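/- **Setting.** Let $0<b\le\infty$ and let $R_1,R_2:[0,b)\to\mathbb R$ be nondecreasing and left-continuous with $R_1(0)=R_2(0)=0$; let $dR_1,dR_2$ be their Lebesgue–Stieltjes measures on $[0,b)$ (so $dR_i([s,t))=R_i(t)-R_i(s)$) and $\int_0^x:=\int_{[0,x)}$. Assume that $R_1$ and $R_2$ have no common points of discontinuity, and that for some $b_0<b$ the functions $1$ and $R_1$ are linearly independent in $L^2(R_2,[0,b_0))$. Let $\mathcal T$ be the set of triples $(u_1,u_2,f)$ of complex functions on $[0,b)$ with $u_1,f$ square integrable with respect to $dR_2$ and $$u_1(x)=u_1(0)+\int_0^x u_2\,dR_1,\qquad u_2(x)=u_2(0)-\int_0^x f\,dR_2\qquad(0\le x<b).$$ With $\pi$ the passage to classes in $L^2(R_2)$, let $T_{\max}=\{(\pi u_1,\pi f):(u_1,u_2,f)\in\mathcal T\}$, a linear relation in $L^2(R_2)$, and let $T=T_{\min}$ be the closure of the set of those elements of $T_{\max}$ for which $u_1,f$ have compact support in $[0,b)$ and $u_1(0)=u_2(0)=0$. Let $c(\cdot,\lambda)$, $s(\cdot,\lambda)$ be the solutions of the homogeneous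 system ($f=\lambda u_1$) with $(c_1,c_2)(0,\lambda)=(1,0)$ and $(s_1,s_2)(0,\lambda)=(0,1)$; these exist for every $\lambda\in\mathbb C$. Assume that the system is in the limit point case at $b$, i.e. $\dim\ker(T_{\max}-\lambda I)=1$ for non-real $\lambda$. A *Stieltjes function* is a holomorphic function $m$ on $\mathbb C\setminus[0,\infty)$ with $\operatorname{Im}m\ge0$ on the upper half-plane, $m(\bar\lambda)=\overline{m(\lambda)}$, and $m(\lambda)\ge0$ for $\lambda<0$. A *boundary triple* $(\mathbb C,\Gamma_0,\Gamma_1)$ for $T^*$ consists of linear maps $\Gamma_0,\Gamma_1:T^*\to\mathbb C$ such that $(\Gamma_0,\Gamma_1)$ is onto $\mathbb C^2$ and $\langle f,v\rangle-\langle u,g\rangle=\Gamma_1\mathbf u\,\overline{\Gamma_0\mathbf v}-\Gamma_0\mathbf u\,\overline{\Gamma_1\mathbf v}$ for all $\mathbf u=(u,f),\mathbf v=(v,g)\in T^*$. Its *Weyl function* $m$ is defined for $\lambda\in\rho(\ker\Gamma_0)$ by $m(\lambda)\Gamma_0\mathbf u=\Gamma_1\mathbf u$ for all $\mathbf u=(u,\lambda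 u)\in T^*$. **Proposition.** Under these assumptions: 1. $T$ is a symmetric nonnegative linear relation in $L^2(R_2)$ with deficiency indices $(1,1)$, and $T^*=T_{\max}$. 2. $\Gamma_0\mathbf u=u_2(0)$, $\Gamma_1\mathbf u=-u_1(0)$ are well defined on $T^*=T_{\max}$, and $(\mathbb C,\Gamma_0,\Gamma_1)$ is a boundary triple for $T^*$. 3. For each non-real $\lambda$ there is exactly one $m_N(\lambda)\in\mathbb C$ (the Neumann $m$-function) such that $\psi(\cdot,\lambda)=s(\cdot,\lambda)-m_N(\lambda)c(\cdot,\lambda)$ has first component $\psi_1(\cdot,\lambda)\in\mathcal L^2(R_2)$; $\ker(T^*-\lambda I)$ is spanned by $\psi_1(\cdot,\lambda)$, and the Weyl function $m$ of this boundary triple satisfies $m(\lambda)=-\psi_1(0,\lambda)/\psi_2(0,\lambda)=m_N(\lambda)$. 4. $\mathbb C\setminus[0,\infty)\subseteq\rho(\ker\Gamma_0)$; for every $\lambda\in\mathbb C\setminus[0,\infty)$ the limit $q(\lambda)=\lim_{x\to b}s_1(x,\lambda)/c_1(x,\lambda)$ (the principal Titchmarsh–Weyl coefficient) exists and equals $m(\lambda)$;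 and $m$ is a Stieltjes function. 5. If $R_2(b):=\lim_{x\to b}R_2(x)<\infty$, then $m(\lambda)=-\dfrac{1}{R_2(b)\,\lambda}+\widetilde m(\lambda)$ for $\lambda\in\mathbb C\setminus[0,\infty)$, where $\widetilde m$ is a Stieltjes function with $\lim_{y\downarrow0}y\,\widetilde m(iy)=0$. -/

import Mathlib

open MeasureTheory Set Filter Topology Complex
open scoped ENNReal ComplexConjugate

noncomputable section

/-! ### Linear relations, boundary triples, Weyl functions, Stieltjes functions -/

section LinearRelations

variable {H : Type*} [NormedAddCommGroup H] [InnerProductSpace ℂ H]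

/-- A linear relation in `H` is a linear subspace of `H × H`; its adjoint is Mathlib's
`Submodule.adjoint`. A relation is symmetric if it is contained in its adjoint. -/
def IsSymmetricRelation (T : Submodule ℂ (H × H)) : Prop :=
  T ≤ T.adjoint

/-- `⟨f, u⟩ ≥ 0` for all `(u, f) ∈ T`. (Mathlib's inner product is linear in the second slot.) -/
def IsNonnegativeRelation (T : Submodule ℂ (H × H)) : Prop :=
  ∀ u f : H, (u, f) ∈ T → 0 ≤ (inner ℂ u f).re ∧ (inner ℂ u f).im = 0

/-- `ker (A - z I) = {u | (u, z u) ∈ A}`. -/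
def eigenKernel (A : Submodule ℂ (H × H)) (z : ℂ) : Submodule ℂ H :=
  A.comap (LinearMap.prod LinearMap.id (z • LinearMap.id))

/-- `n₊(T) = dim ker (T* - i I)`. -/
def deficiencyPlus (T : Submodule ℂ (H × H)) : Cardinal :=
  Module.rank ℂ (eigenKernel T.adjoint Complex.I)

/-- `n₋(T) = dim ker (T* + i I)`. -/
def deficiencyMinus (T : Submodule ℂ (H × H)) : Cardinal :=
  Module.rank ℂ (eigenKernel T.adjoint (-Complex.I))

/-- `z ∈ ρ(A)`: `ker (A - z I) = {0}` and `ran (A - z I) = H`. -/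
def IsRegularPoint (A : Submodule ℂ (H × H)) (z : ℂ) : Prop :=
  (∀ u : H, (u, z • u) ∈ A → u = 0) ∧ ∀ w : H, ∃ u f : H, (u, f) ∈ A ∧ f - z • u = w

/-- `(ℂ, Γ₀, Γ₁)` is a boundary triple for `T*`: the abstract Green identity
`⟨f, v⟩ - ⟨u, g⟩ = Γ₁ 𝐮 conj(Γ₀ 𝐯) - Γ₀ 𝐮 conj(Γ₁ 𝐯)` holds for all `𝐮 = (u, f)`, `𝐯 = (v, g)`
in `T*`, and `(Γ₀, Γ₁) : T* → ℂ²` is onto. -/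
def IsBoundaryTriple (T : Submodule ℂ (H × H)) (Γ₀ Γ₁ : T.adjoint →ₗ[ℂ] ℂ) : Prop :=
  (∀ p q : T.adjoint,
    inner ℂ (q : H × H).1 (p : H × H).2 - inner ℂ (q : H × H).2 (p : H × H).1
      = Γ₁ p * conj (Γ₀ q) - Γ₀ p * conj (Γ₁ q)) ∧
  Function.Surjective fun p : T.adjoint => (Γ₀ p, Γ₁ p)

/-- The extension `A₀ = ker Γ₀` of `T`, as a linear relation in `H`. -/
def kernelRelation {T : Submodule ℂ (H × H)} (Γ₀ : T.adjoint →ₗ[ℂ] ℂ) : Submodule ℂ (H × H) :=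
  (LinearMap.ker Γ₀).map T.adjoint.subtype

/-- `m` is the Weyl function of `T` corresponding to `(ℂ, Γ₀, Γ₁)`: for every `z ∈ ρ(A₀)`, `m z` is
the one and only scalar `w` with `w Γ₀ 𝐮 = Γ₁ 𝐮` for all `𝐮 = (u, z u) ∈ T*`. -/
def IsWeylFunction {T : Submodule ℂ (H × H)} (Γ₀ Γ₁ : T.adjoint →ₗ[ℂ] ℂ) (m : ℂ → ℂ) : Prop :=
  ∀ z : ℂ, IsRegularPoint (kernelRelation Γ₀) z → ∀ w : ℂ,
    (∀ p : T.adjoint, (p : H × H).2 = z • (p : H × H).1 → w * Γ₀ p = Γ₁ p) ↔ w = m z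

end LinearRelations

/-- `ℂ \ [0, ∞)`. -/
def cutPlane : Set ℂ := {z | ¬ (z.im = 0 ∧ 0 ≤ z.re)}

/-- Stieltjes functions, as functions on `ℂ \ [0, ∞)`: Herglotz–Nevanlinna functions that are
holomorphic across the negative half-line and nonnegative on it. -/
def IsStieltjesFn (m : ℂ → ℂ) : Prop :=
  DifferentiableOn ℂ m cutPlane ∧
  (∀ z : ℂ, 0 < z.im → 0 ≤ (m z).im) ∧
  (∀ z : ℂ, z.im ≠ 0 → m (conj z) = conj (m z)) ∧
  ∀ x : ℝ, x < 0 → 0 ≤ (m x).re ∧ (m x).im = 0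

/-! ### Lebesgue–Stieltjes measures on `[0, b)` -/

/-- The interval `[0, b)`, with `b ≤ ∞`. -/
def halfOpen (b : EReal) : Set ℝ := {x | 0 ≤ x ∧ (x : EReal) < b}

/-- The half-line `(-∞, b)`. -/
def below (b : EReal) : Set ℝ := {x | (x : EReal) < b}

instance below_ordConnected (b : EReal) : OrdConnected (below b) :=
  ⟨fun _ _ _ hy _ hz => lt_of_le_of_lt (EReal.coe_le_coe_iff.2 hz.2) hy⟩

theorem below_isCompact_Icc (b : EReal) (x y : below b) : IsCompact (Icc x y) := by
  rw [Subtype.isCompact_iff]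
  have : (Subtype.val '' Icc x y : Set ℝ) = Icc (x : ℝ) y := by
    ext t
    constructor
    · rintro ⟨s, hs, rfl⟩
      exact hs
    · intro ht
      exact ⟨⟨t, OrdConnected.out (below_ordConnected b) x.2 y.2 ht⟩, ht, rfl⟩
  rw [this]
  exact isCompact_Icc

instance below_compactIcc (b : EReal) : CompactIccSpace (below b) :=
  ⟨fun {x y} => below_isCompact_Icc b x y⟩

theorem extendByZero_monotone {b : EReal} (hb : 0 < b) {R : ℝ → ℝ}
    (hR : MonotoneOn R (halfOpen b)) :
    Monotone fun x : below b => R (max (x : ℝ) 0) := by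
  have key : ∀ x : below b, max (x : ℝ) 0 ∈ halfOpen b := by
    intro x
    refine ⟨le_max_right _ _, ?_⟩
    rcases max_cases (x : ℝ) 0 with h | h
    · rw [h.1]; exact x.2
    · rw [h.1]; exact_mod_cast hb
  intro x y hxy
  exact hR (key x) (key y) (max_le_max (show (x : ℝ) ≤ y from hxy) le_rfl)

/-- The Lebesgue–Stieltjes measure `dR` on `[0, b)` of a nondecreasing left-continuous function `R`
on `[0, b)`, regarded as a Borel measure on `ℝ` that is carried by `[0, b)`: it satisfies
`dR [s, t) = R t - R s` (see `stieltjesOn_Ico`, `stieltjesOn_compl`).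
`R` is continued to `(-∞, 0)` by its value at `0`. -/
def stieltjesOn {b : EReal} (hb : 0 < b) {R : ℝ → ℝ} (hR : MonotoneOn R (halfOpen b)) :
    Measure ℝ :=
  ((extendByZero_monotone hb hR).stieltjesFunction.measure).map Subtype.val

theorem leftLim_extendByZero {b : EReal} (hb : 0 < b) {R : ℝ → ℝ}
    (hR : MonotoneOn R (halfOpen b)) (x : below b) {l : ℝ}
    (h : Tendsto (fun y : below b => R (max (y : ℝ) 0)) (𝓝[<] x) (𝓝 l)) :
    Function.leftLim (extendByZero_monotone hb hR).stieltjesFunction x = l := by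
  have hlt : (⟨(x : ℝ) - 1, lt_of_le_of_lt (EReal.coe_le_coe_iff.2 (by linarith)) x.2⟩ : below b)
      < x := Subtype.mk_lt_mk.2 (by linarith)
  have hne : (𝓝[<] x).NeBot := nhdsLT_neBot_of_exists_lt ⟨_, hlt⟩
  have e := leftLim_eq_of_tendsto h
  rw [← e] at h
  exact (leftLim_rightLim h).trans e

theorem stieltjesOn_compl {b : EReal} (hb : 0 < b) {R : ℝ → ℝ} (hR : MonotoneOn R (halfOpen b)) :
    stieltjesOn hb hR (halfOpen b)ᶜ = 0 := by
  have hmeas : MeasurableSet (halfOpen b) :=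
    measurableSet_Ici.inter (measurableSet_lt measurable_coe_real_ereal measurable_const)
  rw [stieltjesOn, Measure.map_apply measurable_subtype_coe hmeas.compl]
  have hll : ∀ x : below b, (x : ℝ) ≤ 0 →
      Function.leftLim (extendByZero_monotone hb hR).stieltjesFunction x = R 0 := by
    intro x hx
    refine leftLim_extendByZero hb hR x (tendsto_const_nhds.congr' ?_)
    filter_upwards [self_mem_nhdsWithin] with y hy
    rw [max_eq_right ((le_of_lt (show (y : ℝ) < x from hy)).trans hx)]
  have h0 : (0 : ℝ) ∈ below b := by simpa [below] using hb
  have hn : ∀ n : ℕ, -(n : ℝ) ∈ below b := fun n =>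
    lt_of_le_of_lt (EReal.coe_le_coe_iff.2 (by simp)) h0
  refine measure_mono_null (t := ⋃ n : ℕ, Ico (⟨-(n : ℝ), hn n⟩ : below b) ⟨0, h0⟩) ?_ ?_
  · intro x hx
    have hx0 : (x : ℝ) < 0 := by
      by_contra hc
      exact hx ⟨not_lt.1 hc, x.2⟩
    obtain ⟨n, hn'⟩ := exists_nat_ge (-(x : ℝ))
    exact mem_iUnion.2 ⟨n, Subtype.mk_le_mk.2 (by linarith), hx0⟩
  · refine measure_iUnion_null fun n => ?_
    rw [StieltjesFunction.measure_Ico, hll _ le_rfl, hll _ (by simp)]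
    simp

theorem stieltjesOn_Ico {b : EReal} (hb : 0 < b) {R : ℝ → ℝ} (hR : MonotoneOn R (halfOpen b))
    (hl : ∀ x ∈ halfOpen b, ContinuousWithinAt R (Icc 0 x) x) {s t : ℝ} (hs : 0 ≤ s) (hst : s ≤ t)
    (ht : (t : EReal) < b) :
    stieltjesOn hb hR (Ico s t) = ENNReal.ofReal (R t - R s) := by
  have hsb : s ∈ below b := lt_of_le_of_lt (EReal.coe_le_coe_iff.2 hst) ht
  have hll : ∀ x : below b, 0 ≤ (x : ℝ) →
      Function.leftLim (extendByZero_monotone hb hR).stieltjesFunction x = R x := by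
    intro x hx
    refine leftLim_extendByZero hb hR x ((hl x ⟨hx, x.2⟩).tendsto.comp
      (tendsto_nhdsWithin_iff.2 ⟨?_, ?_⟩))
    · have hc : Continuous fun y : below b => max (y : ℝ) 0 := by fun_prop
      have h3 := hc.tendsto x
      rw [max_eq_left hx] at h3
      exact h3.mono_left nhdsWithin_le_nhds
    · filter_upwards [self_mem_nhdsWithin] with y hy
      exact ⟨le_max_right _ _, max_le (le_of_lt hy) hx⟩
  rw [stieltjesOn, Measure.map_apply measurable_subtype_coe measurableSet_Ico]
  have hpre : (Subtype.val ⁻¹' Ico s t : Set (below b)) = Ico ⟨s, hsb⟩ ⟨t, ht⟩ := by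
    ext y; rfl
  rw [hpre, StieltjesFunction.measure_Ico, hll ⟨t, ht⟩ (hs.trans hst), hll ⟨s, hsb⟩ hs]

/-! ### Integral systems -/

/-- The data of an integral system `S[R₁, R₂]` on `[0, b)`, `0 < b ≤ ∞`: nondecreasing
left-continuous functions `R₁`, `R₂` on `[0, b)` that vanish at `0`. Values of `R₁`, `R₂` outside
`[0, b)` play no role. -/
structure IntegralSystem where
  b : EReal
  b_pos : 0 < b
  R₁ : ℝ → ℝ
  R₂ : ℝ → ℝ
  monotoneOn₁ : MonotoneOn R₁ (halfOpen b)
  monotoneOn₂ : MonotoneOn R₂ (halfOpen b)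
  leftCont₁ : ∀ x ∈ halfOpen b, ContinuousWithinAt R₁ (Icc 0 x) x
  leftCont₂ : ∀ x ∈ halfOpen b, ContinuousWithinAt R₂ (Icc 0 x) x
  R₁_zero : R₁ 0 = 0
  R₂_zero : R₂ 0 = 0

namespace IntegralSystem

variable (S : IntegralSystem)

/-- The interval `[0, b)`. -/
def I : Set ℝ := halfOpen S.b

/-- The measure `dR₁`. -/
def dR₁ : Measure ℝ := stieltjesOn S.b_pos S.monotoneOn₁

/-- The measure `dR₂`. -/
def dR₂ : Measure ℝ := stieltjesOn S.b_pos S.monotoneOn₂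

/-- The Hilbert space `L²(R₂)`. -/
abbrev L2 : Type := Lp ℂ 2 S.dR₂

/-- The filter `x → b`, `x < b`. -/
def toEnd : Filter ℝ := comap (fun x : ℝ => (x : EReal)) (𝓝[<] S.b)

/-- `R₁` and `R₂` have no common points of discontinuity in `[0, b)`. -/
def NoCommonDiscontinuity : Prop :=
  ∀ x ∈ S.I, ContinuousWithinAt S.R₁ S.I x ∨ ContinuousWithinAt S.R₂ S.I x

/-- For some `b₀ < b` the functions `1` and `R₁` are linearly independent in `L²(R₂, [0, b₀))`. -/
def IsDefinite : Prop :=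
  ∃ b₀ ∈ S.I, ∀ α β : ℂ,
    (∀ᵐ x ∂(S.dR₂.restrict (Ico 0 b₀)), α + β * (S.R₁ x : ℂ) = 0) → α = 0 ∧ β = 0

/-- The integral equation
`u₁ x = u₁ 0 + ∫_[0,x) u₂ dR₁`, `u₂ x = u₂ 0 - ∫_[0,x) g dR₂` for all `x ∈ [0, b)`,
with convergent integrals. -/
def IsIntegralSolution (u₁ u₂ g : ℝ → ℂ) : Prop :=
  ∀ x ∈ S.I, IntegrableOn u₂ (Ico 0 x) S.dR₁ ∧ IntegrableOn g (Ico 0 x) S.dR₂ ∧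
    u₁ x = u₁ 0 + ∫ t in Ico 0 x, u₂ t ∂S.dR₁ ∧
    u₂ x = u₂ 0 - ∫ t in Ico 0 x, g t ∂S.dR₂

/-- `(u₁, u₂)` solves the homogeneous system with spectral parameter `z`. -/
def IsSolution (z : ℂ) (u₁ u₂ : ℝ → ℂ) : Prop :=
  S.IsIntegralSolution u₁ u₂ (fun t => z * u₁ t)

/-- `c(·, z)`, `s(·, z)` are the solutions with `c(0, z) = (1, 0)`, `s(0, z) = (0, 1)`. -/
def IsFundamentalSystem (c₁ c₂ s₁ s₂ : ℂ → ℝ → ℂ) : Prop :=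
  ∀ z : ℂ, (S.IsSolution z (c₁ z) (c₂ z) ∧ c₁ z 0 = 1 ∧ c₂ z 0 = 0) ∧
    (S.IsSolution z (s₁ z) (s₂ z) ∧ s₁ z 0 = 0 ∧ s₂ z 0 = 1)

/-- The set `𝒯` of triples `(u₁, u₂, f)` with `u₁, f` square integrable with respect to `dR₂` that
satisfy the inhomogeneous integral system. -/
def MemT (u₁ u₂ f : ℝ → ℂ) : Prop :=
  MemLp u₁ 2 S.dR₂ ∧ MemLp f 2 S.dR₂ ∧ S.IsIntegralSolution u₁ u₂ f

/-- `(u₁, u₂, f) ∈ 𝒯` and `p = (π u₁, π f)`, with `π` the passage to classes in `L²(R₂)`. -/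
def Represents (u₁ u₂ f : ℝ → ℂ) (p : S.L2 × S.L2) : Prop :=
  S.MemT u₁ u₂ f ∧ p.1 =ᵐ[S.dR₂] u₁ ∧ p.2 =ᵐ[S.dR₂] f

variable {S}

theorem Represents.zero : S.Represents 0 0 0 0 := by
  refine ⟨⟨MemLp.zero, MemLp.zero, fun x _ => ?_⟩, Lp.coeFn_zero _ _ _, Lp.coeFn_zero _ _ _⟩
  refine ⟨integrable_zero _ _ _, integrable_zero _ _ _, ?_, ?_⟩ <;> simp

theorem Represents.add {u₁ u₂ f v₁ v₂ g : ℝ → ℂ} {p q : S.L2 × S.L2}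
    (hp : S.Represents u₁ u₂ f p) (hq : S.Represents v₁ v₂ g q) :
    S.Represents (u₁ + v₁) (u₂ + v₂) (f + g) (p + q) := by
  obtain ⟨⟨hu, hf, hs⟩, e₁, e₂⟩ := hp
  obtain ⟨⟨hv, hg, ht⟩, e₃, e₄⟩ := hq
  refine ⟨⟨hu.add hv, hf.add hg, fun x hx => ?_⟩, (Lp.coeFn_add _ _).trans (e₁.add e₃),
    (Lp.coeFn_add _ _).trans (e₂.add e₄)⟩
  obtain ⟨i₁, i₂, h₁, h₂⟩ := hs x hx
  obtain ⟨j₁, j₂, k₁, k₂⟩ := ht x hx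
  refine ⟨i₁.add j₁, i₂.add j₂, ?_, ?_⟩
  · simp only [Pi.add_apply]
    rw [integral_add i₁ j₁, h₁, k₁]
    ring
  · simp only [Pi.add_apply]
    rw [integral_add i₂ j₂, h₂, k₂]
    ring

theorem Represents.smul {u₁ u₂ f : ℝ → ℂ} {p : S.L2 × S.L2} (a : ℂ)
    (hp : S.Represents u₁ u₂ f p) : S.Represents (a • u₁) (a • u₂) (a • f) (a • p) := by
  obtain ⟨⟨hu, hf, hs⟩, e₁, e₂⟩ := hp
  refine ⟨⟨hu.const_smul a, hf.const_smul a, fun x hx => ?_⟩,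
    (Lp.coeFn_smul _ _).trans (e₁.const_smul a), (Lp.coeFn_smul _ _).trans (e₂.const_smul a)⟩
  obtain ⟨i₁, i₂, h₁, h₂⟩ := hs x hx
  refine ⟨i₁.smul a, i₂.smul a, ?_, ?_⟩
  · simp only [Pi.smul_apply]
    rw [integral_smul, h₁, smul_add]
  · simp only [Pi.smul_apply]
    rw [integral_smul, h₂, smul_sub]

variable (S)

/-- The maximal relation `T_max = {(π u₁, π f) | (u₁, u₂, f) ∈ 𝒯}`. -/
def Tmax : Submodule ℂ (S.L2 × S.L2) where
  carrier := {p | ∃ u₁ u₂ f, S.Represents u₁ u₂ f p}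
  zero_mem' := ⟨_, _, _, Represents.zero⟩
  add_mem' := by
    rintro p q ⟨_, _, _, hp⟩ ⟨_, _, _, hq⟩
    exact ⟨_, _, _, hp.add hq⟩
  smul_mem' := by
    rintro a p ⟨_, _, _, hp⟩
    exact ⟨_, _, _, hp.smul a⟩

/-- The pre-minimal relation: the elements of `T_max` for which `u₁` and `f` have compact support
in `[0, b)` (that is, vanish `dR₂`-a.e. beyond some `l < b`) and `u₁ 0 = u₂ 0 = 0`. -/
def Tpre : Submodule ℂ (S.L2 × S.L2) where
  carrier := {p | ∃ u₁ u₂ f, S.Represents u₁ u₂ f p ∧ u₁ 0 = 0 ∧ u₂ 0 = 0 ∧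
    ∃ l ∈ S.I, ∀ᵐ x ∂S.dR₂, l < x → u₁ x = 0 ∧ f x = 0}
  zero_mem' := ⟨_, _, _, Represents.zero, rfl, rfl, 0, ⟨le_rfl, by simpa using S.b_pos⟩,
    Eventually.of_forall fun _ _ => ⟨rfl, rfl⟩⟩
  add_mem' := by
    rintro p q ⟨_, _, _, hp, h₁, h₂, l, hl, hc⟩ ⟨_, _, _, hq, k₁, k₂, m, hm, hd⟩
    refine ⟨_, _, _, hp.add hq, by simp [h₁, k₁], by simp [h₂, k₂], max l m, ?_, ?_⟩
    · rcases max_cases l m with h | h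
      · rwa [h.1]
      · rwa [h.1]
    · filter_upwards [hc, hd] with x hx hy hlm
      obtain ⟨a₁, a₂⟩ := hx ((le_max_left _ _).trans_lt hlm)
      obtain ⟨b₁, b₂⟩ := hy ((le_max_right _ _).trans_lt hlm)
      simp [a₁, a₂, b₁, b₂]
  smul_mem' := by
    rintro a p ⟨_, _, _, hp, h₁, h₂, l, hl, hc⟩
    refine ⟨_, _, _, hp.smul a, by simp [h₁], by simp [h₂], l, hl, ?_⟩
    filter_upwards [hc] with x hx hlx
    simp [(hx hlx).1, (hx hlx).2]

/-- The minimal relation `T_min`, the closure of the pre-minimal relation. -/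
def Tmin : Submodule ℂ (S.L2 × S.L2) := S.Tpre.topologicalClosure

/-- `S[R₁, R₂]` is limit point at `b`: `dim ker (T_max - z I) = 1` for non-real `z`. This dimension
does not depend on the non-real number `z`, and the definition asks for it at one such point. -/
def IsLimitPoint : Prop :=
  ∃ z : ℂ, z.im ≠ 0 ∧ Module.finrank ℂ (eigenKernel S.Tmax z) = 1

/-- `m` is the Neumann `m`-function of a limit point system with fundamental system `c, s`: for
every non-real `z`, `m z` is the one and only scalar `w` with `s₁(·, z) - w c₁(·, z) ∈ ℒ²(R₂)`. -/
def IsNeumannFunction (c₁ s₁ : ℂ → ℝ → ℂ) (m : ℂ → ℂ) : Prop :=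
  ∀ z : ℂ, z.im ≠ 0 → ∀ w : ℂ, MemLp (fun x => s₁ z x - w * c₁ z x) 2 S.dR₂ ↔ w = m z

/-- `Γ₀ 𝐮 = u₂(0)` and `Γ₁ 𝐮 = -u₁(0)` for every `𝐮 = (π u₁, π f) ∈ T_min*` and every
representing triple `(u₁, u₂, f) ∈ 𝒯`. -/
def AreBoundaryValues (Γ₀ Γ₁ : S.Tmin.adjoint →ₗ[ℂ] ℂ) : Prop :=
  ∀ (p : S.Tmin.adjoint) (u₁ u₂ f : ℝ → ℂ), S.Represents u₁ u₂ f p →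
    Γ₀ p = u₂ 0 ∧ Γ₁ p = -u₁ 0

end IntegralSystem

end

noncomputable section

/-! ### Linear relations: adjoints, ranges and von Neumann's decomposition. -/

section LinearRelations

variable {H : Type*} [NormedAddCommGroup H] [InnerProductSpace ℂ H]

/-! The analysis is done only for elements with compact support and reaches all of `T*` by a
dimension count, so the boundary behaviour of a general element of `T*` at `b` never has to be
estimated.

Without common jumps, integration by parts has no diagonal term (`mul_eq_add_setIntegral`), which
gives the Lagrange and energy identities on every `[0, x)`. The limit point hypothesis excludes a
regular end `b`, where `c` and `s` would both be square integrable. Therefore the boundary term of a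
compactly supported element vanishes at some point beyond its support (`exists_boundary_eq_zero`),
and Green's identity keeps only the values at `0`. Independence of `1` and `R₁` lets compactly
supported elements take arbitrary values at `0`. It also makes every function orthogonal to `1` and
`R₁` on a large `[0, l)` the right-hand side of an element of `Tpre`. Both inclusions of `T_min* =
T_max` follow (`adjoint_Tmin`).

The pivot is `AreBoundaryValues.mem_Tmin`. By von Neumann's decomposition `T*` is `T` plus the span
of two vectors, while the boundary map vanishes on `T` and is onto `ℂ²`; hence its kernel is exactly
`T`. So each element of `T*` is an element of `T` plus a compactly supported one, and Green's
identity and the inequality `Re ⟨f, u⟩ + Re (Γ₁ 𝐮 conj (Γ₀ 𝐮)) ≥ 0` extend to `T*`.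

The rest is largely abstract. `A₀ = ker Γ₀` is self-adjoint and nonnegative, so `A₀ - z` is bounded
below by the distance from `z` to `[0, ∞)`. The Weyl solutions `γ(z)`, normalised by `Γ₀ = 1`,
satisfy `(z - conj w) ⟨γ(w), γ(z)⟩ = m(z) - conj m(w)` in the convention linear in the second slot
(`weylFn_sub`). This identity gives symmetry, holomorphy and the sign in the upper half-plane; the
inequality gives the sign on the negative axis.

For the system, `γ(z) = s₁ - m c₁`. With `w = s₁(x)/c₁(x)` the solution `s - w c` has first
component zero at `x`, and the energy identity bounds its squared norm on `[0, x)` by `|w|` over the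
distance to `[0, ∞)`. As `c₁` is not square integrable, `w` must tend to `m`. When `R₂(b)` is
finite, the constant `1` spans `ker A₀` and `⟨1, γ(z)⟩ = 1/z`. Cauchy–Schwarz then shows that
removing the pole preserves the Stieltjes property, and the part of `γ(-i)` orthogonal to `1` leaves
no mass at `0`. -/

theorem isClosed_adjoint (A : Submodule ℂ (H × H)) : IsClosed (A.adjoint : Set (H × H)) := by
  have : (A.adjoint : Set (H × H)) =
      ⋂ p ∈ A, {x : H × H | inner ℂ p.2 x.1 - inner ℂ p.1 x.2 = 0} := by
    ext x
    simp [Submodule.mem_adjoint_iff]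
  rw [this]
  refine isClosed_biInter fun p _ => isClosed_eq ?_ continuous_const
  fun_prop

theorem mem_adjoint_iff_inner {A : Submodule ℂ (H × H)} {q : H × H} :
    q ∈ A.adjoint ↔ ∀ p ∈ A, inner ℂ q.1 p.2 = inner ℂ q.2 p.1 := by
  rw [Submodule.mem_adjoint_iff]
  refine ⟨fun h p hp => ?_, fun h a b hab => ?_⟩
  · have := congrArg conj (sub_eq_zero.1 (h p.1 p.2 hp))
    rwa [inner_conj_symm, inner_conj_symm] at this
  · have := congrArg conj (h (a, b) hab)
    rw [inner_conj_symm, inner_conj_symm] at this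
    exact sub_eq_zero.2 this

theorem adjoint_topologicalClosure (A : Submodule ℂ (H × H)) :
    A.topologicalClosure.adjoint = A.adjoint := by
  ext q
  simp only [mem_adjoint_iff_inner]
  refine ⟨fun h p hp => h p (A.le_topologicalClosure hp), fun h => ?_⟩
  have hc : IsClosed {p : H × H | inner ℂ q.1 p.2 = inner ℂ q.2 p.1} :=
    isClosed_eq (by fun_prop) (by fun_prop)
  exact fun p hp => closure_minimal (s := (A : Set (H × H))) h hc hp

/-- `ran (A - z I)`. -/
def rangeSub (A : Submodule ℂ (H × H)) (z : ℂ) : Submodule ℂ H :=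
  A.map (LinearMap.snd ℂ H H - z • LinearMap.fst ℂ H H)

theorem mem_rangeSub {A : Submodule ℂ (H × H)} {z : ℂ} {w : H} :
    w ∈ rangeSub A z ↔ ∃ u f : H, (u, f) ∈ A ∧ f - z • u = w := by
  simp [rangeSub]

theorem mem_orthogonal_rangeSub {A : Submodule ℂ (H × H)} {z : ℂ} {w : H} :
    w ∈ (rangeSub A z)ᗮ ↔ (w, conj z • w) ∈ A.adjoint := by
  rw [Submodule.mem_orthogonal', mem_adjoint_iff_inner]
  constructor
  · intro h p hp
    have := h _ (mem_rangeSub.2 ⟨p.1, p.2, hp, rfl⟩)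
    rw [inner_sub_right, inner_smul_right, sub_eq_zero] at this
    rw [inner_smul_left, this, Complex.conj_conj]
  · intro h v hv
    obtain ⟨u, f, hA, rfl⟩ := mem_rangeSub.1 hv
    have := h _ hA
    simp only [inner_smul_left, Complex.conj_conj] at this
    rw [inner_sub_right, inner_smul_right, this, sub_self]

/-- A lower bound for `f - z u` in terms of `u` also controls `f`, so the map `(u, f) ↦ f - z u` is
antilipschitz on the complete space `A`. -/
theorem isClosed_rangeSub [CompleteSpace H] {A : Submodule ℂ (H × H)}
    (hA : IsClosed (A : Set (H × H))) {z : ℂ} {d : ℝ} (hd : 0 < d)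
    (h : ∀ u f : H, (u, f) ∈ A → d * ‖u‖ ≤ ‖f - z • u‖) :
    IsClosed (rangeSub A z : Set H) := by
  have : CompleteSpace A := hA.completeSpace_coe
  let L : A →L[ℂ] H :=
    (ContinuousLinearMap.snd ℂ H H - z • ContinuousLinearMap.fst ℂ H H).comp A.subtypeL
  have hL : (rangeSub A z : Set H) = range L := by
    ext w
    simp [L, mem_rangeSub]
  have hb : ∀ p : A, ‖p‖ ≤ ((1 + (1 + ‖z‖) * d⁻¹).toNNReal : ℝ) * ‖L p‖ := by
    rintro ⟨⟨u, f⟩, hp⟩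
    have h1 : ‖u‖ ≤ d⁻¹ * ‖f - z • u‖ := by
      rw [inv_mul_eq_div, le_div_iff₀ hd, mul_comm]
      exact h u f hp
    have h2 : ‖f‖ ≤ ‖f - z • u‖ + ‖z‖ * ‖u‖ := by
      simpa [norm_smul] using norm_add_le (f - z • u) (z • u)
    have h3 : ‖z‖ * ‖u‖ ≤ ‖z‖ * (d⁻¹ * ‖f - z • u‖) := by gcongr
    have h4 : 0 ≤ ‖z‖ * (d⁻¹ * ‖f - z • u‖) := by positivity
    have h5 : 0 ≤ d⁻¹ * ‖f - z • u‖ := by positivity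
    have h6 := norm_nonneg (f - z • u)
    rw [Real.coe_toNNReal _ (by positivity)]
    change max ‖u‖ ‖f‖ ≤ _ * ‖f - z • u‖
    refine max_le ?_ ?_ <;> nlinarith
  rw [hL]
  exact (L.antilipschitz_of_bound hb).isClosed_range L.uniformContinuous

/-- Orthogonal projection onto the closed range; its orthogonal complement is `ker (A* - conj z)`.
-/
theorem exists_add_of_isClosed_rangeSub [CompleteSpace H] {A : Submodule ℂ (H × H)} {z : ℂ}
    (h : IsClosed (rangeSub A z : Set H)) (w : H) :
    ∃ u f n : H, (u, f) ∈ A ∧ (n, conj z • n) ∈ A.adjoint ∧ w = f - z • u + n := by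
  have : CompleteSpace (rangeSub A z) := h.completeSpace_coe
  have hw : w ∈ rangeSub A z ⊔ (rangeSub A z)ᗮ := by
    rw [Submodule.sup_orthogonal_of_hasOrthogonalProjection]
    trivial
  obtain ⟨y, hy, n, hn, rfl⟩ := Submodule.mem_sup.1 hw
  obtain ⟨u, f, hA, rfl⟩ := mem_rangeSub.1 hy
  exact ⟨u, f, n, hA, mem_orthogonal_rangeSub.1 hn, rfl⟩

theorem IsSymmetricRelation.inner_eq {T : Submodule ℂ (H × H)} (hT : IsSymmetricRelation T)
    {u f v g : H} (hu : (u, f) ∈ T) (hv : (v, g) ∈ T) : inner ℂ v f = inner ℂ g u :=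
  mem_adjoint_iff_inner.1 (hT hv) _ hu

theorem im_inner_eq_zero_of_eq {u f : H} (h : inner ℂ u f = inner ℂ f u) :
    (inner ℂ u f).im = 0 := by
  rw [← inner_conj_symm f u] at h
  exact Complex.conj_eq_iff_im.1 h.symm

/-- Symmetry makes `⟨u, f⟩` real, so the imaginary part of `⟨u, f - z u⟩` is `-Im z ‖u‖²`;
Cauchy–Schwarz finishes. -/
theorem IsSymmetricRelation.norm_le {T : Submodule ℂ (H × H)} (hT : IsSymmetricRelation T)
    (z : ℂ) {u f : H} (hu : (u, f) ∈ T) : |z.im| * ‖u‖ ≤ ‖f - z • u‖ := by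
  rcases eq_or_ne u 0 with rfl | h0
  · simp
  have h1 := im_inner_eq_zero_of_eq (hT.inner_eq hu hu)
  have h2 : (inner ℂ u (f - z • u)).im = -(z.im * ‖u‖ ^ 2) := by
    rw [inner_sub_right, inner_smul_right, inner_self_eq_norm_sq_to_K, Complex.sub_im, h1]
    simp [← Complex.ofReal_pow]
  have h3 : |z.im| * ‖u‖ ^ 2 ≤ ‖u‖ * ‖f - z • u‖ := by
    calc |z.im| * ‖u‖ ^ 2 = |(inner ℂ u (f - z • u)).im| := by
          rw [h2, abs_neg, abs_mul, abs_of_nonneg (sq_nonneg ‖u‖)]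
      _ ≤ _ := (Complex.abs_im_le_norm _).trans (norm_inner_le_norm _ _)
  have h4 : 0 < ‖u‖ := norm_pos_iff.2 h0
  nlinarith

/-- Von Neumann's decomposition `T* = T + N_z + N_{conj z}` at a non-real point `z`. -/
theorem exists_vonNeumann [CompleteSpace H] {T : Submodule ℂ (H × H)}
    (hc : IsClosed (T : Set (H × H))) (hT : IsSymmetricRelation T) {z : ℂ} (hz : z.im ≠ 0)
    {p : H × H} (hp : p ∈ T.adjoint) :
    ∃ t ∈ T, ∃ n k : H, (n, z • n) ∈ T.adjoint ∧ (k, conj z • k) ∈ T.adjoint ∧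
      p = t + (n, z • n) + (k, conj z • k) := by
  have hcl : IsClosed (rangeSub T (conj z) : Set H) :=
    isClosed_rangeSub hc (d := |z.im|) (abs_pos.2 hz) fun u f hu => by
      simpa using hT.norm_le (conj z) hu
  -- The vector `p.2 - conj z • p.1` is split along `ran (T - conj z)` and `ker (T* - z)`. On `(n, z
  -- n)` the map `(u, f) ↦ f - conj z u` acts as multiplication by `z - conj z`, whence the factor
  -- `a`; the remainder is annihilated by it.
  obtain ⟨v, g, n, hvg, hn, hw⟩ := exists_add_of_isClosed_rangeSub hcl (p.2 - conj z • p.1)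
  rw [Complex.conj_conj] at hn
  have hzz : z - conj z ≠ 0 := by
    intro h
    apply hz
    have := congrArg Complex.im h
    simp at this
    linarith
  set a := (z - conj z)⁻¹ with ha
  have hn' : (a • n, z • a • n) ∈ T.adjoint := by
    have := T.adjoint.smul_mem a hn
    rwa [Prod.smul_mk, smul_comm] at this
  have hk : p.2 - g - z • a • n = conj z • (p.1 - v - a • n) := by
    have : n = (z - conj z) • a • n := by rw [smul_smul, mul_inv_cancel₀ hzz, one_smul]
    have e : p.2 = g - conj z • v + (z - conj z) • a • n + conj z • p.1 := by
      rw [← this, ← hw]; abel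
    rw [e]
    simp only [sub_smul, smul_sub]
    abel
  refine ⟨(v, g), hvg, a • n, p.1 - v - a • n, hn', ?_, ?_⟩
  · rw [← hk]
    exact T.adjoint.sub_mem (T.adjoint.sub_mem hp (hT hvg)) hn'
  · rw [← hk]
    ext <;> simp

/-! ### Boundary triples with a nonnegative form -/

variable {T : Submodule ℂ (H × H)} {Γ₀ Γ₁ : T.adjoint →ₗ[ℂ] ℂ}

theorem mem_kernelRelation {p : H × H} :
    p ∈ kernelRelation Γ₀ ↔ ∃ h : p ∈ T.adjoint, Γ₀ ⟨p, h⟩ = 0 := by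
  simp [kernelRelation]

theorem IsBoundaryTriple.kernelRelation_symmetric (hB : IsBoundaryTriple T Γ₀ Γ₁) :
    IsSymmetricRelation (kernelRelation Γ₀) := by
  intro q hq
  obtain ⟨hq, hq0⟩ := mem_kernelRelation.1 hq
  rw [mem_adjoint_iff_inner]
  intro p hp
  obtain ⟨hp, hp0⟩ := mem_kernelRelation.1 hp
  have := hB.1 ⟨p, hp⟩ ⟨q, hq⟩
  rw [hp0, hq0] at this
  simpa [sub_eq_zero] using this

/-- Testing against an element with boundary values `(0, 1)` leaves only `conj (Γ₀ q)` in Green's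
identity. Together with symmetry this makes `ker Γ₀` self-adjoint. -/
theorem IsBoundaryTriple.adjoint_kernelRelation_le (hB : IsBoundaryTriple T Γ₀ Γ₁)
    (hT : T ≤ kernelRelation Γ₀) : (kernelRelation Γ₀).adjoint ≤ kernelRelation Γ₀ := by
  intro q hq
  rw [mem_adjoint_iff_inner] at hq
  have hqT : q ∈ T.adjoint := mem_adjoint_iff_inner.2 fun p hp => hq p (hT hp)
  obtain ⟨p, hp⟩ := hB.2 (0, 1)
  obtain ⟨hp0, hp1⟩ := Prod.mk.inj hp
  have h1 := hq p (mem_kernelRelation.2 ⟨p.2, hp0⟩)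
  have h2 := hB.1 p ⟨q, hqT⟩
  rw [hp0, hp1] at h2
  refine mem_kernelRelation.2 ⟨hqT, ?_⟩
  simp [h1] at h2
  exact (map_eq_zero (starRingEnd ℂ)).1 h2.symm

/-- The spectral hypotheses on a boundary triple: `T ⊆ ker Γ₀`, and the form
`Re ⟨f, u⟩ + Re (Γ₁ 𝐮 conj (Γ₀ 𝐮))` is nonnegative on `T*`. -/
structure IsNonnegTriple (T : Submodule ℂ (H × H)) (Γ₀ Γ₁ : T.adjoint →ₗ[ℂ] ℂ) : Prop where
  triple : IsBoundaryTriple T Γ₀ Γ₁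
  le : T ≤ kernelRelation Γ₀
  nonneg : ∀ p : T.adjoint, 0 ≤ (inner ℂ (p : H × H).1 (p : H × H).2).re
    + (Γ₁ p * conj (Γ₀ p)).re

/-! ### The cut plane and the distance to `[0, ∞)`; regularity of `ker Γ₀` there. -/

theorem isOpen_cutPlane : IsOpen cutPlane := by
  have : IsClosed {z : ℂ | z.im = 0 ∧ 0 ≤ z.re} :=
    (isClosed_eq Complex.continuous_im continuous_const).inter
      (isClosed_le continuous_const Complex.continuous_re)
  exact this.isOpen_compl

theorem mem_cutPlane_of_im_ne {z : ℂ} (h : z.im ≠ 0) : z ∈ cutPlane := fun h' => h h'.1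

theorem conj_mem_cutPlane {z : ℂ} (h : z ∈ cutPlane) : conj z ∈ cutPlane := by
  simpa [cutPlane] using h

theorem cutPlane_ne_zero {z : ℂ} (h : z ∈ cutPlane) : z ≠ 0 := by
  rintro rfl
  simp [cutPlane] at h

theorem infDist_cutPlane_pos {z : ℂ} (h : z ∈ cutPlane) : 0 < Metric.infDist z cutPlaneᶜ :=
  (isOpen_cutPlane.isClosed_compl.notMem_iff_infDist_pos ⟨0, by simp [cutPlane]⟩).1 (by simpa)

theorem infDist_cutPlane_le (z : ℂ) {a : ℝ} (ha : 0 ≤ a) :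
    Metric.infDist z cutPlaneᶜ ≤ ‖(a : ℂ) - z‖ := by
  rw [← dist_eq_norm, dist_comm]
  exact Metric.infDist_le_dist_of_mem (by simp [cutPlane, ha])

/-- The quotient `⟨u, f⟩ / ‖u‖²` is a point of `[0, ∞)`, and `⟨u, f - z u⟩` is its difference from
`z` times `‖u‖²`. -/
theorem infDist_mul_norm_le {u f : H} (h₁ : (inner ℂ u f).im = 0) (h₂ : 0 ≤ (inner ℂ u f).re)
    (z : ℂ) : Metric.infDist z cutPlaneᶜ * ‖u‖ ≤ ‖f - z • u‖ := by
  rcases eq_or_ne u 0 with rfl | h0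
  · simp
  have h4 : 0 < ‖u‖ := norm_pos_iff.2 h0
  have h5 : inner ℂ u f = ((inner ℂ u f).re : ℂ) := by
    apply Complex.ext <;> simp [h₁]
  have h6 := infDist_cutPlane_le z (a := (inner ℂ u f).re / ‖u‖ ^ 2) (by positivity)
  have h7 : inner ℂ u (f - z • u)
      = ((((inner ℂ u f).re / ‖u‖ ^ 2 : ℝ) : ℂ) - z) * (‖u‖ ^ 2 : ℝ) := by
    rw [inner_sub_right, inner_smul_right, inner_self_eq_norm_sq_to_K, sub_mul,
      ← Complex.ofReal_mul, div_mul_cancel₀ _ (by positivity), ← h5]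
    simp
  have h8 := norm_inner_le_norm (𝕜 := ℂ) u (f - z • u)
  rw [h7, norm_mul, Complex.norm_real, Real.norm_of_nonneg (sq_nonneg _)] at h8
  have h9 : Metric.infDist z cutPlaneᶜ * ‖u‖ ^ 2 ≤ ‖u‖ * ‖f - z • u‖ :=
    (mul_le_mul_of_nonneg_right h6 (sq_nonneg _)).trans h8
  nlinarith

namespace IsNonnegTriple

variable (hN : IsNonnegTriple T Γ₀ Γ₁)
include hN

theorem isClosed : IsClosed (kernelRelation Γ₀ : Set (H × H)) := by
  have : kernelRelation Γ₀ = (kernelRelation Γ₀).adjoint :=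
    le_antisymm hN.triple.kernelRelation_symmetric (hN.triple.adjoint_kernelRelation_le hN.le)
  rw [this]
  exact isClosed_adjoint _

theorem norm_le (z : ℂ) {u f : H} (h : (u, f) ∈ kernelRelation Γ₀) :
    Metric.infDist z cutPlaneᶜ * ‖u‖ ≤ ‖f - z • u‖ := by
  refine infDist_mul_norm_le
    (im_inner_eq_zero_of_eq (hN.triple.kernelRelation_symmetric.inner_eq h h)) ?_ z
  obtain ⟨h, h0⟩ := mem_kernelRelation.1 h
  simpa [h0] using hN.nonneg ⟨_, h⟩

theorem eq_zero {z : ℂ} (hz : z ∈ cutPlane) {u : H} (h : (u, z • u) ∈ kernelRelation Γ₀) :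
    u = 0 := by
  have := hN.norm_le z h
  rw [sub_self, norm_zero] at this
  have h2 := infDist_cutPlane_pos hz
  have h3 := norm_nonneg u
  exact norm_eq_zero.1 (by nlinarith)

/-- The range of `A₀ - z` is closed by the lower bound, and its complement is a kernel of `A₀* ⊆ A₀`
at `conj z`, which is trivial by the same bound. -/
theorem isRegularPoint [CompleteSpace H] {z : ℂ} (hz : z ∈ cutPlane) :
    IsRegularPoint (kernelRelation Γ₀) z := by
  refine ⟨fun u hu => hN.eq_zero hz hu, fun w => ?_⟩
  obtain ⟨u, f, n, hA, hn, rfl⟩ := exists_add_of_isClosed_rangeSub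
    (isClosed_rangeSub hN.isClosed (infDist_cutPlane_pos hz) fun u f h => hN.norm_le z h) w
  have := hN.eq_zero (conj_mem_cutPlane hz) (hN.triple.adjoint_kernelRelation_le hN.le hn)
  exact ⟨u, f, hA, by simp [this]⟩

end IsNonnegTriple

/-- A Weyl solution: an element `(u, z u)` of `T*` with `Γ₀ (u, z u) = 1`. -/
def IsWeylSolution (Γ₀ : T.adjoint →ₗ[ℂ] ℂ) (z : ℂ) (p : T.adjoint) : Prop :=
  (p : H × H).2 = z • (p : H × H).1 ∧ Γ₀ p = 1

/-- An arbitrary element with `Γ₀ = 1` is corrected by a resolvent term from `ker Γ₀`, which leaves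
`Γ₀` unchanged. -/
theorem exists_isWeylSolution (hB : IsBoundaryTriple T Γ₀ Γ₁) {z : ℂ}
    (hz : IsRegularPoint (kernelRelation Γ₀) z) : ∃ p, IsWeylSolution Γ₀ z p := by
  obtain ⟨q, hq⟩ := hB.2 (1, 0)
  obtain ⟨v, g, hvg, e⟩ := hz.2 ((q : H × H).2 - z • (q : H × H).1)
  obtain ⟨hm, h0⟩ := mem_kernelRelation.1 hvg
  refine ⟨q - ⟨_, hm⟩, ?_, ?_⟩
  · simp only [AddSubgroupClass.coe_sub, Prod.snd_sub, Prod.fst_sub, smul_sub]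
    rw [sub_eq_sub_iff_add_eq_add, add_comm, ← sub_eq_sub_iff_add_eq_add, ← neg_inj]
    simpa using e
  · rw [map_sub, h0, sub_zero]
    exact (Prod.mk.inj hq).1

theorem IsWeylSolution.eq_smul {z : ℂ} (hz : IsRegularPoint (kernelRelation Γ₀) z)
    {p q : T.adjoint} (hp : IsWeylSolution Γ₀ z p)
    (hq : (q : H × H).2 = z • (q : H × H).1) : q = Γ₀ q • p := by
  have h1 : Γ₀ (q - Γ₀ q • p) = 0 := by simp [hp.2]
  have h2 : ((q - Γ₀ q • p : T.adjoint) : H × H).2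
      = z • ((q - Γ₀ q • p : T.adjoint) : H × H).1 := by
    simp [hp.1, hq, smul_sub, smul_comm z]
  have h3 : ((q - Γ₀ q • p : T.adjoint) : H × H).1 = 0 := by
    apply hz.1
    rw [← h2]
    exact mem_kernelRelation.2 ⟨(q - Γ₀ q • p : T.adjoint).2, h1⟩
  rw [h3, smul_zero] at h2
  have h4 : q - Γ₀ q • p = 0 := Subtype.ext (Prod.ext h3 h2)
  exact sub_eq_zero.1 h4

open Classical in
/-- The Weyl solution, and `0` where there is none. -/
def weylSolution (Γ₀ : T.adjoint →ₗ[ℂ] ℂ) (z : ℂ) : T.adjoint :=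
  if h : ∃ p, IsWeylSolution Γ₀ z p then h.choose else 0

theorem weylSolution_spec (hB : IsBoundaryTriple T Γ₀ Γ₁) {z : ℂ}
    (hz : IsRegularPoint (kernelRelation Γ₀) z) : IsWeylSolution Γ₀ z (weylSolution Γ₀ z) := by
  have h := exists_isWeylSolution hB hz
  rw [weylSolution, dif_pos h]
  exact h.choose_spec

/-- The Weyl function. -/
def weylFn (Γ₀ Γ₁ : T.adjoint →ₗ[ℂ] ℂ) (z : ℂ) : ℂ := Γ₁ (weylSolution Γ₀ z)

theorem isWeylFunction_weylFn (hB : IsBoundaryTriple T Γ₀ Γ₁) :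
    IsWeylFunction Γ₀ Γ₁ (weylFn Γ₀ Γ₁) := by
  intro z hz w
  have hs := weylSolution_spec hB hz
  constructor
  · intro h
    have := h _ hs.1
    rwa [hs.2, mul_one] at this
  · rintro rfl p hp
    conv_rhs => rw [hs.eq_smul hz hp]
    rw [map_smul, smul_eq_mul, mul_comm]
    rfl

/-- Green's identity for two Weyl solutions. All properties of the Weyl function that do not use the
form are read off from it. -/
theorem IsWeylSolution.sub_conj_mul_inner (hB : IsBoundaryTriple T Γ₀ Γ₁) {z w : ℂ}
    {p q : T.adjoint} (hp : IsWeylSolution Γ₀ z p) (hq : IsWeylSolution Γ₀ w q) :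
    (z - conj w) * inner ℂ (q : H × H).1 (p : H × H).1 = Γ₁ p - conj (Γ₁ q) := by
  have := hB.1 p q
  rw [hp.1, hq.1, hp.2, hq.2, inner_smul_right, inner_smul_left] at this
  simp only [map_one, mul_one, one_mul] at this
  rw [← this]
  ring

theorem rank_eigenKernel_adjoint (hB : IsBoundaryTriple T Γ₀ Γ₁) {z : ℂ}
    (hz : IsRegularPoint (kernelRelation Γ₀) z) :
    (weylSolution Γ₀ z : H × H).1 ≠ 0 ∧
    eigenKernel T.adjoint z = Submodule.span ℂ {(weylSolution Γ₀ z : H × H).1} ∧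
      Module.rank ℂ (eigenKernel T.adjoint z) = 1 := by
  have hs := weylSolution_spec hB hz
  have h0 : (weylSolution Γ₀ z : H × H).1 ≠ 0 := by
    intro h
    have h2 := hs.1
    rw [h, smul_zero] at h2
    have h3 : weylSolution Γ₀ z = 0 := Subtype.ext (Prod.ext h h2)
    have := hs.2
    simp [h3] at this
  have hspan : eigenKernel T.adjoint z = Submodule.span ℂ {(weylSolution Γ₀ z : H × H).1} := by
    ext u
    rw [Submodule.mem_span_singleton]
    constructor
    · intro hu
      have hu' : (u, z • u) ∈ T.adjoint := hu
      have := hs.eq_smul hz (q := ⟨_, hu'⟩) rfl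
      exact ⟨_, (congrArg (fun p : T.adjoint => (p : H × H).1) this).symm⟩
    · rintro ⟨a, rfl⟩
      refine Submodule.smul_mem _ _ ?_
      change ((weylSolution Γ₀ z : H × H).1, z • (weylSolution Γ₀ z : H × H).1) ∈ T.adjoint
      rw [← hs.1]
      exact (weylSolution Γ₀ z).2
  refine ⟨h0, hspan, ?_⟩
  rw [hspan]
  rw [rank_eq_one_iff]
  refine ⟨⟨_, Submodule.mem_span_singleton_self _⟩, fun h => h0 (congrArg Subtype.val h), ?_⟩
  rintro ⟨v, hv⟩
  obtain ⟨a, rfl⟩ := Submodule.mem_span_singleton.1 hv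
  exact ⟨a, rfl⟩

/-! ### The Weyl function is a Stieltjes function. -/

namespace IsNonnegTriple

variable [CompleteSpace H] (hN : IsNonnegTriple T Γ₀ Γ₁)
include hN

theorem weylSolution_spec {z : ℂ} (hz : z ∈ cutPlane) :
    IsWeylSolution Γ₀ z (weylSolution Γ₀ z) :=
  _root_.weylSolution_spec hN.triple (hN.isRegularPoint hz)

theorem weylFn_sub {z w : ℂ} (hz : z ∈ cutPlane) (hw : w ∈ cutPlane) :
    (z - conj w) * inner ℂ (weylSolution Γ₀ w : H × H).1 (weylSolution Γ₀ z : H × H).1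
      = weylFn Γ₀ Γ₁ z - conj (weylFn Γ₀ Γ₁ w) :=
  (hN.weylSolution_spec hz).sub_conj_mul_inner hN.triple (hN.weylSolution_spec hw)

theorem weylFn_conj {z : ℂ} (hz : z ∈ cutPlane) :
    weylFn Γ₀ Γ₁ (conj z) = conj (weylFn Γ₀ Γ₁ z) := by
  have := hN.weylFn_sub (conj_mem_cutPlane hz) hz
  rw [sub_self, zero_mul] at this
  exact sub_eq_zero.1 this.symm

theorem weylFn_im {z : ℂ} (hz : z ∈ cutPlane) :
    (weylFn Γ₀ Γ₁ z).im = z.im * ‖(weylSolution Γ₀ z : H × H).1‖ ^ 2 := by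
  have := congrArg Complex.im (hN.weylFn_sub hz hz)
  rw [inner_self_eq_norm_sq_to_K, Complex.sub_im, Complex.conj_im] at this
  simp [← Complex.ofReal_pow] at this
  linarith

/-- At the Weyl solution the nonnegative form equals `x ‖γ(x)‖² + Re m(x)`. -/
theorem weylFn_re {x : ℝ} (hx : x < 0) :
    -x * ‖(weylSolution Γ₀ (x : ℂ) : H × H).1‖ ^ 2 ≤ (weylFn Γ₀ Γ₁ x).re := by
  have hs := hN.weylSolution_spec (z := (x : ℂ)) (by simp [cutPlane, hx])
  have := hN.nonneg (weylSolution Γ₀ (x : ℂ))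
  rw [hs.1, hs.2, inner_smul_right, inner_self_eq_norm_sq_to_K] at this
  simp [← Complex.ofReal_pow] at this
  change _ ≤ (Γ₁ _).re
  linarith

theorem weylSolution_sub_mem {z w : ℂ} (hz : z ∈ cutPlane) (hw : w ∈ cutPlane) :
    ((weylSolution Γ₀ z - weylSolution Γ₀ w : T.adjoint) : H × H) ∈ kernelRelation Γ₀ :=
  mem_kernelRelation.2 ⟨(weylSolution Γ₀ z - weylSolution Γ₀ w).2, by
    change Γ₀ (weylSolution Γ₀ z - weylSolution Γ₀ w) = 0
    rw [map_sub, (hN.weylSolution_spec hz).2, (hN.weylSolution_spec hw).2, sub_self]⟩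

/-- The difference of two Weyl solutions lies in `A₀`, so this is `γ(z) - γ(w) = (z - w) (A₀ - z)⁻¹
γ(w)` without naming the resolvent. It provides the continuity of `γ` and its growth bound near `0`.
-/
theorem weylSolution_sub_eq {z w : ℂ} (hz : z ∈ cutPlane) (hw : w ∈ cutPlane) :
    (weylSolution Γ₀ z : H × H).2 - (weylSolution Γ₀ w : H × H).2
      - z • ((weylSolution Γ₀ z : H × H).1 - (weylSolution Γ₀ w : H × H).1)
      = (z - w) • (weylSolution Γ₀ w : H × H).1 := by
  rw [(hN.weylSolution_spec hz).1, (hN.weylSolution_spec hw).1, smul_sub, sub_smul]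
  abel

theorem weylSolution_sub_norm_le {z w : ℂ} (hz : z ∈ cutPlane) (hw : w ∈ cutPlane) :
    Metric.infDist z cutPlaneᶜ
        * ‖(weylSolution Γ₀ z : H × H).1 - (weylSolution Γ₀ w : H × H).1‖
      ≤ ‖z - w‖ * ‖(weylSolution Γ₀ w : H × H).1‖ := by
  rw [← norm_smul, ← hN.weylSolution_sub_eq hz hw]
  exact hN.norm_le z (hN.weylSolution_sub_mem hz hw)

theorem continuousAt_weylSolution {w : ℂ} (hw : w ∈ cutPlane) :
    ContinuousAt (fun z => (weylSolution Γ₀ z : H × H).1) w := by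
  rw [ContinuousAt, tendsto_iff_norm_sub_tendsto_zero]
  have hlim : Tendsto (fun z => (Metric.infDist z cutPlaneᶜ)⁻¹
      * (‖z - w‖ * ‖(weylSolution Γ₀ w : H × H).1‖)) (𝓝 w) (𝓝 0) := by
    have : Tendsto (fun z => (Metric.infDist z cutPlaneᶜ)⁻¹
      * (‖z - w‖ * ‖(weylSolution Γ₀ w : H × H).1‖)) (𝓝 w)
      (𝓝 ((Metric.infDist w cutPlaneᶜ)⁻¹ * (‖w - w‖ * ‖(weylSolution Γ₀ w : H × H).1‖))) := by
      refine Tendsto.mul (Tendsto.inv₀ ?_ (infDist_cutPlane_pos hw).ne') ?_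
      · exact (Metric.continuous_infDist_pt _).continuousAt
      · exact ((continuous_id.sub continuous_const).norm.mul continuous_const).continuousAt
    simpa using this
  refine tendsto_of_tendsto_of_tendsto_of_le_of_le' tendsto_const_nhds hlim
    (Eventually.of_forall fun _ => norm_nonneg _) ?_
  filter_upwards [isOpen_cutPlane.mem_nhds hw] with z hz
  rw [inv_mul_eq_div, le_div_iff₀ (infDist_cutPlane_pos hz), mul_comm]
  exact hN.weylSolution_sub_norm_le hz hw

/-- Taking the second point to be `conj w` in `weylFn_sub` turns the difference quotient of `m` at
`w` into `⟨γ(conj w), γ(z)⟩`, which is continuous in `z`. -/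
theorem differentiableOn_weylFn : DifferentiableOn ℂ (weylFn Γ₀ Γ₁) cutPlane := by
  intro w hw
  apply DifferentiableAt.differentiableWithinAt
  have hc := conj_mem_cutPlane hw
  have hg : ContinuousAt (fun z => inner ℂ (weylSolution Γ₀ (conj w) : H × H).1
      (weylSolution Γ₀ z : H × H).1) w :=
    continuousAt_const.inner (hN.continuousAt_weylSolution hw)
  refine HasDerivAt.differentiableAt (f' := inner ℂ (weylSolution Γ₀ (conj w) : H × H).1
      (weylSolution Γ₀ w : H × H).1) ?_
  rw [hasDerivAt_iff_tendsto_slope]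
  refine (hg.tendsto.mono_left nhdsWithin_le_nhds).congr' ?_
  filter_upwards [self_mem_nhdsWithin, mem_nhdsWithin_of_mem_nhds (isOpen_cutPlane.mem_nhds hw)]
    with z hz hz'
  have := hN.weylFn_sub hz' hc
  rw [hN.weylFn_conj hw, Complex.conj_conj, Complex.conj_conj] at this
  rw [slope_def_field, ← this, mul_div_cancel_left₀ _ (sub_ne_zero.2 hz)]

theorem isStieltjesFn_weylFn : IsStieltjesFn (weylFn Γ₀ Γ₁) := by
  refine ⟨hN.differentiableOn_weylFn, fun z hz => ?_,
    fun z hz => hN.weylFn_conj (mem_cutPlane_of_im_ne hz), fun x hx => ⟨?_, ?_⟩⟩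
  · rw [hN.weylFn_im (mem_cutPlane_of_im_ne hz.ne')]
    positivity
  · refine le_trans ?_ (hN.weylFn_re hx)
    exact mul_nonneg (by linarith) (sq_nonneg _)
  · rw [hN.weylFn_im (by simp [cutPlane, hx])]
    simp

/-! ### The singular part at `0` -/

variable {e : H} {q₀ : T.adjoint} (hq : (q₀ : H × H) = (e, 0)) (h₀ : Γ₀ q₀ = 0)
  (h₁ : Γ₁ q₀ = -1)
include hq h₀ h₁

/-- Green's identity against `(e, 0)`, whose boundary values are `(0, -1)`. -/
theorem inner_weylSolution {z : ℂ} (hz : z ∈ cutPlane) :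
    inner ℂ e (weylSolution Γ₀ z : H × H).1 = z⁻¹ := by
  have hs := hN.weylSolution_spec hz
  have := hN.triple.1 (weylSolution Γ₀ z) q₀
  rw [hs.1, hs.2, h₀, h₁, hq, inner_smul_right, inner_zero_left] at this
  simp only [sub_zero, map_zero, mul_zero, map_neg, map_one, zero_sub, one_mul, neg_neg] at this
  exact eq_inv_of_mul_eq_one_right this

theorem inv_le_norm_weylSolution {z : ℂ} (hz : z ∈ cutPlane) :
    (‖e‖ ^ 2)⁻¹ * (Complex.normSq z)⁻¹ ≤ ‖(weylSolution Γ₀ z : H × H).1‖ ^ 2 := by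
  have he : e ≠ 0 := by
    rintro rfl
    have : q₀ = 0 := Subtype.ext hq
    simp [this] at h₁
  have h := norm_inner_le_norm (𝕜 := ℂ) e (weylSolution Γ₀ z : H × H).1
  rw [hN.inner_weylSolution hq h₀ h₁ hz] at h
  rw [inv_mul_le_iff₀ (by positivity), ← mul_pow, Complex.normSq_eq_norm_sq, ← inv_pow,
    ← norm_inv]
  exact pow_le_pow_left₀ (norm_nonneg _) h 2

/-- The added term contributes `-Im z / (‖e‖² |z|²)` to the imaginary part, and the analogous
multiple of `x` on the negative axis. Both are compensated by the Cauchy–Schwarz lower bound for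
`‖γ(z)‖²`. -/
theorem isStieltjesFn_weylFn_add :
    IsStieltjesFn fun z => weylFn Γ₀ Γ₁ z + 1 / (((‖e‖ ^ 2 : ℝ) : ℂ) * z) := by
  have hre : ∀ z : ℂ, (1 / (((‖e‖ ^ 2 : ℝ) : ℂ) * z)).re
      = (‖e‖ ^ 2)⁻¹ * (Complex.normSq z)⁻¹ * z.re := fun z => by
    rw [one_div, mul_inv, ← Complex.ofReal_inv, Complex.re_ofReal_mul, Complex.inv_re]
    ring
  have him : ∀ z : ℂ, (1 / (((‖e‖ ^ 2 : ℝ) : ℂ) * z)).im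
      = -((‖e‖ ^ 2)⁻¹ * (Complex.normSq z)⁻¹ * z.im) := fun z => by
    rw [one_div, mul_inv, ← Complex.ofReal_inv, Complex.im_ofReal_mul, Complex.inv_im]
    ring
  have he : e ≠ 0 := by
    rintro rfl
    have : q₀ = 0 := Subtype.ext hq
    simp [this] at h₁
  refine ⟨hN.differentiableOn_weylFn.add ?_, fun z hz => ?_, fun z hz => ?_,
    fun x hx => ⟨?_, ?_⟩⟩
  · refine DifferentiableOn.div (differentiableOn_const _)
      ((differentiableOn_const _).mul differentiableOn_id) fun z hz => mul_ne_zero ?_ ?_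
    · exact Complex.ofReal_ne_zero.2 (by positivity)
    · exact cutPlane_ne_zero hz
  · have hz' := mem_cutPlane_of_im_ne hz.ne'
    rw [Complex.add_im, hN.weylFn_im hz', him]
    nlinarith [hN.inv_le_norm_weylSolution hq h₀ h₁ hz']
  · simp only [hN.weylFn_conj (mem_cutPlane_of_im_ne hz)]
    simp
  · rw [Complex.add_re, hre]
    have h2 := hN.weylFn_re hx
    have h3 := hN.inv_le_norm_weylSolution hq h₀ h₁ (z := x) (by simp [cutPlane, hx])
    rw [Complex.ofReal_re]
    nlinarith
  · rw [Complex.add_im, him, hN.weylFn_im (by simp [cutPlane, hx])]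
    simp

variable (hker : ∀ u : H, (u, 0) ∈ kernelRelation Γ₀ → ∃ a : ℂ, u = a • e)
include hker

-- The orthogonal complement of `ran A₀` is `ker A₀* ⊆ ker A₀`, which by `hker` lies in the span of
-- `e`.
omit hq h₀ h₁ in
theorem mem_closure_range_of_inner_eq_zero {v : H} (hv : inner ℂ e v = 0) :
    v ∈ closure (rangeSub (kernelRelation Γ₀) 0 : Set H) := by
  rw [← Submodule.topologicalClosure_coe, ← Submodule.orthogonal_orthogonal_eq_closure]
  change v ∈ (rangeSub (kernelRelation Γ₀) 0)ᗮᗮ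
  rw [Submodule.mem_orthogonal]
  intro w hw
  rw [mem_orthogonal_rangeSub, map_zero, zero_smul] at hw
  obtain ⟨a, rfl⟩ := hker w (hN.triple.adjoint_kernelRelation_le hN.le hw)
  rw [inner_smul_left, hv, mul_zero]

-- The symmetric lower bound applied to `γ(iy) - γ(i)` gives `y ‖γ(iy) - γ(i)‖ ≤ (1 - y) ‖γ(i)‖`.
-- The factor `2` is slack.
omit hq h₀ h₁ hker in
theorem mul_norm_weylSolution_le {y : ℝ} (hy : y ∈ Ioo (0 : ℝ) 1) :
    y * ‖(weylSolution Γ₀ (y * Complex.I) : H × H).1‖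
      ≤ 2 * ‖(weylSolution Γ₀ Complex.I : H × H).1‖ := by
  have hz : (y * Complex.I : ℂ) ∈ cutPlane := mem_cutPlane_of_im_ne (by simp [hy.1.ne'])
  have hi : Complex.I ∈ cutPlane := mem_cutPlane_of_im_ne (by simp)
  have h := hN.triple.kernelRelation_symmetric.norm_le (y * Complex.I)
    (u := (weylSolution Γ₀ (y * Complex.I) : H × H).1 - (weylSolution Γ₀ Complex.I : H × H).1)
    (hN.weylSolution_sub_mem hz hi)
  change _ ≤ ‖(weylSolution Γ₀ (y * Complex.I) : H × H).2 - (weylSolution Γ₀ Complex.I : H × H).2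
    - (y * Complex.I : ℂ) • _‖ at h
  rw [hN.weylSolution_sub_eq hz hi, norm_smul] at h
  have e1 : ‖(y * Complex.I - Complex.I : ℂ)‖ = 1 - y := by
    rw [← sub_one_mul, norm_mul, Complex.norm_I, mul_one, ← Complex.ofReal_one,
      ← Complex.ofReal_sub, Complex.norm_real, Real.norm_eq_abs, abs_sub_comm,
      abs_of_pos (by linarith [hy.2])]
  have e2 : |(y * Complex.I : ℂ).im| = y := by simp [abs_of_pos hy.1]
  rw [e1, e2] at h
  have h3 := norm_le_norm_sub_add (weylSolution Γ₀ (y * Complex.I) : H × H).1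
    (weylSolution Γ₀ Complex.I : H × H).1
  have h4 := norm_nonneg (weylSolution Γ₀ Complex.I : H × H).1
  nlinarith [hy.1, hy.2, mul_le_mul_of_nonneg_left h3 hy.1.le]

-- For `g'` in `ran A₀`, with `(h, g')` in `A₀`, Green's identity expresses `⟨g', γ(iy)⟩` as `iy ⟨h,
-- γ(iy)⟩` plus a constant, which is bounded as `y ↓ 0`. Boundedness of `y ‖γ(iy)‖` then permits
-- approximating `v` by such `g'`.
omit hq h₀ h₁ in
theorem tendsto_mul_inner_weylSolution {v : H} (hv : inner ℂ e v = 0) :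
    Tendsto (fun y : ℝ => (y : ℂ) * inner ℂ v (weylSolution Γ₀ (y * Complex.I) : H × H).1)
      (𝓝[>] 0) (𝓝 0) := by
  set K := 2 * ‖(weylSolution Γ₀ Complex.I : H × H).1‖ with hK
  have hK0 : 0 ≤ K := by positivity
  rw [Metric.tendsto_nhds]
  intro ε hε
  obtain ⟨g, hg, hvg⟩ := Metric.mem_closure_iff.1
    (hN.mem_closure_range_of_inner_eq_zero hker hv) (ε / (2 * (K + 1))) (by positivity)
  obtain ⟨h, g', hh, rfl⟩ := mem_rangeSub.1 hg
  rw [zero_smul, sub_zero, dist_eq_norm] at hvg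
  obtain ⟨hm, hm0⟩ := mem_kernelRelation.1 hh
  have hlim : Tendsto (fun y : ℝ => y * (K * ‖h‖ + ‖Γ₁ ⟨_, hm⟩‖)) (𝓝[>] 0) (𝓝 0) := by
    have : Tendsto (fun y : ℝ => y * (K * ‖h‖ + ‖Γ₁ ⟨_, hm⟩‖)) (𝓝 0)
        (𝓝 (0 * (K * ‖h‖ + ‖Γ₁ ⟨_, hm⟩‖))) := by
      exact (continuous_id.mul continuous_const).tendsto 0
    rw [zero_mul] at this
    exact this.mono_left nhdsWithin_le_nhds
  filter_upwards [hlim.eventually_lt_const (half_pos hε), Ioo_mem_nhdsGT one_pos] with y hy1 hy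
  rw [dist_zero_right]
  have hz : (y * Complex.I : ℂ) ∈ cutPlane := mem_cutPlane_of_im_ne (by simp [hy.1.ne'])
  have hs := hN.weylSolution_spec hz
  have hb := hN.mul_norm_weylSolution_le hy
  have hG := hN.triple.1 (weylSolution Γ₀ (y * Complex.I)) ⟨_, hm⟩
  rw [hs.1, hs.2, hm0, map_zero, mul_zero, zero_sub, one_mul, inner_smul_right] at hG
  set u := (weylSolution Γ₀ (y * Complex.I) : H × H).1
  have e1 : inner ℂ g' u = y * Complex.I * inner ℂ h u + conj (Γ₁ ⟨_, hm⟩) := by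
    linear_combination -hG
  have n1 : ‖inner ℂ g' u‖ ≤ y * (‖h‖ * ‖u‖) + ‖Γ₁ ⟨_, hm⟩‖ := by
    rw [e1]
    refine (norm_add_le _ _).trans (add_le_add ?_ (RCLike.norm_conj _).le)
    rw [norm_mul, norm_mul, Complex.norm_I, mul_one, Complex.norm_real,
      Real.norm_of_nonneg hy.1.le]
    exact mul_le_mul_of_nonneg_left (norm_inner_le_norm _ _) hy.1.le
  have n2 : ‖inner ℂ v u‖ ≤ ‖v - g'‖ * ‖u‖ + ‖inner ℂ g' u‖ := by
    have : inner ℂ v u = inner ℂ (v - g') u + inner ℂ g' u := by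
      rw [inner_sub_left]
      ring
    rw [this]
    exact (norm_add_le _ _).trans (add_le_add_left (norm_inner_le_norm _ _) _)
  rw [norm_mul, Complex.norm_real, Real.norm_of_nonneg hy.1.le]
  have n3 : y * ‖inner ℂ v u‖ ≤ ‖v - g'‖ * (y * ‖u‖) + y * (‖h‖ * (y * ‖u‖) + ‖Γ₁ ⟨_, hm⟩‖) := by
    have := mul_le_mul_of_nonneg_left (n2.trans (add_le_add_right n1 _)) hy.1.le
    linarith
  have n4 : ‖v - g'‖ * (y * ‖u‖) ≤ ε / (2 * (K + 1)) * K :=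
    mul_le_mul hvg.le hb (mul_nonneg hy.1.le (norm_nonneg _)) (by positivity)
  have n5 : ε / (2 * (K + 1)) * K ≤ ε / 2 := by
    rw [div_mul_eq_mul_div, div_le_div_iff₀ (by positivity) (by positivity)]
    nlinarith
  have n6 : y * (‖h‖ * (y * ‖u‖) + ‖Γ₁ ⟨_, hm⟩‖) ≤ y * (K * ‖h‖ + ‖Γ₁ ⟨_, hm⟩‖) := by
    refine mul_le_mul_of_nonneg_left (add_le_add_left ?_ _) hy.1.le
    rw [mul_comm K]
    exact mul_le_mul_of_nonneg_left hb (norm_nonneg _)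
  linarith

theorem tendsto_mul_weylFn_add :
    Tendsto (fun y : ℝ => (y : ℂ) * (weylFn Γ₀ Γ₁ (y * Complex.I)
      + 1 / (((‖e‖ ^ 2 : ℝ) : ℂ) * (y * Complex.I)))) (𝓝[>] 0) (𝓝 0) := by
  have hi : -Complex.I ∈ cutPlane := mem_cutPlane_of_im_ne (by simp)
  have he : e ≠ 0 := by
    rintro rfl
    have : q₀ = 0 := Subtype.ext hq
    simp [this] at h₁
  have hM : ((‖e‖ ^ 2 : ℝ) : ℂ) ≠ 0 := Complex.ofReal_ne_zero.2 (by positivity)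
  set u := (weylSolution Γ₀ (-Complex.I) : H × H).1 with hu
  -- Since `⟨e, γ(-i)⟩ = i`, this `v` is the component of `γ(-i)` orthogonal to `e`. The removed
  -- component produces exactly the pole in the formula for `m(iy) - m(i)`.
  set v := u - (Complex.I * ((‖e‖ ^ 2 : ℝ) : ℂ)⁻¹) • e with hv
  have hve : inner ℂ e v = 0 := by
    rw [hv, inner_sub_right, inner_smul_right, hN.inner_weylSolution hq h₀ h₁ hi,
      inner_self_eq_norm_sq_to_K, inv_neg, Complex.inv_I, neg_neg]
    have : ((‖e‖ : ℂ)) ≠ 0 := Complex.ofReal_ne_zero.2 (norm_ne_zero_iff.2 he)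
    push_cast
    simp
    field_simp
    simp
  have h1 := hN.tendsto_mul_inner_weylSolution hker hve
  set c := weylFn Γ₀ Γ₁ Complex.I - Complex.I * ((‖e‖ ^ 2 : ℝ) : ℂ)⁻¹
  have h2 : Tendsto (fun y : ℝ => (y : ℂ)) (𝓝[>] 0) (𝓝 0) := by
    have := (Complex.continuous_ofReal.tendsto (0 : ℝ)).mono_left
      (nhdsWithin_le_nhds (s := Ioi (0 : ℝ)))
    simpa using this
  have h3 : Tendsto (fun y : ℝ => (y : ℂ) * c + Complex.I * ((y : ℂ) - 1)
      * ((y : ℂ) * inner ℂ v (weylSolution Γ₀ (y * Complex.I) : H × H).1)) (𝓝[>] 0)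
      (𝓝 (0 * c + Complex.I * (0 - 1) * 0)) :=
    (h2.mul_const c).add (((h2.sub_const 1).const_mul Complex.I).mul h1)
  rw [zero_mul, mul_zero, add_zero] at h3
  refine h3.congr' ?_
  filter_upwards [self_mem_nhdsWithin] with y hy
  have hy0 : (y : ℂ) ≠ 0 := Complex.ofReal_ne_zero.2 (ne_of_gt hy)
  have hz : (y * Complex.I : ℂ) ∈ cutPlane :=
    mem_cutPlane_of_im_ne (by simp [(ne_of_gt hy : y ≠ 0)])
  have h4 := hN.weylFn_sub hz hi
  rw [← hN.weylFn_conj hi, map_neg, Complex.conj_I, neg_neg, ← hu] at h4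
  have h5 : inner ℂ v (weylSolution Γ₀ (y * Complex.I) : H × H).1
      = inner ℂ u (weylSolution Γ₀ (y * Complex.I) : H × H).1
        + ((‖e‖ ^ 2 : ℝ) : ℂ)⁻¹ * (y : ℂ)⁻¹ := by
    rw [hv, inner_sub_left, inner_smul_left, hN.inner_weylSolution hq h₀ h₁ hz, map_mul,
      Complex.conj_I, map_inv₀, Complex.conj_ofReal, mul_inv, Complex.inv_I]
    linear_combination (-(((‖e‖ ^ 2 : ℝ) : ℂ)⁻¹ * (y : ℂ)⁻¹)) * Complex.I_mul_I
  have h6 : (1 : ℂ) / (((‖e‖ ^ 2 : ℝ) : ℂ) * (y * Complex.I))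
      = -Complex.I * (((‖e‖ ^ 2 : ℝ) : ℂ)⁻¹ * (y : ℂ)⁻¹) := by
    rw [one_div, mul_inv, mul_inv, Complex.inv_I]
    ring
  have h7 : (y : ℂ) * (y : ℂ)⁻¹ = 1 := mul_inv_cancel₀ hy0
  rw [h6, h5]
  linear_combination (y : ℂ) * h4 + Complex.I * ((‖e‖ ^ 2 : ℝ) : ℂ)⁻¹ * (y : ℂ) * h7

end IsNonnegTriple

end LinearRelations

/-! ### Products of integrals over `[0, x)` -/

section Products

variable {μ ν : Measure ℝ} [SFinite μ] [SFinite ν]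

theorem measurableSet_lt_prod : MeasurableSet {p : ℝ × ℝ | p.2 < p.1} :=
  measurableSet_lt measurable_snd measurable_fst

-- Only countably many points carry `ν`-mass, and by `h` each of them is `μ`-null; for every other
-- `s` the diagonal section `{s}` is `ν`-null.
omit [SFinite μ] in
theorem prod_diagonal_eq_zero (h : ∀ t, μ {t} = 0 ∨ ν {t} = 0) :
    (μ.prod ν) {p : ℝ × ℝ | p.1 = p.2} = 0 := by
  have hm : MeasurableSet {p : ℝ × ℝ | p.1 = p.2} :=
    measurableSet_eq_fun measurable_fst measurable_snd
  rw [Measure.measure_prod_null hm]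
  have hc : {t : ℝ | 0 < ν {t}}.Countable :=
    Measure.countable_meas_pos_of_disjoint_iUnion (As := fun t : ℝ => ({t} : Set ℝ))
      (fun t => measurableSet_singleton t) fun s t hst => disjoint_singleton.2 hst
  have h0 : μ {t : ℝ | 0 < ν {t}} = 0 := by
    rw [← biUnion_of_singleton {t : ℝ | 0 < ν {t}}, measure_biUnion_null_iff hc]
    exact fun t ht => (h t).resolve_right (ne_of_gt ht)
  have : ∀ᵐ s ∂μ, ¬ 0 < ν {s} := by
    rw [ae_iff]
    simpa [pos_iff_ne_zero] using h0
  filter_upwards [this] with s hs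
  have e : Prod.mk s ⁻¹' {p : ℝ × ℝ | p.1 = p.2} = {s} := by
    ext t
    simp [eq_comm]
  rw [e]
  simpa using hs

theorem integrableOn_integral_Ico {g : ℝ → ℂ} {f : ℝ → ℂ} {x : ℝ}
    (hf : IntegrableOn f (Ico 0 x) μ) (hg : IntegrableOn g (Ico 0 x) ν) :
    IntegrableOn (fun s => f s * ∫ t in Ico 0 s, g t ∂ν) (Ico 0 x) μ ∧
    ∫ p in {p : ℝ × ℝ | p.2 < p.1}, f p.1 * g p.2 ∂((μ.restrict (Ico 0 x)).prod
      (ν.restrict (Ico 0 x))) = ∫ s in Ico 0 x, f s * ∫ t in Ico 0 s, g t ∂ν ∂μ := by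
  have hi : Integrable (fun p : ℝ × ℝ => f p.1 * g p.2)
      ((μ.restrict (Ico 0 x)).prod (ν.restrict (Ico 0 x))) := Integrable.mul_prod hf hg
  have hi' := hi.indicator measurableSet_lt_prod
  have hin : ∀ s ∈ Ico 0 x, ∫ t, ({p : ℝ × ℝ | p.2 < p.1}.indicator
      (fun p : ℝ × ℝ => f p.1 * g p.2) (s, t)) ∂(ν.restrict (Ico 0 x))
      = f s * ∫ t in Ico 0 s, g t ∂ν := by
    intro s hs
    have e1 : (fun t => ({p : ℝ × ℝ | p.2 < p.1}.indicator
        (fun p : ℝ × ℝ => f p.1 * g p.2) (s, t))) = (Iio s).indicator fun t => f s * g t := by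
      ext t
      by_cases h : t < s <;> simp [h]
    have e2 : Iio s ∩ Ico 0 x = Ico 0 s := by
      ext t
      simp only [mem_inter_iff, mem_Iio, mem_Ico]
      exact ⟨fun h => ⟨h.2.1, h.1⟩, fun h => ⟨h.2, h.1, h.2.trans hs.2⟩⟩
    rw [e1, integral_indicator measurableSet_Iio, Measure.restrict_restrict measurableSet_Iio,
      integral_const_mul, e2]
  constructor
  · refine (hi'.integral_prod_left).congr ?_
    filter_upwards [ae_restrict_mem measurableSet_Ico] with s hs using hin s hs
  · rw [← integral_indicator measurableSet_lt_prod, integral_prod _ hi']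
    exact setIntegral_congr_fun measurableSet_Ico hin

/-- Fubini on the square `[0, x)²`: the two iterated integrals are the open triangles, and the
diagonal is null because there are no common atoms. -/
theorem setIntegral_Ico_mul {f g : ℝ → ℂ} {x : ℝ} (hf : IntegrableOn f (Ico 0 x) μ)
    (hg : IntegrableOn g (Ico 0 x) ν) (h : ∀ t, μ {t} = 0 ∨ ν {t} = 0) :
    (∫ s in Ico 0 x, f s ∂μ) * ∫ t in Ico 0 x, g t ∂ν
      = (∫ s in Ico 0 x, f s * ∫ t in Ico 0 s, g t ∂ν ∂μ)
        + ∫ t in Ico 0 x, g t * ∫ s in Ico 0 t, f s ∂μ ∂ν := by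
  have hi : Integrable (fun p : ℝ × ℝ => f p.1 * g p.2)
      ((μ.restrict (Ico 0 x)).prod (ν.restrict (Ico 0 x))) := Integrable.mul_prod hf hg
  rw [← (integrableOn_integral_Ico hf hg).2, ← (integrableOn_integral_Ico hg hf).2,
    ← integral_prod_mul, ← integral_add_compl measurableSet_lt_prod hi]
  congr 1
  have hd : ((μ.restrict (Ico 0 x)).prod (ν.restrict (Ico 0 x))) {p : ℝ × ℝ | p.1 = p.2} = 0 := by
    refine prod_diagonal_eq_zero fun t => (h t).imp (fun h => ?_) fun h => ?_ <;>
    exact le_antisymm ((Measure.restrict_apply_le _ _).trans h.le) bot_le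
  have hae : ({p : ℝ × ℝ | p.2 < p.1}ᶜ : Set (ℝ × ℝ))
      =ᵐ[(μ.restrict (Ico 0 x)).prod (ν.restrict (Ico 0 x))] {p : ℝ × ℝ | p.1 < p.2} := by
    have : ∀ᵐ p ∂((μ.restrict (Ico 0 x)).prod (ν.restrict (Ico 0 x))), ¬ p.1 = p.2 := by
      rw [ae_iff]
      simpa using hd
    filter_upwards [this] with p hp
    apply propext
    change ¬ p.2 < p.1 ↔ p.1 < p.2
    rw [not_lt]
    exact ⟨fun h => lt_of_le_of_ne h hp, le_of_lt⟩
  have hlt : MeasurableSet {p : ℝ × ℝ | p.1 < p.2} := measurableSet_lt measurable_fst measurable_snd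
  rw [setIntegral_congr_set hae, ← integral_indicator hlt, ← integral_prod_swap,
    ← integral_indicator measurableSet_lt_prod]
  congr 1
  ext p
  by_cases hp : p.2 < p.1 <;> simp [hp, mul_comm]

/-- Integration by parts for two functions without common jumps. -/
theorem mul_eq_add_setIntegral {F G f g : ℝ → ℂ} {x : ℝ} (hx : 0 ≤ x)
    (hf : IntegrableOn f (Ico 0 x) μ)
    (hg : IntegrableOn g (Ico 0 x) ν) (h : ∀ t, μ {t} = 0 ∨ ν {t} = 0)
    (hF : ∀ y ∈ Icc 0 x, F y = F 0 + ∫ t in Ico 0 y, f t ∂μ)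
    (hG : ∀ y ∈ Icc 0 x, G y = G 0 + ∫ t in Ico 0 y, g t ∂ν) :
    IntegrableOn (fun t => f t * G t) (Ico 0 x) μ ∧
    IntegrableOn (fun t => F t * g t) (Ico 0 x) ν ∧
    F x * G x = F 0 * G 0 + (∫ t in Ico 0 x, f t * G t ∂μ) + ∫ t in Ico 0 x, F t * g t ∂ν := by
  obtain ⟨i1, -⟩ := integrableOn_integral_Ico hf hg
  obtain ⟨i2, -⟩ := integrableOn_integral_Ico hg hf
  have e1 : ∀ t ∈ Ico 0 x, f t * G t = G 0 * f t + f t * ∫ t in Ico 0 t, g t ∂ν := fun t ht => by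
    rw [hG t ⟨ht.1, ht.2.le⟩]
    ring
  have e2 : ∀ t ∈ Ico 0 x, F t * g t = F 0 * g t + g t * ∫ t in Ico 0 t, f t ∂μ := fun t ht => by
    rw [hF t ⟨ht.1, ht.2.le⟩]
    ring
  have j1 : IntegrableOn (fun t => G 0 * f t) (Ico 0 x) μ := hf.const_mul _
  have j2 : IntegrableOn (fun t => F 0 * g t) (Ico 0 x) ν := hg.const_mul _
  refine ⟨(j1.add i1).congr_fun (fun t ht => (e1 t ht).symm) measurableSet_Ico,
    (j2.add i2).congr_fun (fun t ht => (e2 t ht).symm) measurableSet_Ico, ?_⟩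
  rw [setIntegral_congr_fun measurableSet_Ico e1, setIntegral_congr_fun measurableSet_Ico e2,
    integral_add j1 i1, integral_add j2 i2, integral_const_mul, integral_const_mul,
    hF x ⟨hx, le_rfl⟩, hG x ⟨hx, le_rfl⟩]
  linear_combination setIntegral_Ico_mul hf hg h

end Products

/-! ### Iterated integrals -/

/-- The `n`-fold iterated integral of `κ` over `t₁ < ⋯ < tₙ < x`. -/
def iterInt (κ : Measure ℝ) : ℕ → ℝ → ℝ≥0∞
  | 0, _ => 1
  | n + 1, x => ∫⁻ t in Ico 0 x, iterInt κ n t ∂κ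

theorem monotone_lintegral_Ico (κ : Measure ℝ) (f : ℝ → ℝ≥0∞) :
    Monotone fun x => ∫⁻ t in Ico 0 x, f t ∂κ := fun _ _ h =>
  lintegral_mono_set (Ico_subset_Ico_right h)

theorem monotone_iterInt (κ : Measure ℝ) (n : ℕ) : Monotone (iterInt κ n) := by
  cases n with
  | zero => exact fun _ _ _ => le_rfl
  | succ n => exact monotone_lintegral_Ico κ _

/-- The two integrals are those of `f(s)` over the disjoint triangles `t < s` and `s < t` of the
square. The diagonal is dropped, so atoms only make the inequality strict and the factorial bound
for iterated integrals needs no continuity. -/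
theorem lintegral_Ico_mul_le {κ : Measure ℝ} [SFinite κ] {f : ℝ → ℝ≥0∞} (hf : Measurable f)
    (x : ℝ) :
    (∫⁻ s in Ico 0 x, f s * κ (Ico 0 s) ∂κ) + ∫⁻ t in Ico 0 x, ∫⁻ s in Ico 0 t, f s ∂κ ∂κ
      ≤ κ (Ico 0 x) * ∫⁻ s in Ico 0 x, f s ∂κ := by
  set κ' := κ.restrict (Ico 0 x) with hκ
  have hlt : MeasurableSet {p : ℝ × ℝ | p.1 < p.2} := measurableSet_lt measurable_fst measurable_snd
  have hres : ∀ (y : ℝ), y ∈ Ico 0 x → κ'.restrict (Iio y) = κ.restrict (Ico 0 y) := by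
    intro y hy
    rw [hκ, Measure.restrict_restrict measurableSet_Iio]
    congr 1
    ext t
    simp only [mem_inter_iff, mem_Iio, mem_Ico]
    exact ⟨fun h => ⟨h.2.1, h.1⟩, fun h => ⟨h.2, h.1, h.2.trans hy.2⟩⟩
  have hfm : Measurable fun p : ℝ × ℝ => f p.1 := hf.comp measurable_fst
  have e1 : ∫⁻ s in Ico 0 x, f s * κ (Ico 0 s) ∂κ
      = ∫⁻ p in {p : ℝ × ℝ | p.2 < p.1}, f p.1 ∂(κ'.prod κ') := by
    rw [← lintegral_indicator measurableSet_lt_prod,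
      lintegral_prod _ (hfm.indicator measurableSet_lt_prod).aemeasurable]
    refine setLIntegral_congr_fun measurableSet_Ico fun s hs => ?_
    have : (fun t => {p : ℝ × ℝ | p.2 < p.1}.indicator (fun p : ℝ × ℝ => f p.1) (s, t))
        = (Iio s).indicator fun _ => f s := by
      ext t
      by_cases h : t < s <;> simp [h]
    simp only [this]
    rw [lintegral_indicator measurableSet_Iio, hres s hs]
    simp
  have e2 : ∫⁻ t in Ico 0 x, ∫⁻ s in Ico 0 t, f s ∂κ ∂κ
      = ∫⁻ p in {p : ℝ × ℝ | p.1 < p.2}, f p.1 ∂(κ'.prod κ') := by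
    rw [← lintegral_indicator hlt,
      lintegral_prod_symm _ (hfm.indicator hlt).aemeasurable]
    refine setLIntegral_congr_fun measurableSet_Ico fun t ht => ?_
    have : (fun s => {p : ℝ × ℝ | p.1 < p.2}.indicator (fun p : ℝ × ℝ => f p.1) (s, t))
        = (Iio t).indicator f := by
      ext s
      by_cases h : s < t <;> simp [h]
    simp only [this]
    rw [lintegral_indicator measurableSet_Iio, hres t ht]
  have hdisj : Disjoint {p : ℝ × ℝ | p.2 < p.1} {p : ℝ × ℝ | p.1 < p.2} :=
    Set.disjoint_left.2 fun p (h : p.2 < p.1) (h' : p.1 < p.2) => lt_asymm h h'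
  rw [e1, e2, ← lintegral_union hlt hdisj]
  refine (setLIntegral_le_lintegral _ _).trans (le_of_eq ?_)
  rw [lintegral_prod _ hfm.aemeasurable]
  simp only [lintegral_const]
  rw [lintegral_mul_const _ hf, mul_comm, hκ, Measure.restrict_apply_univ]

theorem succ_mul_iterInt_le (κ : Measure ℝ) [SFinite κ] (n : ℕ) (x : ℝ) :
    ((n + 1 : ℕ) : ℝ≥0∞) * iterInt κ (n + 1) x ≤ κ (Ico 0 x) * iterInt κ n x := by
  induction n generalizing x with
  | zero => simp [iterInt]
  | succ n ih =>
    have hm := (monotone_iterInt κ n).measurable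
    calc ((n + 1 + 1 : ℕ) : ℝ≥0∞) * iterInt κ (n + 1 + 1) x
        = (∫⁻ t in Ico 0 x, ((n + 1 : ℕ) : ℝ≥0∞) * iterInt κ (n + 1) t ∂κ)
          + ∫⁻ t in Ico 0 x, iterInt κ (n + 1) t ∂κ := by
          rw [lintegral_const_mul _ (monotone_iterInt κ (n + 1)).measurable]
          push_cast
          rw [add_mul, one_mul]
          rfl
      _ ≤ (∫⁻ t in Ico 0 x, iterInt κ n t * κ (Ico 0 t) ∂κ)
          + ∫⁻ t in Ico 0 x, ∫⁻ s in Ico 0 t, iterInt κ n s ∂κ ∂κ :=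
          add_le_add_left (lintegral_mono fun t => (ih t).trans_eq (mul_comm _ _)) _
      _ ≤ κ (Ico 0 x) * ∫⁻ s in Ico 0 x, iterInt κ n s ∂κ := lintegral_Ico_mul_le hm x
      _ = _ := rfl

theorem factorial_mul_iterInt_le (κ : Measure ℝ) [SFinite κ] (n : ℕ) (x : ℝ) :
    (n.factorial : ℝ≥0∞) * iterInt κ n x ≤ κ (Ico 0 x) ^ n := by
  induction n with
  | zero => simp [iterInt]
  | succ n ih =>
    calc ((n + 1).factorial : ℝ≥0∞) * iterInt κ (n + 1) x
        = n.factorial * (((n + 1 : ℕ) : ℝ≥0∞) * iterInt κ (n + 1) x) := by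
          rw [Nat.factorial_succ]
          push_cast
          ring
      _ ≤ n.factorial * (κ (Ico 0 x) * iterInt κ n x) := by
          exact mul_le_mul_right (succ_mul_iterInt_le κ n x) _
      _ = κ (Ico 0 x) * (n.factorial * iterInt κ n x) := by ring
      _ ≤ κ (Ico 0 x) * κ (Ico 0 x) ^ n := by gcongr
      _ = _ := (pow_succ' _ _).symm

theorem toReal_iterInt_le {κ : Measure ℝ} [SFinite κ] {x : ℝ} (hx : κ (Ico 0 x) ≠ ∞) (n : ℕ) :
    iterInt κ n x ≠ ∞ ∧ (iterInt κ n x).toReal ≤ κ.real (Ico 0 x) ^ n / n.factorial := by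
  have h := factorial_mul_iterInt_le κ n x
  have hf : (n.factorial : ℝ≥0∞) ≠ 0 := by exact_mod_cast n.factorial_ne_zero
  have hp : κ (Ico 0 x) ^ n ≠ ∞ := ENNReal.pow_ne_top hx
  constructor
  · intro h'
    rw [h', ENNReal.mul_top hf] at h
    exact hp (top_le_iff.1 h)
  · have := ENNReal.toReal_mono hp h
    rw [ENNReal.toReal_mul, ENNReal.toReal_natCast, ENNReal.toReal_pow] at this
    rw [le_div_iff₀ (by positivity), mul_comm]
    exact this

/-! ### The measures `dR₁` and `dR₂` -/

instance stieltjesOn_sFinite {b : EReal} (hb : 0 < b) {R : ℝ → ℝ} (hR : MonotoneOn R (halfOpen b)) :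
    SFinite (stieltjesOn hb hR) := by
  unfold stieltjesOn
  infer_instance

theorem mem_halfOpen_of_le {b : EReal} {x y : ℝ} (hy : y ∈ halfOpen b) (h0 : 0 ≤ x) (h : x ≤ y) :
    x ∈ halfOpen b :=
  ⟨h0, (EReal.coe_le_coe_iff.2 h).trans_lt hy.2⟩

theorem exists_gt_mem_halfOpen {b : EReal} {x : ℝ} (hx : x ∈ halfOpen b) :
    ∃ y ∈ halfOpen b, x < y := by
  obtain ⟨y, h1, h2⟩ := EReal.lt_iff_exists_real_btwn.1 hx.2
  exact ⟨y, ⟨hx.1.trans (EReal.coe_lt_coe_iff.1 h1).le, h2⟩, EReal.coe_lt_coe_iff.1 h1⟩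

/-- A countable exhaustion that treats finite and infinite `b` alike. -/
theorem exists_seq_halfOpen {b : EReal} (hb : 0 < b) :
    ∃ c : ℕ → ℝ, Monotone c ∧ (∀ n, c n ∈ halfOpen b) ∧ ∀ x ∈ halfOpen b, ∃ n, x < c n := by
  obtain ⟨u, hu, hm, ht⟩ := exists_seq_strictMono_tendsto' hb
  have hne : ∀ n, ((u n).toReal : EReal) = u n := fun n =>
    EReal.coe_toReal (ne_top_of_lt (hm n).2) (ne_bot_of_gt (hm n).1)
  refine ⟨fun n => (u n).toReal, fun m n h => ?_, fun n => ⟨?_, ?_⟩, fun x hx => ?_⟩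
  · rw [← EReal.coe_le_coe_iff, hne, hne]
    exact hu.monotone h
  · rw [← EReal.coe_le_coe_iff, hne]
    exact (hm n).1.le
  · rw [hne]
    exact (hm n).2
  · obtain ⟨n, hn⟩ := (ht.eventually (eventually_gt_nhds hx.2)).exists
    exact ⟨n, by rwa [← EReal.coe_lt_coe_iff, hne]⟩

/-- The mass of `{x}` is at most that of `[x, t)`, namely `R t - R x`, which tends to `0` as `t ↓
x`. -/
theorem stieltjesOn_singleton {b : EReal} (hb : 0 < b) {R : ℝ → ℝ} (hR : MonotoneOn R (halfOpen b))
    (hl : ∀ x ∈ halfOpen b, ContinuousWithinAt R (Icc 0 x) x) {x : ℝ} (hx : x ∈ halfOpen b)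
    (hc : ContinuousWithinAt R (halfOpen b) x) : stieltjesOn hb hR {x} = 0 := by
  obtain ⟨y, hy, hxy⟩ := exists_gt_mem_halfOpen hx
  have hsub : Ioo x y ⊆ halfOpen b := fun t ht =>
    mem_halfOpen_of_le hy (hx.1.trans ht.1.le) ht.2.le
  have hlim : Tendsto (fun t => ENNReal.ofReal (R t - R x)) (𝓝[>] x) (𝓝 0) := by
    have h1 : Tendsto R (𝓝[>] x) (𝓝 (R x)) := by
      rw [← nhdsWithin_Ioo_eq_nhdsGT hxy]
      exact hc.tendsto.mono_left (nhdsWithin_mono _ hsub)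
    have h2 := ENNReal.tendsto_ofReal (h1.sub_const (R x))
    rwa [sub_self, ENNReal.ofReal_zero] at h2
  refine le_antisymm (ge_of_tendsto hlim ?_) bot_le
  filter_upwards [Ioo_mem_nhdsGT hxy] with t ht
  rw [← stieltjesOn_Ico hb hR hl hx.1 ht.1.le (hsub ht).2]
  exact measure_mono (singleton_subset_iff.2 ⟨le_rfl, ht.1⟩)

namespace IntegralSystem

variable {S : IntegralSystem}

instance : SFinite S.dR₁ := stieltjesOn_sFinite _ _

instance : SFinite S.dR₂ := stieltjesOn_sFinite _ _

theorem zero_mem : (0 : ℝ) ∈ S.I := ⟨le_rfl, by simpa using S.b_pos⟩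

theorem mem_of_le {x y : ℝ} (hy : y ∈ S.I) (h0 : 0 ≤ x) (h : x ≤ y) : x ∈ S.I :=
  mem_halfOpen_of_le hy h0 h

theorem dR₁_Ico {x y : ℝ} (hx : 0 ≤ x) (hxy : x ≤ y) (hy : y ∈ S.I) :
    S.dR₁ (Ico x y) = ENNReal.ofReal (S.R₁ y - S.R₁ x) :=
  stieltjesOn_Ico S.b_pos S.monotoneOn₁ S.leftCont₁ hx hxy hy.2

theorem dR₂_Ico {x y : ℝ} (hx : 0 ≤ x) (hxy : x ≤ y) (hy : y ∈ S.I) :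
    S.dR₂ (Ico x y) = ENNReal.ofReal (S.R₂ y - S.R₂ x) :=
  stieltjesOn_Ico S.b_pos S.monotoneOn₂ S.leftCont₂ hx hxy hy.2

theorem dR₁_Ico_zero {x : ℝ} (hx : x ∈ S.I) : S.dR₁ (Ico 0 x) = ENNReal.ofReal (S.R₁ x) := by
  rw [dR₁_Ico le_rfl hx.1 hx, S.R₁_zero, sub_zero]

theorem dR₂_Ico_zero {x : ℝ} (hx : x ∈ S.I) : S.dR₂ (Ico 0 x) = ENNReal.ofReal (S.R₂ x) := by
  rw [dR₂_Ico le_rfl hx.1 hx, S.R₂_zero, sub_zero]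

theorem R₁_nonneg {x : ℝ} (hx : x ∈ S.I) : 0 ≤ S.R₁ x :=
  S.R₁_zero ▸ S.monotoneOn₁ zero_mem hx hx.1

theorem R₂_nonneg {x : ℝ} (hx : x ∈ S.I) : 0 ≤ S.R₂ x :=
  S.R₂_zero ▸ S.monotoneOn₂ zero_mem hx hx.1

theorem isFiniteMeasure₁ {x : ℝ} (hx : x ∈ S.I) : IsFiniteMeasure (S.dR₁.restrict (Ico 0 x)) :=
  ⟨by rw [Measure.restrict_apply_univ, dR₁_Ico_zero hx]; exact ENNReal.ofReal_lt_top⟩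

theorem isFiniteMeasure₂ {x : ℝ} (hx : x ∈ S.I) : IsFiniteMeasure (S.dR₂.restrict (Ico 0 x)) :=
  ⟨by rw [Measure.restrict_apply_univ, dR₂_Ico_zero hx]; exact ENNReal.ofReal_lt_top⟩

theorem measurableSet_I : MeasurableSet S.I :=
  measurableSet_Ici.inter (measurableSet_lt measurable_coe_real_ereal measurable_const)

theorem ae_mem₁ : ∀ᵐ x ∂S.dR₁, x ∈ S.I := stieltjesOn_compl S.b_pos S.monotoneOn₁

theorem ae_mem₂ : ∀ᵐ x ∂S.dR₂, x ∈ S.I := stieltjesOn_compl S.b_pos S.monotoneOn₂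

theorem NoCommonDiscontinuity.singleton (h : S.NoCommonDiscontinuity) (x : ℝ) :
    S.dR₁ {x} = 0 ∨ S.dR₂ {x} = 0 := by
  by_cases hx : x ∈ S.I
  · exact (h x hx).imp (stieltjesOn_singleton _ _ S.leftCont₁ hx)
      (stieltjesOn_singleton _ _ S.leftCont₂ hx)
  · exact Or.inl (measure_mono_null (singleton_subset_iff.2 hx) ae_mem₁)

/-! ### Measurability, bounds and bilinear identities for solutions. -/

theorem ae_of_forall_restrict {P : ℝ → Prop}
    (h : ∀ x ∈ S.I, ∀ᵐ t ∂S.dR₂.restrict (Ico 0 x), P t) : ∀ᵐ t ∂S.dR₂, P t := by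
  obtain ⟨c, -, hc, hc'⟩ := exists_seq_halfOpen S.b_pos
  have h1 := ae_all_iff.2 fun n => (ae_restrict_iff' measurableSet_Ico).1 (h (c n) (hc n))
  filter_upwards [h1, ae_mem₂] with t ht hI
  obtain ⟨n, hn⟩ := hc' t hI
  exact ht n ⟨hI.1, hn⟩

theorem aestronglyMeasurable_of_eq_integral {μ κ : Measure ℝ} [SFinite μ] (hκ : ∀ᵐ x ∂κ, x ∈ S.I)
    {u f : ℝ → ℂ} {a : ℂ} (h : ∀ x ∈ S.I, IntegrableOn f (Ico 0 x) μ)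
    (hu : ∀ x ∈ S.I, u x = a + ∫ t in Ico 0 x, f t ∂μ) : AEStronglyMeasurable u κ := by
  obtain ⟨c, hc1, hc, hc'⟩ := exists_seq_halfOpen S.b_pos
  -- Integrability is only local, so the upper limit is truncated at `c n`; for fixed `x` the
  -- truncations are eventually stationary, and `u` is their pointwise limit on `[0, b)`.
  have hm : ∀ n, StronglyMeasurable fun x : ℝ => ∫ t in Ico 0 (min x (c n)), f t ∂μ := by
    intro n
    set g := (h (c n) (hc n)).1.mk f with hg
    have hgm : StronglyMeasurable g := (h (c n) (hc n)).1.stronglyMeasurable_mk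
    have e : (fun x : ℝ => ∫ t in Ico 0 (min x (c n)), f t ∂μ)
        = fun x => ∫ t, {p : ℝ × ℝ | p.2 < p.1}.indicator (fun p : ℝ × ℝ => g p.2) (x, t)
          ∂(μ.restrict (Ico 0 (c n))) := by
      ext x
      have e1 : (fun t => {p : ℝ × ℝ | p.2 < p.1}.indicator (fun p : ℝ × ℝ => g p.2) (x, t))
          = (Iio x).indicator g := by
        ext t
        by_cases h : t < x <;> simp [h]
      have e2 : Iio x ∩ Ico 0 (c n) = Ico 0 (min x (c n)) := by
        ext t
        simp only [mem_inter_iff, mem_Iio, mem_Ico, lt_min_iff]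
        tauto
      rw [e1, integral_indicator measurableSet_Iio, Measure.restrict_restrict measurableSet_Iio,
        e2]
      refine integral_congr_ae ?_
      exact ae_restrict_of_ae_restrict_of_subset (Ico_subset_Ico_right (min_le_right _ _))
        (h (c n) (hc n)).1.ae_eq_mk
    rw [e]
    have : StronglyMeasurable ({p : ℝ × ℝ | p.2 < p.1}.indicator (fun p : ℝ × ℝ => g p.2)) :=
      (hgm.comp_measurable measurable_snd).indicator measurableSet_lt_prod
    exact this.integral_prod_right'
  refine AEStronglyMeasurable.congr (f := fun x => S.I.indicator u x) ?_ ?_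
  · have hlim : ∀ x, Tendsto (fun n => S.I.indicator
        (fun x => a + ∫ t in Ico 0 (min x (c n)), f t ∂μ) x) atTop (𝓝 (S.I.indicator u x)) := by
      intro x
      by_cases hx : x ∈ S.I
      · simp only [indicator_of_mem hx]
        obtain ⟨N, hN⟩ := hc' x hx
        refine tendsto_const_nhds.congr' ?_
        filter_upwards [eventually_ge_atTop N] with n hn
        rw [min_eq_left (hN.le.trans (hc1 hn)), hu x hx]
      · simp [indicator_of_notMem hx]
    exact (stronglyMeasurable_of_tendsto atTop (fun n =>
      ((stronglyMeasurable_const.add (hm n)).indicator measurableSet_I))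
      (tendsto_pi_nhds.2 hlim)).aestronglyMeasurable
  · filter_upwards [hκ] with x hx
    rw [indicator_of_mem hx]

theorem norm_le_of_eq_integral {μ : Measure ℝ} {u f : ℝ → ℂ} {a : ℂ} {X : ℝ}
    (hX : X ∈ S.I) (h : ∀ x ∈ S.I, IntegrableOn f (Ico 0 x) μ)
    (hu : ∀ x ∈ S.I, u x = a + ∫ t in Ico 0 x, f t ∂μ) {x : ℝ} (hx : x ∈ Icc 0 X) :
    ‖u x‖ ≤ ‖a‖ + ∫ t in Ico 0 X, ‖f t‖ ∂μ := by
  rw [hu x (mem_of_le hX hx.1 hx.2)]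
  refine (norm_add_le _ _).trans (add_le_add_right ((norm_integral_le_integral_norm _).trans ?_) _)
  exact setIntegral_mono_set (h X hX).norm (Eventually.of_forall fun _ => norm_nonneg _)
    (Ico_subset_Ico_right hx.2).eventuallyLE

theorem memLp_restrict_of_bound {κ : Measure ℝ} {X : ℝ} [IsFiniteMeasure (κ.restrict (Ico 0 X))]
    {u : ℝ → ℂ} (hm : AEStronglyMeasurable u κ) {C : ℝ} (hu : ∀ x ∈ Icc 0 X, ‖u x‖ ≤ C)
    (p : ℝ≥0∞) : MemLp u p (κ.restrict (Ico 0 X)) := by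
  refine MemLp.of_bound hm.restrict C ?_
  filter_upwards [ae_restrict_mem measurableSet_Ico] with x hx using hu x ⟨hx.1, hx.2.le⟩

section IsIntegralSolution

variable {u₁ u₂ g : ℝ → ℂ} (h : S.IsIntegralSolution u₁ u₂ g)
include h

theorem IsIntegralSolution.eq_neg {x : ℝ} (hx : x ∈ S.I) :
    u₂ x = u₂ 0 + ∫ t in Ico 0 x, -g t ∂S.dR₂ := by
  rw [integral_neg, ← sub_eq_add_neg]
  exact (h x hx).2.2.2

theorem IsIntegralSolution.aestronglyMeasurable₁ {κ : Measure ℝ} (hκ : ∀ᵐ x ∂κ, x ∈ S.I) :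
    AEStronglyMeasurable u₁ κ :=
  aestronglyMeasurable_of_eq_integral hκ (fun x hx => (h x hx).1) fun x hx => (h x hx).2.2.1

theorem IsIntegralSolution.aestronglyMeasurable₂ {κ : Measure ℝ} (hκ : ∀ᵐ x ∂κ, x ∈ S.I) :
    AEStronglyMeasurable u₂ κ :=
  aestronglyMeasurable_of_eq_integral hκ (fun x hx => (h x hx).2.1.neg) fun _ hx => h.eq_neg hx

theorem IsIntegralSolution.memLp₁ {x : ℝ} (hx : x ∈ S.I) (p : ℝ≥0∞) :
    MemLp u₁ p (S.dR₂.restrict (Ico 0 x)) :=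
  have := isFiniteMeasure₂ hx
  memLp_restrict_of_bound (h.aestronglyMeasurable₁ ae_mem₂) (fun _ hy =>
    norm_le_of_eq_integral hx (fun x hx => (h x hx).1) (fun x hx => (h x hx).2.2.1) hy) p

end IsIntegralSolution

theorem IsIntegralSolution.congr {u₁ u₂ g g' : ℝ → ℂ} (h : S.IsIntegralSolution u₁ u₂ g)
    (hg : g =ᵐ[S.dR₂] g') : S.IsIntegralSolution u₁ u₂ g' := fun x hx => by
  obtain ⟨h1, h2, h3, h4⟩ := h x hx
  exact ⟨h1, h2.congr_fun_ae (ae_restrict_of_ae hg), h3,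
    h4.trans (by rw [integral_congr_ae (ae_restrict_of_ae hg)])⟩

/-- For every locally integrable right-hand side the inhomogeneous system is solved by two
integrations. -/
theorem exists_isIntegralSolution {g : ℝ → ℂ} (hg : ∀ x ∈ S.I, IntegrableOn g (Ico 0 x) S.dR₂)
    (α β : ℂ) : ∃ u₁ u₂, S.IsIntegralSolution u₁ u₂ g ∧ u₁ 0 = α ∧ u₂ 0 = β := by
  set u₂ : ℝ → ℂ := fun x => β - ∫ t in Ico 0 x, g t ∂S.dR₂ with hu₂
  have e : ∀ x ∈ S.I, u₂ x = β + ∫ t in Ico 0 x, -g t ∂S.dR₂ := fun x _ => by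
    rw [integral_neg, ← sub_eq_add_neg]
  have hi : ∀ x ∈ S.I, IntegrableOn u₂ (Ico 0 x) S.dR₁ := fun x hx => by
    have := isFiniteMeasure₁ hx
    exact (memLp_restrict_of_bound (aestronglyMeasurable_of_eq_integral ae_mem₁
      (fun x hx => (hg x hx).neg) e) (fun y hy => norm_le_of_eq_integral hx
      (fun x hx => (hg x hx).neg) e hy) 1).integrable le_rfl
  refine ⟨fun x => α + ∫ t in Ico 0 x, u₂ t ∂S.dR₁, u₂, fun x hx => ⟨hi x hx, hg x hx, ?_, ?_⟩,
    ?_, ?_⟩ <;> simp [hu₂]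

theorem MemLp.integrableOn_Ico {f : ℝ → ℂ} (hf : MemLp f 2 S.dR₂) {x : ℝ} (hx : x ∈ S.I) :
    IntegrableOn f (Ico 0 x) S.dR₂ :=
  have := isFiniteMeasure₂ hx
  (hf.restrict _).integrable (by norm_num)

/-- The bilinear Lagrange identity. -/
theorem IsIntegralSolution.mul_eq (hd : S.NoCommonDiscontinuity) {u₁ u₂ f v₁ v₂ g : ℝ → ℂ}
    (hu : S.IsIntegralSolution u₁ u₂ f) (hv : S.IsIntegralSolution v₁ v₂ g) {x : ℝ} (hx : x ∈ S.I) :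
    IntegrableOn (fun t => u₂ t * v₂ t) (Ico 0 x) S.dR₁ ∧
    IntegrableOn (fun t => u₁ t * g t) (Ico 0 x) S.dR₂ ∧
    u₁ x * v₂ x = u₁ 0 * v₂ 0 + (∫ t in Ico 0 x, u₂ t * v₂ t ∂S.dR₁)
      - ∫ t in Ico 0 x, u₁ t * g t ∂S.dR₂ := by
  obtain ⟨h1, h2, h3⟩ := mul_eq_add_setIntegral (F := u₁) (G := v₂) hx.1 (hu x hx).1
    (hv x hx).2.1.neg hd.singleton (fun y hy => (hu y (mem_of_le hx hy.1 hy.2)).2.2.1)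
    fun y hy => hv.eq_neg (mem_of_le hx hy.1 hy.2)
  simp only [Pi.neg_apply, mul_neg] at h2 h3
  rw [integral_neg, ← sub_eq_add_neg] at h3
  exact ⟨h1, by simpa using h2.neg, h3⟩

/-- The `dR₁`-integrals of `u₂ v₂` are symmetric in the two solutions and cancel. Conjugation is
left out here, so that the identity serves both Green's formula and constancy of Wronskians. -/
theorem IsIntegralSolution.wronskian_eq (hd : S.NoCommonDiscontinuity) {u₁ u₂ f v₁ v₂ g : ℝ → ℂ}
    (hu : S.IsIntegralSolution u₁ u₂ f) (hv : S.IsIntegralSolution v₁ v₂ g) {x : ℝ} (hx : x ∈ S.I) :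
    u₁ x * v₂ x - u₂ x * v₁ x = u₁ 0 * v₂ 0 - u₂ 0 * v₁ 0
      + ((∫ t in Ico 0 x, f t * v₁ t ∂S.dR₂) - ∫ t in Ico 0 x, u₁ t * g t ∂S.dR₂) := by
  have h1 := (hu.mul_eq hd hv hx).2.2
  have h2 := (hv.mul_eq hd hu hx).2.2
  simp only [mul_comm (v₁ _), mul_comm (v₂ _)] at h2
  linear_combination h1 - h2

theorem IsIntegralSolution.conj {u₁ u₂ f : ℝ → ℂ} (hu : S.IsIntegralSolution u₁ u₂ f) :
    S.IsIntegralSolution (fun t => conj (u₁ t)) (fun t => conj (u₂ t)) (fun t => conj (f t)) := by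
  intro x hx
  obtain ⟨h1, h2, h3, h4⟩ := hu x hx
  refine ⟨(LinearIsometryEquiv.integrable_comp_iff Complex.conjLIE).2 h1,
    (LinearIsometryEquiv.integrable_comp_iff Complex.conjLIE).2 h2, ?_, ?_⟩
  · simp only [integral_conj]
    rw [h3, map_add]
  · simp only [integral_conj]
    rw [h4, map_sub]

theorem IsIntegralSolution.linear {u₁ u₂ f v₁ v₂ g : ℝ → ℂ} (hu : S.IsIntegralSolution u₁ u₂ f)
    (hv : S.IsIntegralSolution v₁ v₂ g) (a b : ℂ) :
    S.IsIntegralSolution (fun t => a * u₁ t + b * v₁ t) (fun t => a * u₂ t + b * v₂ t)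
      (fun t => a * f t + b * g t) := by
  intro x hx
  obtain ⟨h1, h2, h3, h4⟩ := hu x hx
  obtain ⟨k1, k2, k3, k4⟩ := hv x hx
  refine ⟨(h1.const_mul a).add (k1.const_mul b), (h2.const_mul a).add (k2.const_mul b), ?_, ?_⟩
  · rw [integral_add (h1.const_mul a) (k1.const_mul b), integral_const_mul, integral_const_mul]
    linear_combination a * h3 + b * k3
  · rw [integral_add (h2.const_mul a) (k2.const_mul b), integral_const_mul, integral_const_mul]
    linear_combination a * h4 + b * k4

/-- The solutions `α + β R₁` for the spectral parameter `0`. -/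
theorem isIntegralSolution_R₁ (α β : ℂ) :
    S.IsIntegralSolution (fun x => α + β * (S.R₁ x : ℂ)) (fun _ => β) 0 := by
  intro x hx
  have := isFiniteMeasure₁ hx
  refine ⟨integrable_const _, integrable_zero _ _ _, ?_, by simp⟩
  rw [setIntegral_const, Measure.real, dR₁_Ico_zero hx, ENNReal.toReal_ofReal (R₁_nonneg hx)]
  simp [S.R₁_zero, mul_comm]

/-! ### Existence of solutions of the homogeneous system -/

variable (S) in
/-- The measure `(1 + R₁) dR₂`, which controls the successive approximations. -/
def picardMeasure : Measure ℝ := S.dR₂.withDensity fun t => 1 + S.dR₁ (Ico 0 t)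

theorem monotone_one_add_dR₁ : Monotone fun t => 1 + S.dR₁ (Ico 0 t) := fun _ _ h =>
  add_le_add_right (measure_mono (Ico_subset_Ico_right h)) 1

instance : SFinite S.picardMeasure := by
  unfold picardMeasure
  infer_instance

theorem setLIntegral_picardMeasure {f : ℝ → ℝ≥0∞} (hf : Measurable f) (x : ℝ) :
    ∫⁻ t in Ico 0 x, f t ∂S.picardMeasure
      = ∫⁻ t in Ico 0 x, (1 + S.dR₁ (Ico 0 t)) * f t ∂S.dR₂ :=
  setLIntegral_withDensity_eq_setLIntegral_mul _ monotone_one_add_dR₁.measurable hf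
    measurableSet_Ico

theorem picardMeasure_Ico (x : ℝ) :
    S.picardMeasure (Ico 0 x) = ∫⁻ t in Ico 0 x, (1 + S.dR₁ (Ico 0 t)) ∂S.dR₂ :=
  withDensity_apply _ measurableSet_Ico

theorem picardMeasure_Ico_ne_top {x : ℝ} (hx : x ∈ S.I) : S.picardMeasure (Ico 0 x) ≠ ∞ := by
  rw [picardMeasure_Ico]
  refine ne_top_of_le_ne_top (b := ∫⁻ t in Ico 0 x, (1 + S.dR₁ (Ico 0 x)) ∂S.dR₂) ?_
    (setLIntegral_mono' measurableSet_Ico fun t ht => monotone_one_add_dR₁ ht.2.le)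
  rw [setLIntegral_const, dR₁_Ico_zero hx, dR₂_Ico_zero hx]
  exact ENNReal.mul_ne_top (by simp) (by simp)

/-- The successive approximations form a sequence of inhomogeneous problems. -/
structure IsPicardSequence (S : IntegralSystem) (z α β : ℂ) (a b : ℕ → ℝ → ℂ) : Prop where
  zero₁ : a 0 = fun x => α + β * (S.R₁ x : ℂ)
  zero₂ : b 0 = fun _ => β
  succ : ∀ n, S.IsIntegralSolution (a (n + 1)) (b (n + 1)) fun t => z * a n t
  init₁ : ∀ n, a (n + 1) 0 = 0
  init₂ : ∀ n, b (n + 1) 0 = 0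

theorem exists_isPicardSequence (S : IntegralSystem) (z α β : ℂ) :
    ∃ a b, IsPicardSequence S z α β a b := by
  -- The solution operator is made total, with value zero when `g` is not locally integrable, so
  -- that the recursion can be written first and local integrability proved by induction afterwards.
  have : ∀ g : ℝ → ℂ, ∃ u₁ u₂ : ℝ → ℂ, (∀ x ∈ S.I, IntegrableOn g (Ico 0 x) S.dR₂) →
      S.IsIntegralSolution u₁ u₂ g ∧ u₁ 0 = 0 ∧ u₂ 0 = 0 := by
    intro g
    by_cases hg : ∀ x ∈ S.I, IntegrableOn g (Ico 0 x) S.dR₂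
    · obtain ⟨u₁, u₂, h⟩ := exists_isIntegralSolution hg 0 0
      exact ⟨u₁, u₂, fun _ => h⟩
    · exact ⟨0, 0, fun h => absurd h hg⟩
  choose U₁ U₂ hU using this
  let a : ℕ → ℝ → ℂ := fun n => Nat.rec (fun x => α + β * (S.R₁ x : ℂ))
    (fun _ φ => U₁ fun t => z * φ t) n
  let b : ℕ → ℝ → ℂ := fun n => Nat.casesOn n (fun _ => β) fun n => U₂ fun t => z * a n t
  have hloc : ∀ {u₁ u₂ g : ℝ → ℂ}, S.IsIntegralSolution u₁ u₂ g →
      ∀ x ∈ S.I, IntegrableOn u₁ (Ico 0 x) S.dR₂ := fun hu x hx =>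
    memLp_one_iff_integrable.1 (hu.memLp₁ hx 1)
  have hint : ∀ n, ∀ x ∈ S.I, IntegrableOn (a n) (Ico 0 x) S.dR₂ := by
    intro n
    induction n with
    | zero => exact hloc (isIntegralSolution_R₁ α β)
    | succ n ih => exact hloc (hU (fun t => z * a n t) fun x hx => (ih x hx).const_mul z).1
  have h := fun n => hU (fun t => z * a n t) fun x hx => (hint n x hx).const_mul z
  exact ⟨a, b, rfl, rfl, fun n => (h n).1, fun n => (h n).2.1, fun n => (h n).2.2⟩

namespace IsPicardSequence

variable {z α β : ℂ} {a b : ℕ → ℝ → ℂ} (h : IsPicardSequence S z α β a b)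
include h

theorem exists_isIntegralSolution (n : ℕ) : ∃ g, S.IsIntegralSolution (a n) (b n) g := by
  cases n with
  | zero =>
    rw [h.zero₁, h.zero₂]
    exact ⟨_, isIntegralSolution_R₁ α β⟩
  | succ n => exact ⟨_, h.succ n⟩

/-- One step integrates against `dR₂` for the second component and then against `dR₁`, which costs
at most a factor `1 + R₁`. That factor is the density of the measure used for the next iterated
integral. -/
theorem enorm_le (n : ℕ) : ∀ x ∈ S.I,
    ‖a n x‖ₑ ≤ (‖α‖ₑ + ‖β‖ₑ) * ‖z‖ₑ ^ n * ((1 + S.dR₁ (Ico 0 x)) * iterInt S.picardMeasure n x) ∧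
    ‖b n x‖ₑ ≤ (‖α‖ₑ + ‖β‖ₑ) * ‖z‖ₑ ^ n * iterInt S.picardMeasure n x := by
  induction n with
  | zero =>
    intro x hx
    rw [h.zero₁, h.zero₂]
    simp only [pow_zero, mul_one, iterInt]
    refine ⟨(enorm_add_le _ _).trans ?_, le_add_self⟩
    rw [enorm_mul, dR₁_Ico_zero hx, mul_add, mul_one, add_assoc]
    refine add_le_add_right ?_ _
    have : ‖(S.R₁ x : ℂ)‖ₑ = ENNReal.ofReal (S.R₁ x) := by
      rw [← ofReal_norm, Complex.norm_real, Real.norm_of_nonneg (R₁_nonneg hx)]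
    rw [this]
    exact (mul_le_mul_left le_add_self _).trans le_add_self
  | succ n ih =>
    have hb : ∀ x ∈ S.I, ‖b (n + 1) x‖ₑ
        ≤ (‖α‖ₑ + ‖β‖ₑ) * ‖z‖ₑ ^ (n + 1) * iterInt S.picardMeasure (n + 1) x := by
      intro x hx
      rw [(h.succ n x hx).2.2.2, h.init₂, zero_sub, enorm_neg]
      refine (enorm_integral_le_lintegral_enorm _).trans ?_
      have hm := (monotone_iterInt S.picardMeasure n).measurable
      change _ ≤ _ * ∫⁻ t in Ico 0 x, iterInt S.picardMeasure n t ∂S.picardMeasure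
      have hm' : Measurable fun t => (1 + S.dR₁ (Ico 0 t)) * iterInt S.picardMeasure n t :=
        monotone_one_add_dR₁.measurable.mul hm
      rw [setLIntegral_picardMeasure hm, ← lintegral_const_mul _ hm']
      refine setLIntegral_mono' measurableSet_Ico fun t ht => ?_
      rw [enorm_mul]
      refine (mul_le_mul_right (ih t (mem_of_le hx ht.1 ht.2.le)).1 ‖z‖ₑ).trans_eq ?_
      rw [pow_succ]
      ring
    intro x hx
    refine ⟨?_, hb x hx⟩
    rw [(h.succ n x hx).2.2.1, h.init₁, zero_add]
    refine (enorm_integral_le_lintegral_enorm _).trans ?_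
    refine (setLIntegral_mono' (g := fun _ => (‖α‖ₑ + ‖β‖ₑ) * ‖z‖ₑ ^ (n + 1)
      * iterInt S.picardMeasure (n + 1) x) measurableSet_Ico fun t ht => ?_).trans ?_
    · refine (hb t (mem_of_le hx ht.1 ht.2.le)).trans (mul_le_mul_right ?_ _)
      exact monotone_iterInt _ _ ht.2.le
    · rw [setLIntegral_const, mul_assoc (_ * _), mul_comm (iterInt _ _ _)]
      exact mul_le_mul_right (mul_le_mul_left le_add_self _) _

theorem norm_le {x Q K : ℝ} (hx : x ∈ S.I) (hQ : S.picardMeasure.real (Ico 0 x) ≤ Q)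
    (hK : S.R₁ x ≤ K) (n : ℕ) :
    ‖a n x‖ ≤ (‖α‖ + ‖β‖) * (1 + K) * ((‖z‖ * Q) ^ n / n.factorial) ∧
    ‖b n x‖ ≤ (‖α‖ + ‖β‖) * ((‖z‖ * Q) ^ n / n.factorial) := by
  obtain ⟨h1, h2⟩ := h.enorm_le n x hx
  obtain ⟨h3, h4⟩ := toReal_iterInt_le (picardMeasure_Ico_ne_top hx) n
  have h5 : (iterInt S.picardMeasure n x).toReal ≤ Q ^ n / n.factorial :=
    h4.trans (by gcongr)
  have e : ∀ c : ℂ, ‖c‖ₑ ≠ ∞ := fun c => enorm_ne_top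
  have hR := R₁_nonneg hx
  have h6 : (1 + S.dR₁ (Ico 0 x)).toReal = 1 + S.R₁ x := by
    rw [dR₁_Ico_zero hx, ENNReal.toReal_add (by simp) (by simp), ENNReal.toReal_ofReal hR,
      ENNReal.toReal_one]
  have h7 : (1 + S.dR₁ (Ico 0 x)) ≠ ∞ := by
    rw [dR₁_Ico_zero hx]
    simp
  have hC : (‖α‖ₑ + ‖β‖ₑ) * ‖z‖ₑ ^ n ≠ ∞ :=
    ENNReal.mul_ne_top (ENNReal.add_ne_top.2 ⟨e _, e _⟩) (ENNReal.pow_ne_top (e _))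
  have hC' : ((‖α‖ₑ + ‖β‖ₑ) * ‖z‖ₑ ^ n).toReal = (‖α‖ + ‖β‖) * ‖z‖ ^ n := by
    rw [ENNReal.toReal_mul, ENNReal.toReal_add (e _) (e _), ENNReal.toReal_pow]
    simp
  have k1 := ENNReal.toReal_mono (ENNReal.mul_ne_top hC (ENNReal.mul_ne_top h7 h3)) h1
  have k2 := ENNReal.toReal_mono (ENNReal.mul_ne_top hC h3) h2
  rw [ENNReal.toReal_mul, hC', ENNReal.toReal_mul, h6, toReal_enorm] at k1
  rw [ENNReal.toReal_mul, hC', toReal_enorm] at k2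
  rw [mul_pow]
  constructor
  · refine k1.trans ?_
    calc (‖α‖ + ‖β‖) * ‖z‖ ^ n * ((1 + S.R₁ x) * (iterInt S.picardMeasure n x).toReal)
        ≤ (‖α‖ + ‖β‖) * ‖z‖ ^ n * ((1 + K) * (Q ^ n / n.factorial)) := by
          gcongr
          linarith
      _ = _ := by ring
  · refine k2.trans ?_
    calc (‖α‖ + ‖β‖) * ‖z‖ ^ n * (iterInt S.picardMeasure n x).toReal
        ≤ (‖α‖ + ‖β‖) * ‖z‖ ^ n * (Q ^ n / n.factorial) := by gcongr
      _ = _ := by ring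

theorem norm_le_of_mem {x X : ℝ} (hX : X ∈ S.I) (hx : x ∈ Icc 0 X) (n : ℕ) :
    ‖a n x‖ ≤ (‖α‖ + ‖β‖) * (1 + S.R₁ X)
      * ((‖z‖ * S.picardMeasure.real (Ico 0 X)) ^ n / n.factorial) ∧
    ‖b n x‖ ≤ (‖α‖ + ‖β‖) * ((‖z‖ * S.picardMeasure.real (Ico 0 X)) ^ n / n.factorial) := by
  have hx' := mem_of_le hX hx.1 hx.2
  exact h.norm_le hx' (ENNReal.toReal_mono (picardMeasure_Ico_ne_top hX)
    (measure_mono (Ico_subset_Ico_right hx.2))) (S.monotoneOn₁ hx' hX hx.2) n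

theorem summable {x : ℝ} (hx : x ∈ S.I) : Summable (fun n => a n x) ∧ Summable fun n => b n x :=
  ⟨.of_norm_bounded ((Real.summable_pow_div_factorial _).mul_left _)
    fun n => (h.norm_le_of_mem hx ⟨hx.1, le_rfl⟩ n).1,
  .of_norm_bounded ((Real.summable_pow_div_factorial _).mul_left _)
    fun n => (h.norm_le_of_mem hx ⟨hx.1, le_rfl⟩ n).2⟩

theorem hasSum_integral₁ {x : ℝ} (hx : x ∈ S.I) :
    HasSum (fun n => ∫ t in Ico 0 x, b n t ∂S.dR₁) (∫ t in Ico 0 x, ∑' n, b n t ∂S.dR₁) := by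
  have := isFiniteMeasure₁ hx
  refine hasSum_integral_of_dominated_convergence (fun n _ => (‖α‖ + ‖β‖)
    * ((‖z‖ * S.picardMeasure.real (Ico 0 x)) ^ n / n.factorial)) (fun n => ?_) (fun n => ?_)
    (Eventually.of_forall fun _ => (Real.summable_pow_div_factorial _).mul_left _)
    (integrable_const _) ?_
  · obtain ⟨g, hg⟩ := h.exists_isIntegralSolution n
    exact (hg.aestronglyMeasurable₂ ae_mem₁).restrict
  · filter_upwards [ae_restrict_mem measurableSet_Ico] with t ht
    exact (h.norm_le_of_mem hx ⟨ht.1, ht.2.le⟩ n).2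
  · filter_upwards [ae_restrict_mem measurableSet_Ico] with t ht
    exact (h.summable (mem_of_le hx ht.1 ht.2.le)).2.hasSum

theorem hasSum_integral₂ {x : ℝ} (hx : x ∈ S.I) :
    HasSum (fun n => ∫ t in Ico 0 x, a n t ∂S.dR₂) (∫ t in Ico 0 x, ∑' n, a n t ∂S.dR₂) := by
  have := isFiniteMeasure₂ hx
  refine hasSum_integral_of_dominated_convergence (fun n _ => (‖α‖ + ‖β‖) * (1 + S.R₁ x)
    * ((‖z‖ * S.picardMeasure.real (Ico 0 x)) ^ n / n.factorial)) (fun n => ?_) (fun n => ?_)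
    (Eventually.of_forall fun _ => (Real.summable_pow_div_factorial _).mul_left _)
    (integrable_const _) ?_
  · obtain ⟨g, hg⟩ := h.exists_isIntegralSolution n
    exact (hg.aestronglyMeasurable₁ ae_mem₂).restrict
  · filter_upwards [ae_restrict_mem measurableSet_Ico] with t ht
    exact (h.norm_le_of_mem hx ⟨ht.1, ht.2.le⟩ n).1
  · filter_upwards [ae_restrict_mem measurableSet_Ico] with t ht
    exact (h.summable (mem_of_le hx ht.1 ht.2.le)).1.hasSum

theorem tsum_zero₁ : ∑' n, a n 0 = α := by
  rw [tsum_eq_single 0 fun n hn => ?_]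
  · simp [h.zero₁, S.R₁_zero]
  · obtain ⟨m, rfl⟩ := Nat.exists_eq_succ_of_ne_zero hn
    exact h.init₁ m

theorem tsum_zero₂ : ∑' n, b n 0 = β := by
  rw [tsum_eq_single 0 fun n hn => ?_]
  · simp [h.zero₂]
  · obtain ⟨m, rfl⟩ := Nat.exists_eq_succ_of_ne_zero hn
    exact h.init₂ m

theorem aestronglyMeasurable_tsum {κ : Measure ℝ} (hκ : ∀ᵐ x ∂κ, x ∈ S.I) :
    AEStronglyMeasurable (fun x => ∑' n, a n x) κ ∧
      AEStronglyMeasurable (fun x => ∑' n, b n x) κ := by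
  constructor
  · refine aestronglyMeasurable_of_tendsto_ae atTop (f := fun N x => ∑ n ∈ Finset.range N, a n x)
      (fun N => ?_) ?_
    · refine Finset.aestronglyMeasurable_fun_sum _ fun n _ => ?_
      obtain ⟨g, hg⟩ := h.exists_isIntegralSolution n
      exact hg.aestronglyMeasurable₁ hκ
    · filter_upwards [hκ] with x hx using (h.summable hx).1.hasSum.tendsto_sum_nat
  · refine aestronglyMeasurable_of_tendsto_ae atTop (f := fun N x => ∑ n ∈ Finset.range N, b n x)
      (fun N => ?_) ?_
    · refine Finset.aestronglyMeasurable_fun_sum _ fun n _ => ?_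
      obtain ⟨g, hg⟩ := h.exists_isIntegralSolution n
      exact hg.aestronglyMeasurable₂ hκ
    · filter_upwards [hκ] with x hx using (h.summable hx).2.hasSum.tendsto_sum_nat

theorem norm_tsum_le {x Q K : ℝ} (hx : x ∈ S.I) (hQ : S.picardMeasure.real (Ico 0 x) ≤ Q)
    (hK : S.R₁ x ≤ K) :
    ‖∑' n, a n x‖ ≤ (‖α‖ + ‖β‖) * (1 + K) * Real.exp (‖z‖ * Q) ∧
    ‖∑' n, b n x‖ ≤ (‖α‖ + ‖β‖) * Real.exp (‖z‖ * Q) := by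
  have hs : HasSum (fun n : ℕ => (‖z‖ * Q) ^ n / n.factorial) (Real.exp (‖z‖ * Q)) := by
    rw [Real.exp_eq_exp_ℝ]
    exact NormedSpace.expSeries_div_hasSum_exp _
  exact ⟨tsum_of_norm_bounded (hs.mul_left _) fun n => (h.norm_le hx hQ hK n).1,
    tsum_of_norm_bounded (hs.mul_left _) fun n => (h.norm_le hx hQ hK n).2⟩

theorem isSolution_tsum : S.IsSolution z (fun x => ∑' n, a n x) fun x => ∑' n, b n x := by
  intro x hx
  have := isFiniteMeasure₁ hx
  have := isFiniteMeasure₂ hx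
  have hb : ∀ t ∈ Icc 0 x, ‖∑' n, a n t‖ ≤ _ ∧ ‖∑' n, b n t‖ ≤ _ := fun t ht =>
    h.norm_tsum_le (mem_of_le hx ht.1 ht.2)
      (ENNReal.toReal_mono (picardMeasure_Ico_ne_top hx) (measure_mono (Ico_subset_Ico_right ht.2)))
      (S.monotoneOn₁ (mem_of_le hx ht.1 ht.2) hx ht.2)
  have i1 : IntegrableOn (fun x => ∑' n, b n x) (Ico 0 x) S.dR₁ :=
    (memLp_restrict_of_bound (h.aestronglyMeasurable_tsum ae_mem₁).2
      (fun t ht => (hb t ht).2) 1).integrable le_rfl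
  have i2 : IntegrableOn (fun x => ∑' n, a n x) (Ico 0 x) S.dR₂ :=
    (memLp_restrict_of_bound (h.aestronglyMeasurable_tsum ae_mem₂).1
      (fun t ht => (hb t ht).1) 1).integrable le_rfl
  refine ⟨i1, i2.const_mul z, ?_, ?_⟩
  · have h1 := (h.summable (zero_mem (S := S))).1.hasSum.add (h.hasSum_integral₁ hx)
    refine ((h.summable hx).1.hasSum.congr_fun fun n => ?_).unique h1
    obtain ⟨g, hg⟩ := h.exists_isIntegralSolution n
    exact ((hg x hx).2.2.1).symm
  · rw [integral_const_mul]
    have h1 : HasSum (fun n => -(z * ∫ t in Ico 0 x, a n t ∂S.dR₂))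
      (-(z * ∫ t in Ico 0 x, ∑' n, a n t ∂S.dR₂)) := ((h.hasSum_integral₂ hx).mul_left z).neg
    have h2 : HasSum (fun n => b n x) (b 0 x + -(z * ∫ t in Ico 0 x, ∑' n, a n t ∂S.dR₂)) := by
      refine HasSum.zero_add (h1.congr_fun fun n => ?_)
      rw [(h.succ n x hx).2.2.2, h.init₂, zero_sub, integral_const_mul]
    change ∑' n, b n x = (∑' n, b n 0) - _
    rw [h2.tsum_eq, h.tsum_zero₂, h.zero₂, ← sub_eq_add_neg]

end IsPicardSequence

/-- The boundedness clause is the regular-end case: if `dR₂` is finite and `R₁` is bounded almost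
everywhere, the exponential estimate of the series is uniform up to `b`. -/
theorem exists_isSolution (S : IntegralSystem) (z α β : ℂ) :
    ∃ u₁ u₂, S.IsSolution z u₁ u₂ ∧ u₁ 0 = α ∧ u₂ 0 = β ∧
      ∀ K : ℝ, S.dR₂ univ ≠ ∞ → (∀ᵐ x ∂S.dR₂, S.R₁ x ≤ K) → ∃ C : ℝ, ∀ᵐ x ∂S.dR₂, ‖u₁ x‖ ≤ C := by
  obtain ⟨a, b, h⟩ := exists_isPicardSequence S z α β
  refine ⟨_, _, h.isSolution_tsum, h.tsum_zero₁, h.tsum_zero₂, fun K hfin hK => ?_⟩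
  have hQ : ∀ x, S.picardMeasure (Ico 0 x) ≤ (1 + ENNReal.ofReal K) * S.dR₂ univ := by
    intro x
    rw [picardMeasure_Ico, ← lintegral_const]
    refine (lintegral_mono_ae ?_).trans (setLIntegral_le_lintegral _ _)
    refine ae_restrict_of_ae ?_
    filter_upwards [hK, ae_mem₂] with t ht hI
    rw [dR₁_Ico_zero hI]
    exact add_le_add_right (ENNReal.ofReal_le_ofReal ht) _
  have hQ' : (1 + ENNReal.ofReal K) * S.dR₂ univ ≠ ∞ := ENNReal.mul_ne_top (by simp) hfin
  refine ⟨(‖α‖ + ‖β‖) * (1 + K)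
    * Real.exp (‖z‖ * ((1 + ENNReal.ofReal K) * S.dR₂ univ).toReal), ?_⟩
  filter_upwards [hK, ae_mem₂] with x hx hI
  exact (h.norm_tsum_le hI (ENNReal.toReal_mono hQ' (hQ x)) hx).1

theorem exists_isFundamentalSystem (S : IntegralSystem) :
    ∃ c₁ c₂ s₁ s₂ : ℂ → ℝ → ℂ, S.IsFundamentalSystem c₁ c₂ s₁ s₂ := by
  choose c₁ c₂ hc using fun z => exists_isSolution S z 1 0
  choose s₁ s₂ hs using fun z => exists_isSolution S z 0 1
  exact ⟨c₁, c₂, s₁, s₂, fun z => ⟨⟨(hc z).1, (hc z).2.1, (hc z).2.2.1⟩,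
    ⟨(hs z).1, (hs z).2.1, (hs z).2.2.1⟩⟩⟩

/-! ### Definiteness and the limit point condition -/

theorem IsDefinite.eq_zero (hdef : S.IsDefinite) {α β : ℂ}
    (h : ∀ᵐ x ∂S.dR₂, α + β * (S.R₁ x : ℂ) = 0) : α = 0 ∧ β = 0 := by
  obtain ⟨b₀, -, hb⟩ := hdef
  exact hb α β (ae_restrict_of_ae h)

theorem IsIntegralSolution.eq_affine {u₁ u₂ g : ℝ → ℂ} (h : S.IsIntegralSolution u₁ u₂ g)
    (hg : g =ᵐ[S.dR₂] 0) {x : ℝ} (hx : x ∈ S.I) :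
    u₁ x = u₁ 0 + u₂ 0 * (S.R₁ x : ℂ) ∧ u₂ x = u₂ 0 := by
  have h2 : ∀ y ∈ S.I, u₂ y = u₂ 0 := fun y hy => by
    rw [(h y hy).2.2.2, integral_eq_zero_of_ae (ae_restrict_of_ae hg), sub_zero]
  refine ⟨?_, h2 x hx⟩
  rw [(h x hx).2.2.1, setIntegral_congr_fun (g := fun _ => u₂ 0) measurableSet_Ico fun t ht =>
    h2 t (mem_of_le hx ht.1 ht.2.le), setIntegral_const, Measure.real, dR₁_Ico_zero hx,
    ENNReal.toReal_ofReal (R₁_nonneg hx), mul_comm]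
  rfl

/-- With zero right-hand side a solution is `u₁(0) + u₂(0) R₁`, so definiteness reads off both
initial values. This is what makes the boundary maps well defined on classes. -/
theorem IsDefinite.init_eq_zero (hdef : S.IsDefinite) {u₁ u₂ g : ℝ → ℂ}
    (h : S.IsIntegralSolution u₁ u₂ g) (hg : g =ᵐ[S.dR₂] 0) (hu : u₁ =ᵐ[S.dR₂] 0) :
    u₁ 0 = 0 ∧ u₂ 0 = 0 := by
  refine hdef.eq_zero ?_
  filter_upwards [hu, ae_mem₂] with x hx hI
  rw [← (h.eq_affine hg hI).1, hx]
  rfl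

theorem Represents.init_eq_zero (hdef : S.IsDefinite) {u₁ u₂ f : ℝ → ℂ}
    (h : S.Represents u₁ u₂ f 0) : u₁ 0 = 0 ∧ u₂ 0 = 0 := by
  obtain ⟨⟨-, -, hs⟩, h1, h2⟩ := h
  exact hdef.init_eq_zero hs (h2.symm.trans (Lp.coeFn_zero _ _ _))
    (h1.symm.trans (Lp.coeFn_zero _ _ _))

theorem Represents.init_eq (hdef : S.IsDefinite) {u₁ u₂ f v₁ v₂ g : ℝ → ℂ} {p : S.L2 × S.L2}
    (hu : S.Represents u₁ u₂ f p) (hv : S.Represents v₁ v₂ g p) : u₁ 0 = v₁ 0 ∧ u₂ 0 = v₂ 0 := by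
  have h := hu.add (hv.smul (-1))
  rw [show p + (-1 : ℂ) • p = 0 by rw [neg_one_smul, add_neg_cancel]] at h
  have := h.init_eq_zero hdef
  simpa [← sub_eq_add_neg, sub_eq_zero] using this

theorem MemT.represents {u₁ u₂ f : ℝ → ℂ} (h : S.MemT u₁ u₂ f) :
    S.Represents u₁ u₂ f (h.1.toLp u₁, h.2.1.toLp f) :=
  ⟨h, h.1.coeFn_toLp, h.2.1.coeFn_toLp⟩

theorem IsSolution.represents {z : ℂ} {u₁ u₂ : ℝ → ℂ} (h : S.IsSolution z u₁ u₂)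
    (hu : MemLp u₁ 2 S.dR₂) :
    S.Represents u₁ u₂ (fun t => z * u₁ t) (hu.toLp u₁, z • hu.toLp u₁) := by
  refine ⟨⟨hu, hu.const_mul z, h⟩, hu.coeFn_toLp, ?_⟩
  filter_upwards [Lp.coeFn_smul z (hu.toLp u₁), hu.coeFn_toLp] with x h1 h2
  rw [h1, Pi.smul_apply, h2, smul_eq_mul]

theorem IsSolution.linear {z : ℂ} {u₁ u₂ v₁ v₂ : ℝ → ℂ} (hu : S.IsSolution z u₁ u₂)
    (hv : S.IsSolution z v₁ v₂) (a b : ℂ) :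
    S.IsSolution z (fun t => a * u₁ t + b * v₁ t) fun t => a * u₂ t + b * v₂ t := by
  have := IsIntegralSolution.linear hu hv a b
  refine this.congr (Eventually.of_forall fun t => ?_)
  ring

theorem IsSolution.init_eq_zero (hdef : S.IsDefinite) {z : ℂ} {u₁ u₂ : ℝ → ℂ}
    (h : S.IsSolution z u₁ u₂) (hu : u₁ =ᵐ[S.dR₂] 0) : u₁ 0 = 0 ∧ u₂ 0 = 0 := by
  refine hdef.init_eq_zero h ?_ hu
  filter_upwards [hu] with x hx
  rw [hx]
  exact mul_zero z

/-- In the limit point case the end `b` is singular. -/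
theorem IsLimitPoint.singular (hdef : S.IsDefinite) (hLP : S.IsLimitPoint) (K : ℝ)
    (hfin : S.dR₂ univ ≠ ∞) : ¬ ∀ᵐ x ∂S.dR₂, S.R₁ x ≤ K := by
  intro hK
  obtain ⟨z, -, hz⟩ := hLP
  obtain ⟨c₁, c₂, hc, hc1, hc2, hcb⟩ := exists_isSolution S z 1 0
  obtain ⟨s₁, s₂, hs, hs1, hs2, hsb⟩ := exists_isSolution S z 0 1
  have : IsFiniteMeasure S.dR₂ := ⟨lt_top_iff_ne_top.2 hfin⟩
  obtain ⟨C, hC⟩ := hcb K hfin hK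
  obtain ⟨D, hD⟩ := hsb K hfin hK
  have mc : MemLp c₁ 2 S.dR₂ := MemLp.of_bound (hc.aestronglyMeasurable₁ ae_mem₂) C hC
  have ms : MemLp s₁ 2 S.dR₂ := MemLp.of_bound (hs.aestronglyMeasurable₁ ae_mem₂) D hD
  obtain ⟨v, -, hv⟩ := finrank_eq_one_iff'.1 hz
  obtain ⟨a, ha⟩ := hv ⟨mc.toLp c₁, c₁, c₂, _, hc.represents mc⟩
  obtain ⟨b, hb⟩ := hv ⟨ms.toLp s₁, s₁, s₂, _, hs.represents ms⟩
  have ha' : a • (v : S.L2) = mc.toLp c₁ := congrArg Subtype.val ha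
  have hb' : b • (v : S.L2) = ms.toLp s₁ := congrArg Subtype.val hb
  have h0 : b • mc.toLp c₁ + (-a) • ms.toLp s₁ = 0 := by
    rw [← ha', ← hb', smul_smul, smul_smul, ← add_smul]
    rw [mul_comm b a, neg_mul, add_neg_cancel, zero_smul]
  have h1 : (fun t => b * c₁ t + -a * s₁ t) =ᵐ[S.dR₂] 0 := by
    have e0 := Lp.coeFn_zero ℂ 2 S.dR₂
    rw [← h0] at e0
    filter_upwards [e0, Lp.coeFn_add (b • mc.toLp c₁) ((-a) • ms.toLp s₁),
      Lp.coeFn_smul b (mc.toLp c₁), Lp.coeFn_smul (-a) (ms.toLp s₁), mc.coeFn_toLp,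
      ms.coeFn_toLp] with x k1 k2 k3 k4 k5 k6
    rw [k2, Pi.add_apply, k3, k4, Pi.smul_apply, Pi.smul_apply, k5, k6] at k1
    exact k1
  -- Both `c₁` and `s₁` are multiples of one vector, so `b c₁ - a s₁` vanishes. Its initial values
  -- are `(b, -a)`, hence `a = 0`, and then `c₁` is null, against `c₁(0) = 1`.
  have h2 := (hc.linear hs b (-a)).init_eq_zero hdef h1
  simp only [hc1, hs1, hc2, hs2, mul_one, mul_zero, add_zero, zero_add, neg_eq_zero] at h2
  rw [h2.2, zero_smul] at ha'
  have h3 : c₁ =ᵐ[S.dR₂] 0 := by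
    rw [eq_comm, Lp.eq_zero_iff_ae_eq_zero] at ha'
    exact mc.coeFn_toLp.symm.trans ha'
  exact one_ne_zero (hc1 ▸ (hc.init_eq_zero hdef h3).1)

theorem setIntegral_Ico_sub {μ : Measure ℝ} {f : ℝ → ℂ} {y x : ℝ} (hy : 0 ≤ y) (hyx : y ≤ x)
    (hf : IntegrableOn f (Ico 0 x) μ) :
    ∫ t in Ico 0 x, f t ∂μ = (∫ t in Ico 0 y, f t ∂μ) + ∫ t in Ico y x, f t ∂μ := by
  rw [← Ico_union_Ico_eq_Ico hy hyx, setIntegral_union ?_ measurableSet_Ico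
    (hf.mono_set (Ico_subset_Ico_right hyx)) (hf.mono_set (Ico_subset_Ico_left hy))]
  rw [Set.disjoint_left]
  exact fun t h1 h2 => not_le.2 h1.2 h2.1

theorem IsIntegralSolution.eq_add {u₁ u₂ g : ℝ → ℂ} (h : S.IsIntegralSolution u₁ u₂ g) {y x : ℝ}
    (hx : x ∈ S.I) (hy : 0 ≤ y) (hyx : y ≤ x) :
    u₁ x = u₁ y + ∫ t in Ico y x, u₂ t ∂S.dR₁ ∧ u₂ x = u₂ y - ∫ t in Ico y x, g t ∂S.dR₂ := by
  have hy' := mem_of_le hx hy hyx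
  obtain ⟨h1, h2, h3, h4⟩ := h x hx
  rw [h3, h4, (h y hy').2.2.1, (h y hy').2.2.2, setIntegral_Ico_sub hy hyx h1,
    setIntegral_Ico_sub hy hyx h2]
  constructor <;> ring

theorem ae_lt_of_measure_Ioi_eq_zero {l : ℝ} (h : ∀ᵐ x ∂S.dR₂, ¬ l < x) (hl : l ∈ S.I) :
    S.dR₂ univ ≠ ∞ ∧ ∀ᵐ x ∂S.dR₂, S.R₁ x ≤ S.R₁ l := by
  constructor
  · obtain ⟨l', hl', hll⟩ := exists_gt_mem_halfOpen hl
    have : S.dR₂ univ ≤ S.dR₂ (Ico 0 l') := by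
      refine measure_mono_ae ?_
      filter_upwards [h, ae_mem₂] with x hx hI _
      exact ⟨hI.1, (not_lt.1 hx).trans_lt hll⟩
    exact ne_top_of_le_ne_top (by rw [dR₂_Ico_zero hl']; simp) this
  · filter_upwards [h, ae_mem₂] with x hx hI
    exact S.monotoneOn₁ hI hl (not_lt.1 hx)

/-- Beyond the support of a compactly supported element of `𝒯` there is a point where the boundary
terms with every element of `𝒯` vanish. -/
theorem exists_boundary_eq_zero (hdef : S.IsDefinite) (hLP : S.IsLimitPoint)
    {u₁ u₂ f v₁ v₂ g : ℝ → ℂ} (hu : S.MemT u₁ u₂ f) (hv : S.MemT v₁ v₂ g) {l : ℝ} (hl : l ∈ S.I)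
    (hs : ∀ᵐ x ∂S.dR₂, l < x → u₁ x = 0 ∧ f x = 0) :
    ∃ x ∈ S.I, l < x ∧ u₁ x = 0 ∧ u₂ x * v₁ x = 0 := by
  -- The support condition holds only `dR₂`-almost everywhere, so an actual zero of `u₁` beyond `l`
  -- requires that `dR₂` charge every neighbourhood of `b`.
  have hex : ∀ l ∈ S.I, ∃ᵐ x ∂S.dR₂, l < x := by
    intro l hl hn
    obtain ⟨h1, h2⟩ := ae_lt_of_measure_Ioi_eq_zero hn hl
    exact hLP.singular hdef _ h1 h2
  obtain ⟨y, hy, hly⟩ := exists_gt_mem_halfOpen hl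
  have hu2 : ∀ x ∈ S.I, y ≤ x → u₂ x = u₂ y := by
    intro x hx hyx
    rw [(hu.2.2.eq_add hx hy.1 hyx).2, setIntegral_eq_zero_of_ae_eq_zero, sub_zero]
    filter_upwards [hs] with t ht hty
    exact (ht (hly.trans_le hty.1)).2
  have hu1 : ∀ x ∈ S.I, ∀ w ∈ S.I, y ≤ x → x ≤ w →
      u₁ w = u₁ x + (S.R₁ w - S.R₁ x : ℝ) * u₂ y := by
    intro x hx w hw hyx hxw
    rw [(hu.2.2.eq_add hw hx.1 hxw).1, setIntegral_congr_fun (g := fun _ => u₂ y)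
      measurableSet_Ico fun t ht => hu2 t (mem_of_le hw (hx.1.trans ht.1) ht.2.le) (hyx.trans ht.1),
      setIntegral_const, Measure.real, dR₁_Ico hx.1 hxw hw, ENNReal.toReal_ofReal
      (sub_nonneg.2 (S.monotoneOn₁ hx hw hxw))]
    rfl
  obtain ⟨x, hyx, hx0, hx⟩ := ((hex y hy).and_eventually (hs.and ae_mem₂)).exists
  have hux := (hx0 (hly.trans hyx)).1
  refine ⟨x, hx, hly.trans hyx, hux, ?_⟩
  rw [hu2 x hx hyx.le, mul_eq_zero]
  -- Beyond the support `u₂` is constant and `u₁` is affine in `R₁`. A nonzero constant together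
  -- with the zeros of `u₁` forces `R₁` to be stationary for `dR₂` beyond `x`.
  by_contra! hc
  have hR : ∀ᵐ t ∂S.dR₂, x ≤ t → S.R₁ t = S.R₁ x := by
    filter_upwards [hs, ae_mem₂] with t ht htI hxt
    have h1 := hu1 x hx t htI hyx.le hxt
    rw [hux, (ht (hly.trans (hyx.trans_le hxt))).1, zero_add, eq_comm, mul_eq_zero] at h1
    have := h1.resolve_right hc.1
    exact sub_eq_zero.1 (Complex.ofReal_eq_zero.1 this)
  have hRle : ∀ᵐ t ∂S.dR₂, S.R₁ t ≤ S.R₁ x := by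
    filter_upwards [hR, ae_mem₂] with t ht htI
    rcases le_total x t with h | h
    · exact (ht h).le
    · exact S.monotoneOn₁ htI hx h
  -- There `v₁` is constant as well; being nonzero and square integrable, it leaves only finite mass
  -- beyond `x`. This makes `b` regular.
  have hfin : S.dR₂ univ ≠ ∞ := by
    have hv1 : ∀ᵐ t ∂S.dR₂, x ≤ t → v₁ t = v₁ x := by
      filter_upwards [hR, ae_mem₂] with t ht htI hxt
      rw [(hv.2.2.eq_add htI hx.1 hxt).1, setIntegral_measure_zero, add_zero]
      rw [dR₁_Ico hx.1 hxt htI, ht hxt, sub_self, ENNReal.ofReal_zero]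
    have hlt := hv.1.meas_ge_lt_top (by norm_num) (by norm_num) (ε := ‖v₁ x‖₊)
      (nnnorm_ne_zero_iff.2 hc.2)
    have : S.dR₂ univ ≤ S.dR₂ (Ico 0 x ∪ {t | ‖v₁ x‖₊ ≤ ‖v₁ t‖₊}) := by
      refine measure_mono_ae ?_
      filter_upwards [hv1, ae_mem₂] with t ht htI _
      rcases lt_or_ge t x with h | h
      · exact Or.inl ⟨htI.1, h⟩
      · exact Or.inr (show ‖v₁ x‖₊ ≤ ‖v₁ t‖₊ by rw [ht h])
    refine ne_top_of_le_ne_top ?_ (this.trans (measure_union_le _ _))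
    exact ENNReal.add_ne_top.2 ⟨by rw [dR₂_Ico_zero hx]; simp, hlt.ne⟩
  exact hLP.singular hdef _ hfin hRle

/-! ### Green's identity for compactly supported elements -/

theorem inner_eq_integral {p q : S.L2} {u v : ℝ → ℂ} (hp : p =ᵐ[S.dR₂] u) (hq : q =ᵐ[S.dR₂] v) :
    inner ℂ q p = ∫ x, u x * conj (v x) ∂S.dR₂ := by
  rw [L2.inner_def]
  refine integral_congr_ae ?_
  filter_upwards [hp, hq] with x h1 h2
  rw [h1, h2, RCLike.inner_apply]

theorem setIntegral_Ico_eq_integral {h : ℝ → ℂ} {l x : ℝ} (hlx : l < x)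
    (hs : ∀ᵐ t ∂S.dR₂, l < t → h t = 0) : ∫ t, h t ∂S.dR₂ = ∫ t in Ico 0 x, h t ∂S.dR₂ := by
  refine (setIntegral_eq_integral_of_ae_compl_eq_zero ?_).symm
  filter_upwards [hs, ae_mem₂] with t ht hI htx
  refine ht (hlx.trans_le ?_)
  by_contra hc
  exact htx ⟨hI.1, not_le.1 hc⟩

theorem green_of_compact (hd : S.NoCommonDiscontinuity) (hdef : S.IsDefinite)
    (hLP : S.IsLimitPoint) {u₁ u₂ f v₁ v₂ g : ℝ → ℂ} {p q : S.L2 × S.L2}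
    (hu : S.Represents u₁ u₂ f p) (hv : S.Represents v₁ v₂ g q) {l : ℝ} (hl : l ∈ S.I)
    (hs : ∀ᵐ x ∂S.dR₂, l < x → u₁ x = 0 ∧ f x = 0) :
    inner ℂ q.1 p.2 - inner ℂ q.2 p.1 = u₂ 0 * conj (v₁ 0) - u₁ 0 * conj (v₂ 0) := by
  obtain ⟨x, hx, hlx, hux, huv⟩ := exists_boundary_eq_zero hdef hLP hu.1 hv.1 hl hs
  rw [inner_eq_integral hu.2.2 hv.2.1, inner_eq_integral hu.2.1 hv.2.2,
    setIntegral_Ico_eq_integral (h := fun t => f t * conj (v₁ t)) hlx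
      (hs.mono fun t ht h => by rw [(ht h).2, zero_mul]),
    setIntegral_Ico_eq_integral (h := fun t => u₁ t * conj (g t)) hlx
      (hs.mono fun t ht h => by rw [(ht h).1, zero_mul])]
  have h := hu.1.2.2.wronskian_eq hd hv.1.2.2.conj hx
  have h0 : u₂ x * conj (v₁ x) = 0 := by
    rcases mul_eq_zero.1 huv with h | h <;> simp [h]
  rw [hux, zero_mul, h0] at h
  linear_combination -h

/-- Integration by parts of `conj u₁` against `u₂` up to a zero of `u₁`; the remainder `D` is the
integral of `|u₂|²` with respect to `dR₁`. -/
theorem energy_of_compact (hd : S.NoCommonDiscontinuity) (hdef : S.IsDefinite)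
    (hLP : S.IsLimitPoint) {u₁ u₂ f : ℝ → ℂ} {p : S.L2 × S.L2}
    (hu : S.Represents u₁ u₂ f p) {l : ℝ} (hl : l ∈ S.I)
    (hs : ∀ᵐ x ∂S.dR₂, l < x → u₁ x = 0 ∧ f x = 0) :
    ∃ D : ℝ, 0 ≤ D ∧ inner ℂ p.1 p.2 = conj (u₁ 0) * u₂ 0 + D := by
  obtain ⟨x, hx, hlx, hux, -⟩ := exists_boundary_eq_zero hdef hLP hu.1 hu.1 hl hs
  refine ⟨∫ t in Ico 0 x, ‖u₂ t‖ ^ 2 ∂S.dR₁, integral_nonneg fun t => sq_nonneg _, ?_⟩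
  have h := (hu.1.2.2.conj.mul_eq hd hu.1.2.2 hx).2.2
  rw [hux, map_zero, zero_mul] at h
  rw [inner_eq_integral hu.2.2 hu.2.1,
    setIntegral_Ico_eq_integral (h := fun t => f t * conj (u₁ t)) hlx
      (hs.mono fun t ht h => by rw [(ht h).2, zero_mul]), ← integral_complex_ofReal]
  have e : ∀ t, ((‖u₂ t‖ ^ 2 : ℝ) : ℂ) = conj (u₂ t) * u₂ t := fun t => by
    rw [Complex.conj_mul', Complex.ofReal_pow]
  simp only [e, mul_comm (f _)]
  linear_combination h

/-! ### Compactly supported elements with prescribed boundary values -/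

theorem ae_eq_zero_of_integral_mul_conj {μ : Measure ℝ} {φ : ℝ → ℂ} (hφ : MemLp φ 2 μ)
    (h : ∫ t, φ t * conj (φ t) ∂μ = 0) : φ =ᵐ[μ] 0 := by
  have hi := (memLp_two_iff_integrable_sq_norm hφ.1).1 hφ
  have e : ∀ t, φ t * conj (φ t) = ((‖φ t‖ ^ 2 : ℝ) : ℂ) := fun t => by
    rw [Complex.mul_conj', Complex.ofReal_pow]
  simp only [e] at h
  rw [integral_complex_ofReal, Complex.ofReal_eq_zero,
    integral_eq_zero_iff_of_nonneg (fun t => sq_nonneg _) hi] at h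
  filter_upwards [h] with t ht
  simpa using ht

theorem R₁_memLp {x : ℝ} (hx : x ∈ S.I) (α β : ℂ) (p : ℝ≥0∞) :
    MemLp (fun t => α + β * (S.R₁ t : ℂ)) p (S.dR₂.restrict (Ico 0 x)) :=
  (isIntegralSolution_R₁ α β).memLp₁ hx p

theorem R₁_mul_integrable {x : ℝ} (hx : x ∈ S.I) {f : ℝ → ℂ}
    (hf : MemLp f 2 (S.dR₂.restrict (Ico 0 x))) :
    IntegrableOn (fun t => (S.R₁ t : ℂ) * f t) (Ico 0 x) S.dR₂ := by
  have := (R₁_memLp hx 0 1 2).integrable_mul hf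
  simpa using! this

/-- The moment problem for `1` and `R₁` in `L²(R₂, [0, l))`. -/
theorem exists_moments {l : ℝ} (hl : l ∈ S.I)
    (hdef : ∀ α β : ℂ, (∀ᵐ x ∂(S.dR₂.restrict (Ico 0 l)), α + β * (S.R₁ x : ℂ) = 0) →
      α = 0 ∧ β = 0) (A B : ℂ) :
    ∃ a b : ℂ, (∫ t in Ico 0 l, a + b * (S.R₁ t : ℂ) ∂S.dR₂) = A ∧
      (∫ t in Ico 0 l, (S.R₁ t : ℂ) * (a + b * (S.R₁ t : ℂ)) ∂S.dR₂) = B := by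
  have i0 : ∀ a b : ℂ, IntegrableOn (fun t => a + b * (S.R₁ t : ℂ)) (Ico 0 l) S.dR₂ :=
    fun a b => memLp_one_iff_integrable.1 (R₁_memLp hl a b 1)
  have i1 : ∀ a b : ℂ, IntegrableOn (fun t => (S.R₁ t : ℂ) * (a + b * (S.R₁ t : ℂ)))
    (Ico 0 l) S.dR₂ := fun a b => R₁_mul_integrable hl (R₁_memLp hl a b 2)
  -- The Gram map of `1` and `R₁`. A kernel vector yields a function `a + b R₁` of zero norm, so
  -- definiteness gives injectivity, and surjectivity follows by dimension.
  let G : ℂ × ℂ →ₗ[ℂ] ℂ × ℂ :=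
    { toFun := fun p => (∫ t in Ico 0 l, p.1 + p.2 * (S.R₁ t : ℂ) ∂S.dR₂,
        ∫ t in Ico 0 l, (S.R₁ t : ℂ) * (p.1 + p.2 * (S.R₁ t : ℂ)) ∂S.dR₂)
      map_add' := fun p q => by
        ext
        · simp only [Prod.fst_add, Prod.snd_add]
          rw [← integral_add (i0 _ _) (i0 _ _)]
          congr 1
          ext t
          ring
        · simp only [Prod.fst_add, Prod.snd_add]
          rw [← integral_add (i1 _ _) (i1 _ _)]
          congr 1
          ext t
          ring
      map_smul' := fun c p => by
        ext
        · simp only [Prod.smul_fst, Prod.smul_snd, smul_eq_mul, RingHom.id_apply]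
          rw [← integral_const_mul]
          congr 1
          ext t
          ring
        · simp only [Prod.smul_fst, Prod.smul_snd, smul_eq_mul, RingHom.id_apply]
          rw [← integral_const_mul]
          congr 1
          ext t
          ring }
  have hinj : Function.Injective G := by
    rw [injective_iff_map_eq_zero]
    rintro ⟨a, b⟩ hab
    obtain ⟨h1, h2⟩ := Prod.mk.inj hab
    have h3 := ae_eq_zero_of_integral_mul_conj (R₁_memLp hl a b 2) (by
      have e : ∀ t : ℝ, (a + b * (S.R₁ t : ℂ)) * conj (a + b * (S.R₁ t : ℂ))
          = conj a * (a + b * (S.R₁ t : ℂ)) + conj b * ((S.R₁ t : ℂ) * (a + b * (S.R₁ t : ℂ))) :=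
        fun t => by
          rw [map_add, map_mul, Complex.conj_ofReal]
          ring
      simp only [e]
      rw [integral_add ((i0 a b).const_mul _) ((i1 a b).const_mul _), integral_const_mul,
        integral_const_mul]
      simp only at h1 h2
      rw [h1, h2]
      simp)
    obtain ⟨rfl, rfl⟩ := hdef a b h3
    rfl
  obtain ⟨⟨a, b⟩, hab⟩ := (LinearMap.injective_iff_surjective.1 hinj) (A, B)
  exact ⟨a, b, (Prod.mk.inj hab).1, (Prod.mk.inj hab).2⟩

/-- The first moment makes `u₂` vanish beyond `l`; the Wronskian with the solution `(R₁, 1)` then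
shows that the second moment does the same for `u₁`. -/
theorem exists_compact (hd : S.NoCommonDiscontinuity) {l : ℝ} (hl : l ∈ S.I) {f : ℝ → ℂ}
    (hf : MemLp f 2 (S.dR₂.restrict (Ico 0 l))) {α β : ℂ}
    (h₀ : ∫ t in Ico 0 l, f t ∂S.dR₂ = β) (h₁ : ∫ t in Ico 0 l, (S.R₁ t : ℂ) * f t ∂S.dR₂ = -α) :
    ∃ u₁ u₂, S.MemT u₁ u₂ ((Ico 0 l).indicator f) ∧ u₁ 0 = α ∧ u₂ 0 = β ∧
      ∀ x ∈ S.I, l ≤ x → u₁ x = 0 ∧ u₂ x = 0 := by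
  have hF : MemLp ((Ico 0 l).indicator f) 2 S.dR₂ :=
    (memLp_indicator_iff_restrict measurableSet_Ico).2 hf
  obtain ⟨u₁, u₂, hu, hu1, hu2⟩ :=
    exists_isIntegralSolution (fun x hx => MemLp.integrableOn_Ico hF hx) α β
  have hcut : ∀ x, l ≤ x → ∀ h : ℝ → ℂ, ∫ t in Ico 0 x, (Ico 0 l).indicator h t ∂S.dR₂
      = ∫ t in Ico 0 l, h t ∂S.dR₂ := by
    intro x hx h
    rw [setIntegral_indicator measurableSet_Ico, inter_eq_right.2 (Ico_subset_Ico_right hx)]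
  have hz2 : ∀ x ∈ S.I, l ≤ x → u₂ x = 0 := by
    intro x hx hlx
    rw [(hu x hx).2.2.2, hu2, hcut x hlx, h₀, sub_self]
  have hz1 : ∀ x ∈ S.I, l ≤ x → u₁ x = 0 := by
    intro x hx hlx
    have h := hu.wronskian_eq hd (isIntegralSolution_R₁ 0 1) hx
    have e : ∀ t, (Ico 0 l).indicator f t * (0 + 1 * (S.R₁ t : ℂ))
        = (Ico 0 l).indicator (fun t => (S.R₁ t : ℂ) * f t) t := fun t => by
      by_cases ht : t ∈ Ico 0 l
      · rw [indicator_of_mem ht, indicator_of_mem ht]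
        ring
      · rw [indicator_of_notMem ht, indicator_of_notMem ht, zero_mul]
    simp only [e] at h
    rw [hcut x hlx, h₁, hz2 x hx hlx, hu1, S.R₁_zero] at h
    simpa using h
  refine ⟨u₁, u₂, ⟨?_, hF, hu⟩, hu1, hu2, fun x hx hlx => ⟨hz1 x hx hlx, hz2 x hx hlx⟩⟩
  have h := (memLp_indicator_iff_restrict (measurableSet_Ico (a := (0 : ℝ)) (b := l))).2
    (hu.memLp₁ hl 2)
  refine h.ae_eq ?_
  filter_upwards [ae_mem₂] with x hx
  by_cases hxl : x < l
  · rw [indicator_of_mem (show x ∈ Ico 0 l from ⟨hx.1, hxl⟩)]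
  · rw [indicator_of_notMem (fun h => hxl h.2), hz1 x hx (not_lt.1 hxl)]

theorem exists_compact_init (hd : S.NoCommonDiscontinuity) (hdef : S.IsDefinite) (α β : ℂ) :
    ∃ l ∈ S.I, ∃ u₁ u₂ f, S.MemT u₁ u₂ f ∧ u₁ 0 = α ∧ u₂ 0 = β ∧
      ∀ᵐ x ∂S.dR₂, l < x → u₁ x = 0 ∧ f x = 0 := by
  obtain ⟨l, hl, hb⟩ := hdef
  obtain ⟨a, b, h1, h2⟩ := exists_moments hl hb β (-α)
  obtain ⟨u₁, u₂, hm, hu1, hu2, hz⟩ := exists_compact hd hl (R₁_memLp hl a b 2) h1 h2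
  refine ⟨l, hl, u₁, u₂, _, hm, hu1, hu2, ?_⟩
  filter_upwards [ae_mem₂] with x hx hlx
  exact ⟨(hz x hx hlx.le).1, indicator_of_notMem (fun h => lt_asymm hlx h.2) _⟩

/-! ### The adjoint of the minimal relation -/

theorem Tpre_le_Tmax : S.Tpre ≤ S.Tmax := fun _ ⟨u₁, u₂, f, h, _⟩ => ⟨u₁, u₂, f, h⟩

theorem Tmax_le_adjoint_Tpre (hd : S.NoCommonDiscontinuity) (hdef : S.IsDefinite)
    (hLP : S.IsLimitPoint) : S.Tmax ≤ S.Tpre.adjoint := by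
  rintro q ⟨v₁, v₂, g, hv⟩
  rw [mem_adjoint_iff_inner]
  rintro p ⟨u₁, u₂, f, hu, h1, h2, l, hl, hs⟩
  have := green_of_compact hd hdef hLP hu hv hl hs
  rwa [h1, h2, zero_mul, zero_mul, sub_zero, sub_eq_zero] at this

/-- Let `φ` be `q.1 - w₁` minus its projection onto the span of `1` and `R₁` on `[0, l)`. Having
zero moments, `φ` is the right-hand side of an element of `Tpre`. The adjoint relation and the
Wronskian with `w` make it orthogonal to `q.1 - w₁`, hence to itself. -/
theorem exists_affine_of_mem_adjoint (hd : S.NoCommonDiscontinuity) {q : S.L2 × S.L2}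
    (hq : q ∈ S.Tpre.adjoint) {w₁ w₂ : ℝ → ℂ} (hw : S.IsIntegralSolution w₁ w₂ q.2)
    {l : ℝ} (hl : l ∈ S.I)
    (hdef : ∀ α β : ℂ, (∀ᵐ x ∂(S.dR₂.restrict (Ico 0 l)), α + β * (S.R₁ x : ℂ) = 0) →
      α = 0 ∧ β = 0) :
    ∃ a b : ℂ, ∀ᵐ x ∂(S.dR₂.restrict (Ico 0 l)), q.1 x = w₁ x + (a + b * (S.R₁ x : ℂ)) := by
  have := isFiniteMeasure₂ hl
  have mv : MemLp q.1 2 (S.dR₂.restrict (Ico 0 l)) := (Lp.memLp q.1).restrict _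
  have mw := hw.memLp₁ hl 2
  have mh : MemLp (fun t => q.1 t - w₁ t) 2 (S.dR₂.restrict (Ico 0 l)) := mv.sub mw
  obtain ⟨a, b, hA, hB⟩ := exists_moments hl hdef (∫ t in Ico 0 l, q.1 t - w₁ t ∂S.dR₂)
    (∫ t in Ico 0 l, (S.R₁ t : ℂ) * (q.1 t - w₁ t) ∂S.dR₂)
  have mr := R₁_memLp hl a b 2
  set φ : ℝ → ℂ := fun t => q.1 t - w₁ t - (a + b * (S.R₁ t : ℂ)) with hφ
  have mφ : MemLp φ 2 (S.dR₂.restrict (Ico 0 l)) := mh.sub mr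
  have m0 : ∫ t in Ico 0 l, φ t ∂S.dR₂ = 0 := by
    rw [hφ, integral_sub (mh.integrable (by norm_num)) (mr.integrable (by norm_num)), hA, sub_self]
  have m1 : ∫ t in Ico 0 l, (S.R₁ t : ℂ) * φ t ∂S.dR₂ = 0 := by
    simp only [hφ, mul_sub (_ : ℂ) (_ - _)]
    rw [integral_sub (R₁_mul_integrable hl mh) (R₁_mul_integrable hl mr), hB, sub_self]
  obtain ⟨u₁, u₂, hu, hu1, hu2, hz⟩ := exists_compact hd hl mφ m0 (α := 0) (by rw [m1, neg_zero])
  have hmem : (hu.1.toLp u₁, hu.2.1.toLp ((Ico 0 l).indicator φ)) ∈ S.Tpre := by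
    refine ⟨u₁, u₂, _, hu.represents, hu1, hu2, l, hl, ?_⟩
    filter_upwards [ae_mem₂] with x hx hlx
    exact ⟨(hz x hx hlx.le).1, indicator_of_notMem (fun h => lt_asymm hlx h.2) _⟩
  have hin := mem_adjoint_iff_inner.1 hq _ hmem
  simp only at hin
  rw [inner_eq_integral hu.2.1.coeFn_toLp Filter.EventuallyEq.rfl,
    inner_eq_integral hu.1.coeFn_toLp Filter.EventuallyEq.rfl,
    ← setIntegral_eq_integral_of_ae_compl_eq_zero (s := Ico 0 l) (Eventually.of_forall
      fun t ht => by rw [indicator_of_notMem ht, zero_mul]),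
    ← setIntegral_eq_integral_of_ae_compl_eq_zero (s := Ico 0 l)
      (f := fun t => u₁ t * conj (q.2 t)) (by
        filter_upwards [ae_mem₂] with t ht htl
        rw [(hz t ht (not_lt.1 fun h => htl ⟨ht.1, h⟩)).1, zero_mul])] at hin
  have hW := hu.2.2.wronskian_eq hd hw.conj hl
  rw [(hz l hl le_rfl).1, (hz l hl le_rfl).2, hu1, hu2] at hW
  have e1 : ∀ ψ : ℝ → ℂ, ∫ t in Ico 0 l, (Ico 0 l).indicator φ t * ψ t ∂S.dR₂
      = ∫ t in Ico 0 l, φ t * ψ t ∂S.dR₂ := fun ψ =>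
    setIntegral_congr_fun measurableSet_Ico fun t ht => by simp only [indicator_of_mem ht]
  rw [e1] at hin hW
  have hmul : ∀ ψ : ℝ → ℂ, MemLp ψ 2 (S.dR₂.restrict (Ico 0 l)) →
      IntegrableOn (fun t => φ t * conj (ψ t)) (Ico 0 l) S.dR₂ := fun ψ hψ =>
    mφ.integrable_mul hψ.star
  have h0 : ∫ t in Ico 0 l, φ t * conj (φ t) ∂S.dR₂ = 0 := by
    have i0 : IntegrableOn φ (Ico 0 l) S.dR₂ := mφ.integrable (by norm_num)
    have i1 := R₁_mul_integrable hl mφ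
    have e2 : ∀ t, φ t * conj (φ t) = φ t * conj (q.1 t) - φ t * conj (w₁ t)
        - (conj a * φ t + conj b * ((S.R₁ t : ℂ) * φ t)) := fun t => by
      conv_lhs => rw [show conj (φ t) = conj (q.1 t) - conj (w₁ t)
        - (conj a + conj b * (S.R₁ t : ℂ)) by simp [hφ]]
      ring
    have i2 : IntegrableOn (fun t => φ t * conj (q.1 t) - φ t * conj (w₁ t)) (Ico 0 l) S.dR₂ :=
      (hmul _ mv).sub (hmul _ mw)
    have i3 : IntegrableOn (fun t => conj a * φ t + conj b * ((S.R₁ t : ℂ) * φ t)) (Ico 0 l)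
      S.dR₂ := (i0.const_mul _).add (i1.const_mul _)
    simp only [e2]
    rw [integral_sub i2 i3,
      integral_sub (hmul _ mv) (hmul _ mw), integral_add (i0.const_mul _) (i1.const_mul _),
      integral_const_mul, integral_const_mul, m0, m1]
    linear_combination hin + hW
  refine ⟨a, b, ?_⟩
  filter_upwards [ae_eq_zero_of_integral_mul_conj mφ h0] with t ht
  have ht' : q.1 t - w₁ t - (a + b * (S.R₁ t : ℂ)) = 0 := ht
  linear_combination ht'

/-- The affine corrections found on larger intervals agree with the one on `[0, b₀)` by
definiteness, so a single solution represents `q.1` on all of `[0, b)`. -/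
theorem adjoint_Tpre_le_Tmax (hd : S.NoCommonDiscontinuity) (hdef : S.IsDefinite) :
    S.Tpre.adjoint ≤ S.Tmax := by
  intro q hq
  obtain ⟨b₀, hb, hb'⟩ := hdef
  obtain ⟨w₁, w₂, hw, -, -⟩ := exists_isIntegralSolution (g := q.2)
    (fun x hx => MemLp.integrableOn_Ico (Lp.memLp q.2) hx) 0 0
  obtain ⟨a, b, hab⟩ := exists_affine_of_mem_adjoint hd hq hw hb hb'
  have hall : ∀ᵐ x ∂S.dR₂, q.1 x = w₁ x + (a + b * (S.R₁ x : ℂ)) := by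
    refine ae_of_forall_restrict fun x hx => ?_
    have hm : max x b₀ ∈ S.I := by
      rcases max_choice x b₀ with h | h <;> rwa [h]
    have hsub : Ico 0 b₀ ⊆ Ico 0 (max x b₀) := Ico_subset_Ico_right (le_max_right _ _)
    obtain ⟨a', b', hab'⟩ := exists_affine_of_mem_adjoint hd hq hw hm fun α β h =>
      hb' α β (ae_restrict_of_ae_restrict_of_subset hsub h)
    have h0 := hb' (a' - a) (b' - b) (by
      filter_upwards [hab, ae_restrict_of_ae_restrict_of_subset hsub hab'] with t h1 h2
      linear_combination h1 - h2)
    rw [sub_eq_zero, sub_eq_zero] at h0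
    rw [h0.1, h0.2] at hab'
    exact ae_restrict_of_ae_restrict_of_subset (Ico_subset_Ico_right (le_max_left _ _)) hab'
  have hsol := (IsIntegralSolution.linear hw (isIntegralSolution_R₁ a b) 1 1).congr
    (g' := q.2) (Eventually.of_forall fun t => by simp)
  have he : q.1 =ᵐ[S.dR₂] fun t => 1 * w₁ t + 1 * (a + b * (S.R₁ t : ℂ)) := by
    filter_upwards [hall] with t ht
    rw [ht, one_mul, one_mul]
  exact ⟨_, _, q.2, ⟨(Lp.memLp q.1).ae_eq he, Lp.memLp q.2, hsol⟩, he, Filter.EventuallyEq.rfl⟩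

theorem adjoint_Tmin (hd : S.NoCommonDiscontinuity) (hdef : S.IsDefinite)
    (hLP : S.IsLimitPoint) : S.Tmin.adjoint = S.Tmax := by
  rw [Tmin, adjoint_topologicalClosure]
  exact le_antisymm (adjoint_Tpre_le_Tmax hd hdef) (Tmax_le_adjoint_Tpre hd hdef hLP)

theorem Tmin_symmetric (hd : S.NoCommonDiscontinuity) (hdef : S.IsDefinite)
    (hLP : S.IsLimitPoint) : IsSymmetricRelation S.Tmin := by
  refine Submodule.topologicalClosure_minimal _ ?_ (isClosed_adjoint _)
  rw [adjoint_Tmin hd hdef hLP]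
  exact Tpre_le_Tmax

/-! ### Boundary values -/

theorem exists_boundaryValues (hdef : S.IsDefinite) (hT : S.Tmin.adjoint = S.Tmax) :
    ∃ Γ₀ Γ₁ : S.Tmin.adjoint →ₗ[ℂ] ℂ, S.AreBoundaryValues Γ₀ Γ₁ := by
  have hmem : ∀ p : S.Tmin.adjoint, ∃ u₁ u₂ f, S.Represents u₁ u₂ f p := fun p => by
    have hp : (p : S.L2 × S.L2) ∈ S.Tmax := hT.le p.2
    exact hp
  choose u₁ u₂ f hr using hmem
  refine ⟨⟨⟨fun p => u₂ p 0, fun p q => ?_⟩, fun a p => ?_⟩,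
    ⟨⟨fun p => -u₁ p 0, fun p q => ?_⟩, fun a p => ?_⟩, fun p v₁ v₂ g hv => ?_⟩
  · exact ((hr (p + q)).init_eq hdef ((hr p).add (hr q))).2
  · exact ((hr (a • p)).init_eq hdef ((hr p).smul a)).2
  · rw [((hr (p + q)).init_eq hdef ((hr p).add (hr q))).1, Pi.add_apply, neg_add]
  · change -u₁ (a • p) 0 = a * -u₁ p 0
    rw [((hr (a • p)).init_eq hdef ((hr p).smul a)).1, Pi.smul_apply, smul_eq_mul, mul_neg]
  · have := (hr p).init_eq hdef hv
    exact ⟨this.2, congrArg Neg.neg this.1⟩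

theorem star_smul_L2 (a : ℂ) (v : S.L2) : star (a • v) = conj a • star v := by
  apply Lp.ext
  filter_upwards [Lp.coeFn_star (a • v), Lp.coeFn_smul a v, Lp.coeFn_smul (conj a) (star v),
    Lp.coeFn_star v] with x e1 e2 e3 e4
  rw [e1, e3, Pi.star_apply, Pi.smul_apply, e2, e4, Pi.smul_apply, Pi.star_apply, smul_eq_mul,
    smul_eq_mul, star_mul, mul_comm]
  rfl

/-- The coefficients are real, so conjugation maps the defect space at `z` to that at `conj z`. Thus
one-dimensionality at a single point supplies both defect spaces. -/
theorem mem_Tmax_star {k : S.L2} {z : ℂ} (h : (k, z • k) ∈ S.Tmax) :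
    (star k, conj z • star k) ∈ S.Tmax := by
  obtain ⟨u₁, u₂, f, ⟨h1, h2, h3⟩, h4, h5⟩ := h
  refine ⟨_, _, _, ⟨h1.star, h2.star, h3.conj⟩, ?_, ?_⟩
  · filter_upwards [Lp.coeFn_star k, h4] with x e1 e2
    rw [e1, Pi.star_apply, e2]
    rfl
  · filter_upwards [Lp.coeFn_star k, h5, Lp.coeFn_smul z k, Lp.coeFn_smul (conj z) (star k)]
      with x e1 e2 e3 e4
    change (z • k : S.L2) x = f x at e2
    change (conj z • star k : S.L2) x = conj (f x)
    rw [e4, Pi.smul_apply, e1, Pi.star_apply, ← e2, e3, Pi.smul_apply, smul_eq_mul, smul_eq_mul,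
      map_mul]
    rfl

section BoundaryValues

variable (hd : S.NoCommonDiscontinuity) (hdef : S.IsDefinite) (hLP : S.IsLimitPoint)
  {Γ₀ Γ₁ : S.Tmin.adjoint →ₗ[ℂ] ℂ} (hΓ : S.AreBoundaryValues Γ₀ Γ₁)
include hd hdef hLP hΓ

theorem AreBoundaryValues.exists_compact (α β : ℂ) :
    ∃ p : S.Tmin.adjoint, Γ₀ p = β ∧ Γ₁ p = -α ∧
      ∃ l ∈ S.I, ∃ u₁ u₂ f, S.Represents u₁ u₂ f p ∧ u₁ 0 = α ∧ u₂ 0 = β ∧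
        ∀ᵐ x ∂S.dR₂, l < x → u₁ x = 0 ∧ f x = 0 := by
  obtain ⟨l, hl, u₁, u₂, f, hm, h1, h2, hs⟩ := exists_compact_init hd hdef α β
  have hp : (hm.1.toLp u₁, hm.2.1.toLp f) ∈ S.Tmin.adjoint := by
    rw [adjoint_Tmin hd hdef hLP]
    exact ⟨_, _, _, hm.represents⟩
  refine ⟨⟨_, hp⟩, ?_, ?_, l, hl, u₁, u₂, f, hm.represents, h1, h2, hs⟩
  · rw [(hΓ ⟨_, hp⟩ _ _ _ hm.represents).1, h2]
  · rw [(hΓ ⟨_, hp⟩ _ _ _ hm.represents).2, h1]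

theorem AreBoundaryValues.green_compact {p q : S.Tmin.adjoint} {l : ℝ} (hl : l ∈ S.I)
    {u₁ u₂ f : ℝ → ℂ} (hu : S.Represents u₁ u₂ f p)
    (hs : ∀ᵐ x ∂S.dR₂, l < x → u₁ x = 0 ∧ f x = 0) :
    inner ℂ (q : S.L2 × S.L2).1 (p : S.L2 × S.L2).2
      - inner ℂ (q : S.L2 × S.L2).2 (p : S.L2 × S.L2).1
      = Γ₁ p * conj (Γ₀ q) - Γ₀ p * conj (Γ₁ q) := by
  obtain ⟨v₁, v₂, g, hv⟩ := (adjoint_Tmin hd hdef hLP).le q.2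
  rw [green_of_compact hd hdef hLP hu hv hl hs, (hΓ p _ _ _ hu).1, (hΓ p _ _ _ hu).2,
    (hΓ q _ _ _ hv).1, (hΓ q _ _ _ hv).2, map_neg]
  ring

/-- Values at `0` need no continuity argument: pairing with compactly supported elements with
arbitrary boundary values, and using that `t` is in `T`, kills both functionals. -/
theorem AreBoundaryValues.eq_zero_of_mem_Tmin {t : S.Tmin.adjoint}
    (ht : (t : S.L2 × S.L2) ∈ S.Tmin) : Γ₀ t = 0 ∧ Γ₁ t = 0 := by
  have key : ∀ α β : ℂ, -α * conj (Γ₀ t) - β * conj (Γ₁ t) = 0 := by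
    intro α β
    obtain ⟨p, h0, h1, l, hl, u₁, u₂, f, hu, -, -, hs⟩ := hΓ.exists_compact hd hdef hLP α β
    have h := hΓ.green_compact hd hdef hLP (q := t) hl hu hs
    rw [h0, h1] at h
    rw [← h, sub_eq_zero]
    have h2 := congrArg conj (mem_adjoint_iff_inner.1 p.2 _ ht)
    rw [inner_conj_symm, inner_conj_symm] at h2
    exact h2.symm
  have k1 := key 1 0
  have k2 := key 0 1
  constructor
  · exact (map_eq_zero (starRingEnd ℂ)).1 (by simpa using k1)
  · exact (map_eq_zero (starRingEnd ℂ)).1 (by simpa using k2)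

/-- Modulo `T` the space `T*` is spanned by two vectors, and the boundary map on it is still onto
`ℂ²`. A surjection `ℂ² → ℂ²` is injective, so zero boundary values leave no defect component. -/
theorem AreBoundaryValues.mem_Tmin {p : S.Tmin.adjoint} (h₀ : Γ₀ p = 0) (h₁ : Γ₁ p = 0) :
    (p : S.L2 × S.L2) ∈ S.Tmin := by
  have hT := adjoint_Tmin hd hdef hLP
  have hsym := Tmin_symmetric hd hdef hLP
  obtain ⟨z, hz, hrank⟩ := id hLP
  obtain ⟨v, -, hv⟩ := finrank_eq_one_iff'.1 hrank
  have hn : ∀ n : S.L2, (n, z • n) ∈ S.Tmin.adjoint → ∃ a : ℂ, n = a • (v : S.L2) := by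
    intro n hn
    rw [hT] at hn
    obtain ⟨a, ha⟩ := hv ⟨n, hn⟩
    exact ⟨a, (congrArg Subtype.val ha).symm⟩
  have hk : ∀ k : S.L2, (k, conj z • k) ∈ S.Tmin.adjoint → ∃ a : ℂ, k = a • star (v : S.L2) := by
    intro k hk
    rw [hT] at hk
    have := mem_Tmax_star hk
    rw [Complex.conj_conj] at this
    obtain ⟨a, ha⟩ := hv ⟨star k, this⟩
    have ha' : a • (v : S.L2) = star k := congrArg Subtype.val ha
    refine ⟨conj a, ?_⟩
    rw [← star_star k, ← ha', star_smul_L2]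
  have hP : ((v : S.L2), z • (v : S.L2)) ∈ S.Tmin.adjoint := by
    rw [hT]
    exact v.2
  have hQ : (star (v : S.L2), conj z • star (v : S.L2)) ∈ S.Tmin.adjoint := by
    rw [hT]
    exact mem_Tmax_star v.2
  have hdec : ∀ p : S.Tmin.adjoint, ∃ (t : S.Tmin.adjoint) (a b : ℂ),
      (t : S.L2 × S.L2) ∈ S.Tmin ∧ p = t + (a • ⟨_, hP⟩ + b • ⟨_, hQ⟩) := by
    intro p
    obtain ⟨t, ht, n, k, h1, h2, h3⟩ :=
      exists_vonNeumann S.Tpre.isClosed_topologicalClosure hsym hz p.2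
    obtain ⟨a, rfl⟩ := hn n h1
    obtain ⟨b, rfl⟩ := hk k h2
    refine ⟨⟨t, hsym ht⟩, a, b, ht, Subtype.ext ?_⟩
    rw [h3, add_assoc]
    simp only [Submodule.coe_add, Submodule.coe_smul, Prod.smul_mk, smul_comm z, smul_comm (conj z)]
  let G : ℂ × ℂ →ₗ[ℂ] ℂ × ℂ := (Γ₀.prod Γ₁).comp
    ((LinearMap.fst ℂ ℂ ℂ).smulRight (⟨_, hP⟩ : S.Tmin.adjoint)
      + (LinearMap.snd ℂ ℂ ℂ).smulRight (⟨_, hQ⟩ : S.Tmin.adjoint))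
  have hG : ∀ (t : S.Tmin.adjoint) (a b : ℂ), (t : S.L2 × S.L2) ∈ S.Tmin →
      G (a, b) = (Γ₀ (t + (a • ⟨_, hP⟩ + b • ⟨_, hQ⟩)), Γ₁ (t + (a • ⟨_, hP⟩ + b • ⟨_, hQ⟩))) := by
    intro t a b ht
    obtain ⟨h0, h1⟩ := hΓ.eq_zero_of_mem_Tmin hd hdef hLP ht
    rw [map_add Γ₀ t, map_add Γ₁ t, h0, h1, zero_add, zero_add]
    rfl
  have hsurj : Function.Surjective G := by
    rintro ⟨β, α⟩
    obtain ⟨p, h0, h1, -⟩ := hΓ.exists_compact hd hdef hLP (-α) β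
    obtain ⟨t, a, b, ht, rfl⟩ := hdec p
    exact ⟨(a, b), by rw [hG t a b ht, h0, h1, neg_neg]⟩
  obtain ⟨t, a, b, ht, rfl⟩ := hdec p
  have h := hG t a b ht
  rw [h₀, h₁] at h
  have hab := (injective_iff_map_eq_zero G).1 (LinearMap.injective_iff_surjective.2 hsurj) _ h
  obtain ⟨rfl, rfl⟩ := Prod.mk.inj hab
  simpa using ht

/-- A compactly supported `e` with the boundary values of `p` satisfies Green's identity, and `p -
e` lies in `T`, where both sides vanish against `q` in `T*`. -/
theorem AreBoundaryValues.isBoundaryTriple : IsBoundaryTriple S.Tmin Γ₀ Γ₁ := by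
  constructor
  · intro p q
    obtain ⟨e, h0, h1, l, hl, u₁, u₂, f, hu, -, -, hs⟩ :=
      hΓ.exists_compact hd hdef hLP (-Γ₁ p) (Γ₀ p)
    rw [neg_neg] at h1
    have ht := hΓ.mem_Tmin hd hdef hLP (p := p - e) (by rw [map_sub, h0, sub_self])
      (by rw [map_sub, h1, sub_self])
    have hG := hΓ.green_compact hd hdef hLP (q := q) hl hu hs
    have h2 := mem_adjoint_iff_inner.1 q.2 _ ht
    simp only [AddSubgroupClass.coe_sub, Prod.fst_sub, Prod.snd_sub, inner_sub_right] at h2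
    rw [h0, h1] at hG
    rw [← hG]
    linear_combination h2
  · rintro ⟨β, α⟩
    obtain ⟨p, h0, h1, -⟩ := hΓ.exists_compact hd hdef hLP (-α) β
    exact ⟨p, by simp only [h0, h1, neg_neg]⟩

/-- Write `p = t + e` with `t` in `T` and `e` compactly supported. Replacing `t` by elements of
`Tpre` leaves the boundary values alone, so the energy identity gives the inequality, which is
closed in `t`. -/
theorem AreBoundaryValues.nonneg (p : S.Tmin.adjoint) :
    0 ≤ (inner ℂ (p : S.L2 × S.L2).1 (p : S.L2 × S.L2).2).re + (Γ₁ p * conj (Γ₀ p)).re := by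
  obtain ⟨e, h0, h1, l, hl, u₁, u₂, f, hu, hu1, hu2, hs⟩ :=
    hΓ.exists_compact hd hdef hLP (-Γ₁ p) (Γ₀ p)
  rw [neg_neg] at h1
  have ht := hΓ.mem_Tmin hd hdef hLP (p := p - e) (by rw [map_sub, h0, sub_self])
    (by rw [map_sub, h1, sub_self])
  have hc : IsClosed {x : S.L2 × S.L2 | 0 ≤ (inner ℂ (x + e).1 (x + e).2).re
      + (Γ₁ p * conj (Γ₀ p)).re} := by
    refine isClosed_le continuous_const ((Complex.continuous_re.comp ?_).add continuous_const)
    fun_prop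
  have hpre : (S.Tpre : Set (S.L2 × S.L2)) ⊆ {x : S.L2 × S.L2 | 0 ≤ (inner ℂ (x + e).1 (x + e).2).re
      + (Γ₁ p * conj (Γ₀ p)).re} := by
    rintro x ⟨v₁, v₂, g, hv, hv1, hv2, m, hm, hms⟩
    have hmax : max l m ∈ S.I := by
      rcases max_choice l m with h | h <;> rwa [h]
    obtain ⟨D, hD, hE⟩ := energy_of_compact hd hdef hLP (hv.add hu) hmax (by
      filter_upwards [hs, hms] with _ k1 k2 hlt
      obtain ⟨a1, a2⟩ := k1 ((le_max_left _ _).trans_lt hlt)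
      obtain ⟨b1, b2⟩ := k2 ((le_max_right _ _).trans_lt hlt)
      simp [a1, a2, b1, b2])
    suffices h : 0 ≤ (inner ℂ (x + e).1 (x + e).2).re + (Γ₁ p * conj (Γ₀ p)).re from h
    rw [hE, Pi.add_apply, Pi.add_apply, hv1, hv2, hu1, hu2, zero_add, zero_add]
    simp
    linarith
  have := closure_minimal hpre hc ht
  simpa using this

theorem AreBoundaryValues.isNonnegTriple : IsNonnegTriple S.Tmin Γ₀ Γ₁ :=
  ⟨hΓ.isBoundaryTriple hd hdef hLP,
    fun _ ht => mem_kernelRelation.2 ⟨Tmin_symmetric hd hdef hLP ht,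
      (hΓ.eq_zero_of_mem_Tmin hd hdef hLP ht).1⟩, hΓ.nonneg hd hdef hLP⟩

theorem AreBoundaryValues.isNonnegativeRelation : IsNonnegativeRelation S.Tmin := by
  intro u f h
  have hsym := Tmin_symmetric hd hdef hLP
  refine ⟨?_, im_inner_eq_zero_of_eq (hsym.inner_eq h h)⟩
  have h0 := (hΓ.eq_zero_of_mem_Tmin hd hdef hLP (t := ⟨_, hsym h⟩) h).1
  have := hΓ.nonneg hd hdef hLP ⟨_, hsym h⟩
  simpa [h0] using this

end BoundaryValues

/-! ### The end `b` -/

theorem eventually_toEnd {y : ℝ} (hy : y ∈ S.I) : ∀ᶠ x in S.toEnd, x ∈ S.I ∧ y < x := by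
  have : Ioo (y : EReal) S.b ∈ 𝓝[<] S.b := Ioo_mem_nhdsLT hy.2
  filter_upwards [preimage_mem_comap this] with x hx
  have hyx : y < x := EReal.coe_lt_coe_iff.1 hx.1
  exact ⟨⟨hy.1.trans hyx.le, hx.2⟩, hyx⟩

theorem tendsto_toEnd {c : ℕ → ℝ} (hc1 : Monotone c) (hc : ∀ n, c n ∈ S.I)
    (hc' : ∀ x ∈ S.I, ∃ n, x < c n) : Tendsto c atTop S.toEnd := by
  rw [toEnd, tendsto_comap_iff, tendsto_nhdsWithin_iff]
  refine ⟨tendsto_order.2 ⟨fun a ha => ?_, fun a ha => ?_⟩, Eventually.of_forall fun n => (hc n).2⟩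
  · obtain ⟨y, h1, h2⟩ := EReal.lt_iff_exists_real_btwn.1 (max_lt ha S.b_pos)
    have h0 : (0 : ℝ) < y := EReal.coe_lt_coe_iff.1 ((le_max_right a 0).trans_lt h1)
    obtain ⟨N, hN⟩ := hc' y ⟨h0.le, h2⟩
    filter_upwards [eventually_ge_atTop N] with n hn
    exact (le_max_left a 0).trans_lt (h1.trans (EReal.coe_lt_coe_iff.2 (hN.trans_le (hc1 hn))))
  · exact Eventually.of_forall fun n => (hc n).2.trans ha

theorem dR₂_univ_of_tendsto {M : ℝ} (h : Tendsto S.R₂ S.toEnd (𝓝 M)) :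
    S.dR₂ univ = ENNReal.ofReal M ∧ 0 ≤ M := by
  obtain ⟨c, hc1, hc, hc'⟩ := exists_seq_halfOpen S.b_pos
  have ht := h.comp (tendsto_toEnd hc1 hc hc')
  refine ⟨?_, ge_of_tendsto' ht fun n => R₂_nonneg (hc n)⟩
  have h1 : Tendsto (fun n => S.dR₂ (Ico 0 (c n))) atTop (𝓝 (S.dR₂ (⋃ n, Ico 0 (c n)))) :=
    tendsto_measure_iUnion_atTop fun m n hmn => Ico_subset_Ico_right (hc1 hmn)
  have h2 : S.dR₂ (⋃ n, Ico 0 (c n)) = S.dR₂ univ := by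
    refine measure_congr ?_
    filter_upwards [ae_mem₂] with x hx
    obtain ⟨n, hn⟩ := hc' x hx
    exact propext ⟨fun _ => trivial, fun _ => mem_iUnion.2 ⟨n, hx.1, hn⟩⟩
  rw [h2] at h1
  refine tendsto_nhds_unique h1 ((ENNReal.tendsto_ofReal ht).congr fun n => ?_)
  exact (dR₂_Ico_zero (hc n)).symm

theorem exists_lt_integral_of_not_memLp {u : ℝ → ℂ} (hm : AEStronglyMeasurable u S.dR₂)
    (hu : ¬ MemLp u 2 S.dR₂) (hloc : ∀ x ∈ S.I, MemLp u 2 (S.dR₂.restrict (Ico 0 x))) (B : ℝ) :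
    ∃ x ∈ S.I, B < ∫ t in Ico 0 x, ‖u t‖ ^ 2 ∂S.dR₂ := by
  by_contra! hB
  obtain ⟨c, hc1, hc, hc'⟩ := exists_seq_halfOpen S.b_pos
  have hcov : AECover S.dR₂ atTop fun n => Ico 0 (c n) := by
    refine ⟨?_, fun n => measurableSet_Ico⟩
    filter_upwards [ae_mem₂] with x hx
    obtain ⟨N, hN⟩ := hc' x hx
    filter_upwards [eventually_ge_atTop N] with n hn
    exact ⟨hx.1, hN.trans_le (hc1 hn)⟩
  refine hu ((memLp_two_iff_integrable_sq_norm hm).2 ?_)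
  refine hcov.integrable_of_integral_norm_bounded B
    (fun n => (memLp_two_iff_integrable_sq_norm hm.restrict).1 (hloc _ (hc n)))
    (Eventually.of_forall fun n => ?_)
  simpa using hB _ (hc n)

/-! ### Solutions that vanish at a point -/

/-- The energy identity reads `D - z E = -conj (u₁ 0) u₂ 0` with `D, E ≥ 0`. If `E > 0`, the left
side has modulus `E |D/E - z|`, at least `E` times the distance from `z` to `[0, ∞)`. -/
theorem IsSolution.infDist_mul_le (hd : S.NoCommonDiscontinuity) {z : ℂ} {u₁ u₂ : ℝ → ℂ}
    (h : S.IsSolution z u₁ u₂) {x : ℝ} (hx : x ∈ S.I) (hux : u₁ x = 0) :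
    Metric.infDist z cutPlaneᶜ * ∫ t in Ico 0 x, ‖u₁ t‖ ^ 2 ∂S.dR₂ ≤ ‖u₁ 0‖ * ‖u₂ 0‖ := by
  have hm := (IsIntegralSolution.conj h).mul_eq hd h hx |>.2.2
  set E := ∫ t in Ico 0 x, ‖u₁ t‖ ^ 2 ∂S.dR₂ with hE
  set D := ∫ t in Ico 0 x, ‖u₂ t‖ ^ 2 ∂S.dR₁ with hD
  have hE0 : 0 ≤ E := integral_nonneg fun t => sq_nonneg _
  have hD0 : 0 ≤ D := integral_nonneg fun t => sq_nonneg _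
  have e1 : ∫ t in Ico 0 x, conj (u₂ t) * u₂ t ∂S.dR₁ = D := by
    rw [hD, ← integral_complex_ofReal]
    congr 1
    ext t
    rw [Complex.conj_mul', Complex.ofReal_pow]
  have e2 : ∫ t in Ico 0 x, conj (u₁ t) * (z * u₁ t) ∂S.dR₂ = z * E := by
    rw [hE, ← integral_complex_ofReal, ← integral_const_mul]
    congr 1
    ext t
    rw [mul_left_comm, Complex.conj_mul', Complex.ofReal_pow]
  rw [hux, map_zero, zero_mul, e1, e2] at hm
  have e3 : ‖(D : ℂ) - z * E‖ = ‖u₁ 0‖ * ‖u₂ 0‖ := by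
    rw [show (D : ℂ) - z * E = -(conj (u₁ 0) * u₂ 0) by linear_combination -hm, norm_neg, norm_mul,
      RCLike.norm_conj]
  rw [← e3]
  rcases hE0.eq_or_lt with h0 | h0
  · rw [← h0, mul_zero]
    exact norm_nonneg _
  · have := infDist_cutPlane_le z (div_nonneg hD0 hE0)
    refine (mul_le_mul_of_nonneg_right this hE0).trans_eq ?_
    have hE' : (E : ℂ) ≠ 0 := Complex.ofReal_ne_zero.2 h0.ne'
    nth_rw 2 [← Real.norm_of_nonneg hE0]
    rw [← Complex.norm_real, ← norm_mul, sub_mul, Complex.ofReal_div, div_mul_cancel₀ _ hE']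

/-! ### The Weyl solution in terms of `c`, `s`, and the limit of `s₁ / c₁`. -/

section FundamentalSystem

variable (hd : S.NoCommonDiscontinuity)

-- Constancy of the three Wronskians determines the expansion pointwise, which replaces a uniqueness
-- theorem for the initial value problem.
include hd in
theorem IsSolution.eq_fundamental {z : ℂ} {c₁ c₂ s₁ s₂ u₁ u₂ : ℝ → ℂ}
    (hc : S.IsSolution z c₁ c₂) (hc1 : c₁ 0 = 1) (hc2 : c₂ 0 = 0)
    (hs : S.IsSolution z s₁ s₂) (hs1 : s₁ 0 = 0) (hs2 : s₂ 0 = 1)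
    (hu : S.IsSolution z u₁ u₂) {x : ℝ} (hx : x ∈ S.I) :
    u₁ x = u₁ 0 * c₁ x + u₂ 0 * s₁ x := by
  have key : ∀ {v₁ v₂ w₁ w₂ : ℝ → ℂ}, S.IsSolution z v₁ v₂ → S.IsSolution z w₁ w₂ →
      v₁ x * w₂ x - v₂ x * w₁ x = v₁ 0 * w₂ 0 - v₂ 0 * w₁ 0 := by
    intro v₁ v₂ w₁ w₂ hv hw
    have := IsIntegralSolution.wronskian_eq hd hv hw hx
    simp only [mul_left_comm (v₁ _) z, mul_assoc] at this
    rw [this, sub_self, add_zero]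
  have k1 := key hc hs
  have k2 := key hu hs
  have k3 := key hc hu
  rw [hc1, hc2, hs1, hs2] at k1
  rw [hs1, hs2] at k2
  rw [hc1, hc2] at k3
  linear_combination -u₁ x * k1 + c₁ x * k2 + s₁ x * k3

variable (hdef : S.IsDefinite) (hLP : S.IsLimitPoint)
  {Γ₀ Γ₁ : S.Tmin.adjoint →ₗ[ℂ] ℂ} (hΓ : S.AreBoundaryValues Γ₀ Γ₁)
  {c₁ c₂ s₁ s₂ : ℂ → ℝ → ℂ} (hF : S.IsFundamentalSystem c₁ c₂ s₁ s₂)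
include hd hdef hLP hΓ hF

theorem AreBoundaryValues.weylSolution_ae_eq {z : ℂ} (hz : z ∈ cutPlane) :
    (weylSolution Γ₀ z : S.L2 × S.L2).1
      =ᵐ[S.dR₂] fun x => s₁ z x - weylFn Γ₀ Γ₁ z * c₁ z x := by
  have hs := (hΓ.isNonnegTriple hd hdef hLP).weylSolution_spec hz
  obtain ⟨u₁, u₂, f, hu⟩ := (adjoint_Tmin hd hdef hLP).le (weylSolution Γ₀ z).2
  obtain ⟨h0, h1⟩ := hΓ _ _ _ _ hu
  rw [hs.2] at h0
  have hsol : S.IsSolution z u₁ u₂ := by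
    refine hu.1.2.2.congr ?_
    filter_upwards [hu.2.1, hu.2.2, Lp.coeFn_smul z (weylSolution Γ₀ z : S.L2 × S.L2).1]
      with x e1 e2 e3
    rw [← e2, hs.1, e3, Pi.smul_apply, e1, smul_eq_mul]
  obtain ⟨⟨kc, kc1, kc2⟩, ks, ks1, ks2⟩ := hF z
  filter_upwards [hu.2.1, ae_mem₂] with x hx hI
  rw [hx, IsSolution.eq_fundamental hd kc kc1 kc2 ks ks1 ks2 hsol hI, ← h0,
    show u₁ 0 = -weylFn Γ₀ Γ₁ z by rw [weylFn, h1, neg_neg]]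
  ring

theorem AreBoundaryValues.memLp_weylSolution {z : ℂ} (hz : z ∈ cutPlane) :
    MemLp (fun x => s₁ z x - weylFn Γ₀ Γ₁ z * c₁ z x) 2 S.dR₂ :=
  (Lp.memLp _).ae_eq (hΓ.weylSolution_ae_eq hd hdef hLP hF hz)

/-- As `c₂(0) = 0`, a square integrable `c₁` would be an eigenvector of `ker Γ₀` at a regular point.
-/
theorem AreBoundaryValues.not_memLp {z : ℂ} (hz : z ∈ cutPlane) : ¬ MemLp (c₁ z) 2 S.dR₂ := by
  intro hc
  obtain ⟨⟨kc, kc1, kc2⟩, -⟩ := hF z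
  have hr := kc.represents hc
  have hm : (hc.toLp (c₁ z), z • hc.toLp (c₁ z)) ∈ S.Tmin.adjoint := by
    rw [adjoint_Tmin hd hdef hLP]
    exact ⟨_, _, _, hr⟩
  have h0 := (hΓ ⟨_, hm⟩ _ _ _ hr).1
  rw [kc2] at h0
  have h1 := (hΓ.isNonnegTriple hd hdef hLP).eq_zero hz (mem_kernelRelation.2 ⟨hm, h0⟩)
  rw [Lp.eq_zero_iff_ae_eq_zero] at h1
  have := (kc.init_eq_zero hdef (hc.coeFn_toLp.symm.trans h1)).1
  exact one_ne_zero (kc1.symm.trans this)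

theorem AreBoundaryValues.isNeumannFunction : S.IsNeumannFunction c₁ s₁ (weylFn Γ₀ Γ₁) := by
  intro z hz w
  have hz' := mem_cutPlane_of_im_ne hz
  have hm := hΓ.memLp_weylSolution hd hdef hLP hF hz'
  refine ⟨fun hw => ?_, fun h => h ▸ hm⟩
  by_contra hne
  refine hΓ.not_memLp hd hdef hLP hF hz' ?_
  have h1 := (hm.sub hw).const_mul (w - weylFn Γ₀ Γ₁ z)⁻¹
  refine h1.ae_eq (Eventually.of_forall fun x => ?_)
  have : w - weylFn Γ₀ Γ₁ z ≠ 0 := sub_ne_zero.2 hne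
  simp only [Pi.sub_apply]
  field_simp
  ring

theorem AreBoundaryValues.tendsto_div {z : ℂ} (hz : z ∈ cutPlane) :
    Tendsto (fun x => s₁ z x / c₁ z x) S.toEnd (𝓝 (weylFn Γ₀ Γ₁ z)) := by
  obtain ⟨⟨kc, kc1, kc2⟩, ks, ks1, ks2⟩ := hF z
  set m := weylFn Γ₀ Γ₁ z with hm
  set d := Metric.infDist z cutPlaneᶜ with hd'
  have hd0 : 0 < d := infDist_cutPlane_pos hz
  have hψ := hΓ.memLp_weylSolution hd hdef hLP hF hz
  have hψi := (memLp_two_iff_integrable_sq_norm hψ.1).1 hψ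
  set N := ∫ t, ‖s₁ z t - m * c₁ z t‖ ^ 2 ∂S.dR₂ with hN
  have hN0 : 0 ≤ N := integral_nonneg fun t => sq_nonneg _
  have hcm : AEStronglyMeasurable (c₁ z) S.dR₂ :=
    IsIntegralSolution.aestronglyMeasurable₁ kc ae_mem₂
  have hci : ∀ x ∈ S.I, IntegrableOn (fun t => ‖c₁ z t‖ ^ 2) (Ico 0 x) S.dR₂ := fun x hx =>
    (memLp_two_iff_integrable_sq_norm hcm.restrict).1 (IsIntegralSolution.memLp₁ kc hx 2)
  rw [Metric.tendsto_nhds]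
  intro ε hε
  -- With `δ = |w - m|` and `K` the squared norm of `c₁` on `[0, x)`, the estimate below is `δ² K ≤
  -- 2 (δ + |m|)/d + 2 N`. Dividing by `δ ≥ ε` bounds `δ K` by `2/d + (2|m|/d + 2N)/ε`; the
  -- threshold contradicts this.
  obtain ⟨y, hy, hB⟩ := exists_lt_integral_of_not_memLp hcm (hΓ.not_memLp hd hdef hLP hF hz)
    (fun x hx => IsIntegralSolution.memLp₁ kc hx 2) ((2 / d + (2 * ‖m‖ / d + 2 * N) / ε) / ε)
  filter_upwards [eventually_toEnd hy] with x ⟨hx, hyx⟩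
  have hK : (2 / d + (2 * ‖m‖ / d + 2 * N) / ε) / ε < ∫ t in Ico 0 x, ‖c₁ z t‖ ^ 2 ∂S.dR₂ :=
    hB.trans_le (setIntegral_mono_set (hci x hx) (Eventually.of_forall fun _ => sq_nonneg _)
      (Ico_subset_Ico_right hyx.le).eventuallyLE)
  set K := ∫ t in Ico 0 x, ‖c₁ z t‖ ^ 2 ∂S.dR₂ with hKdef
  have hK0 : 0 < K := lt_of_le_of_lt (by positivity) hK
  have hcx : c₁ z x ≠ 0 := by
    intro h0
    have := IsSolution.infDist_mul_le hd kc hx h0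
    rw [kc2, norm_zero, mul_zero] at this
    exact absurd (mul_pos hd0 hK0) (not_lt.2 this)
  set w := s₁ z x / c₁ z x with hw
  -- The solution `s - w c` has initial values `(-w, 1)` and first component zero at `x`, so its
  -- energy bound is `|w|`.
  have hχ := IsSolution.linear ks kc 1 (-w)
  have hE := IsSolution.infDist_mul_le hd hχ hx (by
    rw [hw]
    field_simp
    ring)
  simp only [ks1, kc1, ks2, kc2, mul_one, mul_zero, add_zero, zero_add, norm_neg, norm_one] at hE
  have hχi : IntegrableOn (fun t => ‖1 * s₁ z t + -w * c₁ z t‖ ^ 2) (Ico 0 x) S.dR₂ :=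
    (memLp_two_iff_integrable_sq_norm (IsIntegralSolution.aestronglyMeasurable₁ hχ
      ae_mem₂).restrict).1 (IsIntegralSolution.memLp₁ hχ hx 2)
  set E := ∫ t in Ico 0 x, ‖1 * s₁ z t + -w * c₁ z t‖ ^ 2 ∂S.dR₂ with hEdef
  -- The function `(w - m) c₁` is the difference of the Weyl solution and `s₁ - w c₁`.
  have hmain : ‖w - m‖ ^ 2 * K ≤ 2 * E + 2 * N := by
    have h1 : ‖w - m‖ ^ 2 * K ≤ ∫ t in Ico 0 x, (2 * ‖1 * s₁ z t + -w * c₁ z t‖ ^ 2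
        + 2 * ‖s₁ z t - m * c₁ z t‖ ^ 2) ∂S.dR₂ := by
      rw [hKdef, ← integral_const_mul]
      refine integral_mono ((hci x hx).const_mul _)
        ((hχi.const_mul 2).add (hψi.integrableOn.const_mul 2)) fun t => ?_
      have e : (w - m) * c₁ z t = (s₁ z t - m * c₁ z t) - (1 * s₁ z t + -w * c₁ z t) := by ring
      have h2 := norm_sub_le (s₁ z t - m * c₁ z t) (1 * s₁ z t + -w * c₁ z t)
      rw [← e] at h2
      simp only
      rw [← mul_pow, ← norm_mul]
      nlinarith [norm_nonneg ((w - m) * c₁ z t), sq_nonneg (‖s₁ z t - m * c₁ z t‖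
        - ‖1 * s₁ z t + -w * c₁ z t‖)]
    rw [integral_add (hχi.const_mul 2) (hψi.integrableOn.const_mul 2), integral_const_mul,
      integral_const_mul] at h1
    have h3 : ∫ t in Ico 0 x, ‖s₁ z t - m * c₁ z t‖ ^ 2 ∂S.dR₂ ≤ N :=
      setIntegral_le_integral hψi (Eventually.of_forall fun _ => sq_nonneg _)
    linarith
  rw [dist_eq_norm]
  by_contra! hδ
  set δ := ‖w - m‖
  have hw' : ‖w‖ ≤ δ + ‖m‖ := norm_le_norm_sub_add w m
  have hE' : E ≤ (δ + ‖m‖) / d := by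
    rw [le_div_iff₀ hd0, mul_comm]
    exact hE.trans hw'
  have h1 : δ ^ 2 * K ≤ 2 / d * δ + (2 * ‖m‖ / d + 2 * N) := by
    refine hmain.trans ?_
    have : 2 * ((δ + ‖m‖) / d) = 2 / d * δ + 2 * ‖m‖ / d := by ring
    linarith
  have hδ0 : 0 < δ := hε.trans_le hδ
  have h2 : 2 * ‖m‖ / d + 2 * N ≤ (2 * ‖m‖ / d + 2 * N) / ε * δ := by
    rw [div_mul_eq_mul_div, le_div_iff₀ hε]
    exact mul_le_mul_of_nonneg_left hδ (by positivity)
  have h3 : δ * K ≤ 2 / d + (2 * ‖m‖ / d + 2 * N) / ε := by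
    refine le_of_mul_le_mul_left ?_ hδ0
    nlinarith
  rw [div_lt_iff₀ hε] at hK
  nlinarith [mul_le_mul_of_nonneg_left hδ hK0.le]

end FundamentalSystem

/-! ### Finite total mass of `dR₂` -/

section FiniteMass

variable (hd : S.NoCommonDiscontinuity) (hdef : S.IsDefinite) (hLP : S.IsLimitPoint)
  {Γ₀ Γ₁ : S.Tmin.adjoint →ₗ[ℂ] ℂ} (hΓ : S.AreBoundaryValues Γ₀ Γ₁)
include hd hdef hLP hΓ

/-- The constant `1` solves the system with `f = 0` and boundary values `(0, -1)`. Any element of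
`ker A₀` is affine in `R₁` with slope `u₂(0) = 0`, hence constant. -/
theorem AreBoundaryValues.exists_constant {M : ℝ} (hM : Tendsto S.R₂ S.toEnd (𝓝 M)) :
    ∃ (e : S.L2) (q : S.Tmin.adjoint), (q : S.L2 × S.L2) = (e, 0) ∧ Γ₀ q = 0 ∧ Γ₁ q = -1 ∧
      ‖e‖ ^ 2 = M ∧ ∀ u : S.L2, (u, 0) ∈ kernelRelation Γ₀ → ∃ a : ℂ, u = a • e := by
  obtain ⟨hu, hM0⟩ := dR₂_univ_of_tendsto hM
  have : IsFiniteMeasure S.dR₂ := ⟨by rw [hu]; exact ENNReal.ofReal_lt_top⟩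
  have h1 : MemLp (fun _ : ℝ => (1 : ℂ)) 2 S.dR₂ := memLp_const 1
  have hsol : S.IsIntegralSolution (fun _ => 1) (fun _ => 0) 0 := by
    simpa using isIntegralSolution_R₁ (S := S) 1 0
  have hr : S.Represents (fun _ => 1) (fun _ => 0) 0 (h1.toLp _, 0) :=
    ⟨⟨h1, MemLp.zero, hsol⟩, h1.coeFn_toLp, Lp.coeFn_zero _ _ _⟩
  have hm : ((h1.toLp _, 0) : S.L2 × S.L2) ∈ S.Tmin.adjoint := by
    rw [adjoint_Tmin hd hdef hLP]
    exact ⟨_, _, _, hr⟩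
  obtain ⟨h0, h2⟩ := hΓ ⟨_, hm⟩ _ _ _ hr
  refine ⟨_, ⟨_, hm⟩, rfl, h0, h2, ?_, fun u hu => ?_⟩
  · have h3 : inner ℂ (h1.toLp _ : S.L2) (h1.toLp _) = (M : ℂ) := by
      rw [inner_eq_integral h1.coeFn_toLp h1.coeFn_toLp]
      simp [Measure.real, hu, hM0]
    rw [inner_self_eq_norm_sq_to_K] at h3
    have := congrArg Complex.re h3
    simpa [← Complex.ofReal_pow] using this
  · obtain ⟨hm', h3⟩ := mem_kernelRelation.1 hu
    obtain ⟨u₁, u₂, f, hf⟩ := (adjoint_Tmin hd hdef hLP).le hm'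
    have h4 := (hΓ ⟨_, hm'⟩ _ _ _ hf).1
    rw [h3] at h4
    refine ⟨u₁ 0, Lp.ext ?_⟩
    filter_upwards [hf.2.1, ae_mem₂, Lp.coeFn_smul (u₁ 0) (h1.toLp _ : S.L2), h1.coeFn_toLp]
      with x e1 hI e2 e3
    rw [e2, Pi.smul_apply, e3, smul_eq_mul, mul_one]
    change (u : ℝ → ℂ) x = u₁ x at e1
    rw [e1, (hf.1.2.2.eq_affine (hf.2.2.symm.trans (Lp.coeFn_zero _ _ _)) hI).1, ← h4, zero_mul,
      add_zero]

end FiniteMass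

end IntegralSystem

end

theorem mainTheorem4 (S : IntegralSystem) (hdisc : S.NoCommonDiscontinuity)
    (hdef : S.IsDefinite) (hLP : S.IsLimitPoint) :
    -- the adjoint of `T_min` is `T_max`; `T_min` is symmetric, nonnegative, with indices (1, 1)
    S.Tmin.adjoint = S.Tmax ∧
    IsSymmetricRelation S.Tmin ∧
    IsNonnegativeRelation S.Tmin ∧
    deficiencyPlus S.Tmin = 1 ∧ deficiencyMinus S.Tmin = 1 ∧
    -- the fundamental system exists
    (∃ c₁ c₂ s₁ s₂ : ℂ → ℝ → ℂ, S.IsFundamentalSystem c₁ c₂ s₁ s₂) ∧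
    -- the boundary triple
    ∃ Γ₀ Γ₁ : S.Tmin.adjoint →ₗ[ℂ] ℂ,
      S.AreBoundaryValues Γ₀ Γ₁ ∧
      IsBoundaryTriple S.Tmin Γ₀ Γ₁ ∧
      -- its Weyl function, which is defined on the whole of `ℂ \ [0, ∞)`
      (∀ z ∈ cutPlane, IsRegularPoint (kernelRelation Γ₀) z) ∧
      ∃ m : ℂ → ℂ, IsWeylFunction Γ₀ Γ₁ m ∧
        (∀ c₁ c₂ s₁ s₂ : ℂ → ℝ → ℂ, S.IsFundamentalSystem c₁ c₂ s₁ s₂ →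
          -- the Neumann function and the Weyl solution
          (∃ mN : ℂ → ℂ, S.IsNeumannFunction c₁ s₁ mN ∧
            ∀ z : ℂ, z.im ≠ 0 →
              (∃ ψ : S.L2, ψ =ᵐ[S.dR₂] (fun x => s₁ z x - mN z * c₁ z x) ∧
                eigenKernel S.Tmin.adjoint z = Submodule.span ℂ {ψ}) ∧
              m z = -((s₁ z 0 - mN z * c₁ z 0) / (s₂ z 0 - mN z * c₂ z 0)) ∧
              m z = mN z) ∧
          -- the principal Titchmarsh–Weyl coefficient
          (∀ z ∈ cutPlane, Tendsto (fun x => s₁ z x / c₁ z x) S.toEnd (𝓝 (m z)))) ∧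
        IsStieltjesFn m ∧
        -- the case of a finite limit `R₂(b)`
        (∀ M : ℝ, Tendsto S.R₂ S.toEnd (𝓝 M) →
          ∃ m' : ℂ → ℂ, IsStieltjesFn m' ∧
            (∀ z ∈ cutPlane, m z = -(1 / ((M : ℂ) * z)) + m' z) ∧
            Tendsto (fun y : ℝ => (y : ℂ) * m' ((y : ℂ) * Complex.I)) (𝓝[>] 0) (𝓝 0)) := by
  have hT := S.adjoint_Tmin hdisc hdef hLP
  obtain ⟨Γ₀, Γ₁, hΓ⟩ := IntegralSystem.exists_boundaryValues hdef hT
  have hN := hΓ.isNonnegTriple hdisc hdef hLP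
  have hrank := fun {z : ℂ} (hz : z.im ≠ 0) =>
    rank_eigenKernel_adjoint hN.triple (hN.isRegularPoint (mem_cutPlane_of_im_ne hz))
  refine ⟨hT, S.Tmin_symmetric hdisc hdef hLP, hΓ.isNonnegativeRelation hdisc hdef hLP,
    (hrank (z := Complex.I) (by simp)).2.2, (hrank (z := -Complex.I) (by simp)).2.2,
    S.exists_isFundamentalSystem, Γ₀, Γ₁, hΓ, hN.triple, fun z hz => hN.isRegularPoint hz,
    weylFn Γ₀ Γ₁, isWeylFunction_weylFn hN.triple, fun c₁ c₂ s₁ s₂ hF => ⟨⟨weylFn Γ₀ Γ₁,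
      hΓ.isNeumannFunction hdisc hdef hLP hF, fun z hz => ⟨⟨_,
        hΓ.weylSolution_ae_eq hdisc hdef hLP hF (mem_cutPlane_of_im_ne hz), (hrank hz).2.1⟩,
        ?_, rfl⟩⟩, fun z hz => hΓ.tendsto_div hdisc hdef hLP hF hz⟩,
    hN.isStieltjesFn_weylFn, fun M hM => ?_⟩
  · obtain ⟨⟨-, hc1, hc2⟩, -, hs1, hs2⟩ := hF z
    simp [hc1, hc2, hs1, hs2]
  · obtain ⟨e, q, hq, h0, h1, he, hker⟩ := hΓ.exists_constant hdisc hdef hLP hM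
    subst he
    exact ⟨_, hN.isStieltjesFn_weylFn_add hq h0 h1, fun z _ => by ring,
      hN.tendsto_mul_weylFn_add hq h0 h1 hker⟩
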